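/- **Setting.** Let $\mathcal S^0(\mathbb R^n)\subset\mathcal S(\mathbb R^n)$ be the closed subspace of the Schwartz functions all of whose derivatives vanish at $0$, and let $\mathcal S^{00}(\mathbb R^n)$ be its inverse image under the Fourier transform; both carry the topology of $\mathcal S(\mathbb R^n)$. A *single-particle test space* is $E=W\otimes\mathbb C^4$ with $W\in\{\mathcal S^0(\mathbb R^3),\mathcal S(\mathbb R^3)\}$, and a *space-time test space* is $\mathscr E=X\otimes\mathbb C^4$ with $X\in\{\mathcal S^{00}(\mathbb R^4),\mathcal S(\mathbb R^4)\}$. $E^*,\mathscr E^*$ are the strong duals, and $\mathscr L(F,G)$ is the space of continuous linear maps with the topology of uniform convergence on bounded sets. Over $E$, with Bose or Fermi statistics, the Hida test space $(E)$ consists of the sequences $\Phi=(\Phi_n)_{n\ge0}$ of symmetric, respectively antisymmetric, elements $\Phi_n$ of the completed tensor powers $E^{\otimes n}$ (functions of $n$ momenta and $n$ spin indices) for which all the norms $|\Phi|_k^2=\sum_n n!\,|(H^{\otimes n})^k\Phi_n|_{L^2}^2$, $k\ge 0$, are finite, where $H=-\Delta+|\mathbf p|^2+1$; these norms define its topology.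 Put $\langle\langle\Phi,\Psi\rangle\rangle=\sum_n n!\,\langle\Phi_n,\Psi_n\rangle$ (bilinear), $(a_s(\mathbf p)\Phi)_n=(n+1)\,\Phi_{n+1}((s,\mathbf p),\cdot)$, and let $a_s(\mathbf p)^+$ be the transpose of $a_s(\mathbf p)$. The field with kernels $\kappa_{0,1},\kappa_{1,0}$ is $\mathbb A(\phi)=\Xi_{0,1}(\kappa_{0,1}(\phi))+\Xi_{1,0}(\kappa_{1,0}(\phi))$, $\phi\in\mathscr E$, given by $$\langle\langle\mathbb A(\phi)\Phi,\Psi\rangle\rangle=\sum_s\int\kappa_{0,1}(\phi)(s,\mathbf p)\langle\langle a_s(\mathbf p)\Phi,\Psi\rangle\rangle\,d^3\mathbf p+\sum_s\int\kappa_{1,0}(\phi)(s,\mathbf p)\langle\langle a_s(\mathbf p)^+\Phi,\Psi\rangle\rangle\,d^3\mathbf p ,$$ where $\kappa(\phi)(s,\mathbf p)=\sum_a\int\kappa(s,\mathbf p;a,x)\phi_a(x)\,d^4x$ and, for $\xi\in E$, $\kappa(\xi)(a,x)=\sum_s\int\kappa(s,\mathbf p;a,x)\xi_s(\mathbf p)\,d^3\mathbf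 p$. The kernels are as follows, with $g=\mathrm{diag}(1,-1,-1,-1)$ and $p\cdot x=p^0x^0-\mathbf p\cdot\mathbf x$. * Electromagnetic potential $A$ (Bose, $p^0=|\mathbf p|$): $\kappa_{0,1}(\nu,\mathbf p;\mu,x)=\dfrac{g_{\nu\mu}}{(2\pi)^{3/2}\sqrt{2p^0}}e^{-ip\cdot x}$, and $\kappa_{1,0}$ is the same with $e^{ip\cdot x}$. * Dirac field $\psi$ of mass $m>0$ (Fermi, $p^0=E(\mathbf p)=\sqrt{|\mathbf p|^2+m^2}$): $\kappa_{0,1}(s,\mathbf p;a,x)=(2\pi)^{-3/2}u_s^a(\mathbf p)e^{-ip\cdot x}$ for $s=1,2$ and $0$ for $s=3,4$; $\kappa_{1,0}(s,\mathbf p;a,x)=0$ for $s=1,2$ and $(2\pi)^{-3/2}v_{s-2}^a(\mathbf p)e^{ip\cdot x}$ for $s=3,4$. Here, with $\chi_1,\chi_2$ the standard basis of $\mathbb C^2$, $\boldsymbol\sigma$ the Pauli matrices and $w_s=\frac{\mathbf p\cdot\boldsymbol\sigma}{E(\mathbf p)+m}\chi_s$, $$u_s=\tfrac1{\sqrt2}\sqrt{\tfrac{E(\mathbf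 p)+m}{2E(\mathbf p)}}\begin{pmatrix}\chi_s+w_s\\ \chi_s-w_s\end{pmatrix},\qquad v_s=\tfrac1{\sqrt2}\sqrt{\tfrac{E(\mathbf p)+m}{2E(\mathbf p)}}\begin{pmatrix}\chi_s+w_s\\ -(\chi_s-w_s)\end{pmatrix}.$$ **Lemma.** Put $(E_A,\mathscr E_A)=(\mathcal S^0(\mathbb R^3;\mathbb C^4),\mathcal S^{00}(\mathbb R^4;\mathbb C^4))$ and $(E_\psi,\mathscr E_\psi)=(\mathcal S(\mathbb R^3;\mathbb C^4),\mathcal S(\mathbb R^4;\mathbb C^4))$. For $\mathbb A=A$, and for $\mathbb A=\psi$ with any mass $m>0$: 1. For each of the four pairs $(E,\mathscr E)$ of test spaces the following are equivalent: (a) $\mathbb A\in\mathscr L(\mathscr E,\mathscr L((E),(E)))$; (b) $\kappa_{0,1},\kappa_{1,0}\in\mathscr L(\mathscr E,E)$; (c) $\kappa_{0,1},\kappa_{1,0}$, as maps $\xi\mapsto\kappa(\xi)$ from $E$ to $\mathscr E^*$, extend to elements of $\mathscr L(E^*,\mathscr E^*)$; (d) $E_{\mathbb A}\subseteq E$ and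 $\mathscr E\subseteq\mathscr E_{\mathbb A}$. 2. In particular, if $(E,\mathscr E)$ is one of the two corresponding pairs $(\mathcal S^0(\mathbb R^3;\mathbb C^4),\mathcal S^{00}(\mathbb R^4;\mathbb C^4))$ and $(\mathcal S(\mathbb R^3;\mathbb C^4),\mathcal S(\mathbb R^4;\mathbb C^4))$, then $\mathbb A\in\mathscr L(\mathscr E,\mathscr L((E),(E)))$ if and only if $(E,\mathscr E)=(E_{\mathbb A},\mathscr E_{\mathbb A})$. 3. If $E=E_{\mathbb A}$, then $\kappa_{0,1},\kappa_{1,0}\in\mathscr L(E,\mathcal O_M)$, where $\mathcal O_M=\mathcal O_M(\mathbb R^4;\mathbb C^4)$ is Schwartz's space of multipliers with its operator topology (induced by $\mathscr L(\mathcal S(\mathbb R^4),\mathcal S(\mathbb R^4))$), and for each $\xi\in E$ the functions $\kappa_{0,1}(\xi),\kappa_{1,0}(\xi)$ are smooth with all derivatives bounded. -/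

import Mathlib

open MeasureTheory SchwartzMap
open scoped ContDiff FourierTransform

noncomputable section

namespace FreeField

/-- Momentum space. -/
abbrev R3 : Type := EuclideanSpace ℝ (Fin 3)

/-- Space-time; the coordinate `0` is time. -/
abbrev R4 : Type := EuclideanSpace ℝ (Fin 4)

/-! ### The test spaces -/

/-- `S⁰(V)`: the Schwartz functions all of whose derivatives vanish at the origin. -/
def flat (V : Type) [NormedAddCommGroup V] [NormedSpace ℝ V] : Submodule ℂ 𝓢(V, ℂ) where
  carrier := {f | ∀ n : ℕ, iteratedFDeriv ℝ n f 0 = 0}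
  zero_mem' n := by
    have h : ((0 : 𝓢(V, ℂ)) : V → ℂ) = fun _ => 0 := rfl
    rw [h, iteratedFDeriv_fun_zero]
    rfl
  add_mem' {f g} hf hg n := by
    have h : ((f + g : 𝓢(V, ℂ)) : V → ℂ) = (f : V → ℂ) + g := rfl
    rw [h, iteratedFDeriv_add_apply ((f.smooth n).contDiffAt) ((g.smooth n).contDiffAt), hf n, hg n,
      add_zero]
  smul_mem' c f hf n := by
    have h : ((c • f : 𝓢(V, ℂ)) : V → ℂ) = c • (f : V → ℂ) := rfl
    rw [h, iteratedFDeriv_const_smul_apply ((f.smooth n).contDiffAt), hf n, smul_zero]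

/-- `S⁰⁰(ℝ⁴)`: the inverse image of `S⁰(ℝ⁴)` under the Fourier transform. -/
def flatFourier : Submodule ℂ 𝓢(R4, ℂ) :=
  (flat R4).comap (FourierTransform.fourierCLM ℂ 𝓢(R4, ℂ)).toLinearMap

/-- The space `W ⊗ ℂ⁴` of `ℂ⁴`-valued test functions with components in `W`, with the
topology of the Schwartz space. -/
abbrev Test {V : Type} [NormedAddCommGroup V] [NormedSpace ℝ V] (W : Submodule ℂ 𝓢(V, ℂ)) : Type :=
  Fin 4 → W

/-- The inclusion `E ⊂ E*`: the functional `η ↦ ∑ₛ ∫ ξₛ(p) ηₛ(p) dp`. -/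
def toDual {W : Submodule ℂ 𝓢(R3, ℂ)} (ξ : Test W) : StrongDual ℂ (Test W) :=
  ∑ s : Fin 4,
    ((SchwartzMap.integralCLM ℂ (volume : Measure R3)).comp
      (SchwartzMap.pairing (ContinuousLinearMap.mul ℂ ℂ) (ξ s : 𝓢(R3, ℂ)))).comp
    (W.subtypeL.comp (ContinuousLinearMap.proj s))

theorem toDual_apply {W : Submodule ℂ 𝓢(R3, ℂ)} (ξ η : Test W) :
    toDual ξ η = ∑ s, ∫ p, (ξ s : 𝓢(R3, ℂ)) p * (η s : 𝓢(R3, ℂ)) p := by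
  simp [toDual, SchwartzMap.integralCLM_apply]

/-! ### The Hida space over `E` -/

/-- The statistics of a field. -/
inductive Stat : Type
  | bose : Stat
  | fermi : Stat

/-- The factor by which an `n`-particle function is multiplied under a permutation. -/
def Stat.factor (st : Stat) {n : ℕ} (σ : Equiv.Perm (Fin n)) : ℂ :=
  match st with
  | .bose => 1
  | .fermi => ((Equiv.Perm.sign σ : ℤ) : ℂ)

/-- The labels of the components of a Fock space vector: a particle number `n` and the spin
indices of the `n` particles. -/
abbrev Idx : Type := Σ n : ℕ, (Fin n → Fin 4)

/-- The completed tensor power `W ⊗ ⋯ ⊗ W` (`n` factors) as a space of functions of `n` momenta: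
the closed span of the products `w₁(p₁) ⋯ wₙ(pₙ)`. -/
def tensorPow (W : Submodule ℂ 𝓢(R3, ℂ)) (n : ℕ) : Submodule ℂ 𝓢(Fin n → R3, ℂ) :=
  (Submodule.span ℂ {F : 𝓢(Fin n → R3, ℂ) |
    ∃ w : Fin n → W, ∀ p, F p = ∏ i, (w i : 𝓢(R3, ℂ)) (p i)}).topologicalClosure

theorem oscPotential_hasTemperateGrowth (n : ℕ) (i : Fin n) :
    (fun p : Fin n → R3 => ((‖p i‖ ^ 2 + 1 : ℝ) : ℂ)).HasTemperateGrowth := by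
  have h1 : (fun p : Fin n → R3 => p i).HasTemperateGrowth :=
    (ContinuousLinearMap.proj (R := ℝ) (φ := fun _ : Fin n => R3) i).hasTemperateGrowth
  have h2 : (fun p : Fin n → R3 => ‖p i‖ ^ 2 + 1).HasTemperateGrowth := 
    ((Function.hasTemperateGrowth_norm_sq R3).comp h1).add (.const 1)
  have h3 : (fun x : ℝ => (x : ℂ)).HasTemperateGrowth := Complex.ofRealCLM.hasTemperateGrowth
  exact h3.comp h2

instance (n : ℕ) : (volume : Measure (Fin n → R3)).HasTemperateGrowth :=
  Measure.IsAddHaarMeasure.instHasTemperateGrowth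

/-- The oscillator Hamiltonian `-Δ + |p|² + 1` in the `i`-th of `n` momenta. -/
def osc (n : ℕ) (i : Fin n) : 𝓢(Fin n → R3, ℂ) →L[ℂ] 𝓢(Fin n → R3, ℂ) :=
  SchwartzMap.smulLeftCLM ℂ (fun p : Fin n → R3 => ((‖p i‖ ^ 2 + 1 : ℝ) : ℂ)) -
    ∑ j : Fin 3,
      (LineDeriv.lineDerivOpCLM ℂ 𝓢(Fin n → R3, ℂ)
        (Pi.single i (EuclideanSpace.single j (1 : ℝ)) : Fin n → R3)) ^ 2

/-- The `n`-fold tensor power of the oscillator Hamiltonian. -/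
def oscTensor (n : ℕ) : 𝓢(Fin n → R3, ℂ) →L[ℂ] 𝓢(Fin n → R3, ℂ) :=
  (List.ofFn (osc n)).prod

/-- The Hilbert space that receives the norms of Fock space vectors. -/
abbrev Fock : Type :=
  lp (fun i : Idx => Lp ℂ 2 (volume : Measure (Fin i.1 → R3))) 2

/-- The family whose `ℓ²` norm is the Hida norm
`|Φ|ₖ² = ∑ₙ n! |(H ⊗ ⋯ ⊗ H)ᵏ Φₙ|²_{L²}`, with `H = -Δ + |p|² + 1`. -/
def weighted (k : ℕ) (Φ : ∀ i : Idx, 𝓢(Fin i.1 → R3, ℂ)) :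
    ∀ i : Idx, Lp ℂ 2 (volume : Measure (Fin i.1 → R3)) :=
  fun i => ((Real.sqrt (i.1.factorial : ℝ) : ℝ) : ℂ) •
    SchwartzMap.toLpCLM ℂ ℂ 2 (volume : Measure (Fin i.1 → R3)) (((oscTensor i.1) ^ k) (Φ i))

theorem weighted_add (k : ℕ) (Φ Ψ : ∀ i : Idx, 𝓢(Fin i.1 → R3, ℂ)) :
    weighted k (Φ + Ψ) = weighted k Φ + weighted k Ψ := by
  funext i
  simp only [weighted, Pi.add_apply, map_add, smul_add]

theorem weighted_smul (k : ℕ) (c : ℂ) (Φ : ∀ i : Idx, 𝓢(Fin i.1 → R3, ℂ)) :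
    weighted k (c • Φ) = c • weighted k Φ := by
  funext i
  simp only [weighted, Pi.smul_apply, map_smul]
  rw [smul_comm]

/-- The Hida test vectors over `E = W ⊗ ℂ⁴`: sequences of (anti)symmetric functions
`Φₙ` in the completed tensor powers of `E`, all of whose Hida norms are finite. -/
def hidaSubmodule (st : Stat) (W : Submodule ℂ 𝓢(R3, ℂ)) :
    Submodule ℂ (∀ i : Idx, 𝓢(Fin i.1 → R3, ℂ)) where
  carrier := {Φ | (∀ i, Φ i ∈ tensorPow W i.1) ∧
    (∀ (n : ℕ) (σ : Equiv.Perm (Fin n)) (s : Fin n → Fin 4) (p : Fin n → R3),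
      Φ ⟨n, s ∘ σ⟩ (p ∘ σ) = st.factor σ * Φ ⟨n, s⟩ p) ∧
    ∀ k, Memℓp (weighted k Φ) 2}
  zero_mem' := by
    refine ⟨fun i => Submodule.zero_mem _, fun n σ s p => ?_, fun k => ?_⟩
    · simp
    · have h : weighted k (0 : ∀ i : Idx, 𝓢(Fin i.1 → R3, ℂ)) = 0 := by
        funext i
        rw [weighted, Pi.zero_apply, map_zero, map_zero, smul_zero]
        rfl
      rw [h]
      exact zero_memℓp
  add_mem' {Φ Ψ} hΦ hΨ := by
    refine ⟨fun i => Submodule.add_mem _ (hΦ.1 i) (hΨ.1 i), fun n σ s p => ?_, fun k => ?_⟩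
    · simp only [Pi.add_apply, add_apply, hΦ.2.1 n σ s p, hΨ.2.1 n σ s p, mul_add]
    · rw [weighted_add]
      exact (hΦ.2.2 k).add (hΨ.2.2 k)
  smul_mem' c Φ hΦ := by
    refine ⟨fun i => Submodule.smul_mem _ c (hΦ.1 i), fun n σ s p => ?_, fun k => ?_⟩
    · simp only [Pi.smul_apply, smul_apply, hΦ.2.1 n σ s p, smul_eq_mul]
      ring
    · rw [weighted_smul]
      exact (hΦ.2.2 k).const_smul c

/-- The Hida test space `(E)` over `E = W ⊗ ℂ⁴`. -/
def Hida (st : Stat) (W : Submodule ℂ 𝓢(R3, ℂ)) : Type := hidaSubmodule st W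

instance (st : Stat) (W : Submodule ℂ 𝓢(R3, ℂ)) : AddCommGroup (Hida st W) :=
  inferInstanceAs (AddCommGroup (hidaSubmodule st W))

instance (st : Stat) (W : Submodule ℂ 𝓢(R3, ℂ)) : Module ℂ (Hida st W) :=
  inferInstanceAs (Module ℂ (hidaSubmodule st W))

/-- The component functions of a Hida test vector. -/
def Hida.comp {st : Stat} {W : Submodule ℂ 𝓢(R3, ℂ)} (Φ : Hida st W) (i : Idx) :
    (Fin i.1 → R3) → ℂ :=
  Φ.1 i

/-- The linear map into a Hilbert space which defines the `k`-th Hida norm. -/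
def Hida.embed (st : Stat) (W : Submodule ℂ 𝓢(R3, ℂ)) (k : ℕ) : Hida st W →ₗ[ℂ] Fock where
  toFun Φ := ⟨weighted k Φ.1, Φ.2.2.2 k⟩
  map_add' Φ Ψ := Subtype.ext (weighted_add k Φ.1 Ψ.1)
  map_smul' c Φ := Subtype.ext (weighted_smul k c Φ.1)

/-- The topology of `(E)` is defined by the Hida norms. -/
instance (st : Stat) (W : Submodule ℂ 𝓢(R3, ℂ)) : TopologicalSpace (Hida st W) :=
  ⨅ k : ℕ, TopologicalSpace.induced (Hida.embed st W k) inferInstance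

instance (st : Stat) (W : Submodule ℂ 𝓢(R3, ℂ)) : IsTopologicalAddGroup (Hida st W) :=
  topologicalAddGroup_iInf fun k => topologicalAddGroup_induced (Hida.embed st W k)

instance (st : Stat) (W : Submodule ℂ 𝓢(R3, ℂ)) : ContinuousSMul ℂ (Hida st W) :=
  continuousSMul_iInf fun k => continuousSMul_induced (Hida.embed st W k)

/-! ### Integral kernel operators -/

/-- The bilinear pairing `⟨⟨Φ, Ψ⟩⟩ = ∑ₙ n! ∑ₛ ∫ Φₙ Ψₙ`. -/
def pairing (F G : ∀ i : Idx, (Fin i.1 → R3) → ℂ) : ℂ :=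
  ∑' i : Idx, (i.1.factorial : ℂ) * ∫ q, F i q * G i q

/-- The Hida annihilation operator at the spin-momentum point `(s, p)`:
`(a_s(p) Φ)ₙ = (n + 1) Φₙ₊₁((s, p), ·)`. -/
def annihilate (s : Fin 4) (p : R3) (F : ∀ i : Idx, (Fin i.1 → R3) → ℂ) :
    ∀ i : Idx, (Fin i.1 → R3) → ℂ :=
  fun i q => ((i.1 : ℂ) + 1) * F ⟨i.1 + 1, Fin.cons s i.2⟩ (Fin.cons p q)

/-- A plane-wave kernel `κ(s, p; a, x)`. -/
abbrev Kernel : Type := Fin 4 → R3 → Fin 4 → R4 → ℂ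

/-- The function `κ(φ)(s, p) = ∑ₐ ∫ κ(s, p; a, x) φₐ(x) dx`. -/
def Kernel.smearX (κ : Kernel) {X : Submodule ℂ 𝓢(R4, ℂ)} (φ : Test X) (s : Fin 4) (p : R3) : ℂ :=
  ∑ a, ∫ x, κ s p a x * (φ a : 𝓢(R4, ℂ)) x

/-- The function `κ(ξ)(a, x) = ∑ₛ ∫ κ(s, p; a, x) ξₛ(p) dp`. -/
def Kernel.smearP (κ : Kernel) {W : Submodule ℂ 𝓢(R3, ℂ)} (ξ : Test W) (a : Fin 4) (x : R4) : ℂ :=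
  ∑ s, ∫ p, κ s p a x * (ξ s : 𝓢(R3, ℂ)) p

/-- The matrix elements `⟨⟨(Ξ₀₁(κ₀₁(φ)) + Ξ₁₀(κ₁₀(φ))) Φ, Ψ⟩⟩` of the field smeared with `φ`:
`∑ₛ ∫ κ₀₁(φ)(s, p) ⟨⟨a_s(p) Φ, Ψ⟩⟩ dp + ∑ₛ ∫ κ₁₀(φ)(s, p) ⟨⟨a_s(p)⁺ Φ, Ψ⟩⟩ dp`,
where `a_s(p)⁺` is the transpose of `a_s(p)` for the pairing. -/
def fieldForm (κ₀₁ κ₁₀ : Kernel) {st : Stat} {W : Submodule ℂ 𝓢(R3, ℂ)}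
    {X : Submodule ℂ 𝓢(R4, ℂ)} (φ : Test X) (Φ Ψ : Hida st W) : ℂ :=
  (∑ s, ∫ p, κ₀₁.smearX φ s p * pairing (annihilate s p Φ.comp) Ψ.comp) +
    ∑ s, ∫ p, κ₁₀.smearX φ s p * pairing Φ.comp (annihilate s p Ψ.comp)

/-- The field with kernels `κ₀₁`, `κ₁₀` belongs to `L(𝓔, L((E), (E)))`, where `E = W ⊗ ℂ⁴`,
`𝓔 = X ⊗ ℂ⁴`, and spaces of operators carry the topology of uniform convergence on
bounded sets. -/
def FieldMem (st : Stat) (κ₀₁ κ₁₀ : Kernel) (W : Submodule ℂ 𝓢(R3, ℂ))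
    (X : Submodule ℂ 𝓢(R4, ℂ)) : Prop :=
  ∃ T : Test X →L[ℂ] (Hida st W →L[ℂ] Hida st W),
    ∀ (φ : Test X) (Φ Ψ : Hida st W), pairing (T φ Φ).comp Ψ.comp = fieldForm κ₀₁ κ₁₀ φ Φ Ψ

/-- `κ ∈ L(𝓔, E)`. -/
def Kernel.MemTest (κ : Kernel) (W : Submodule ℂ 𝓢(R3, ℂ)) (X : Submodule ℂ 𝓢(R4, ℂ)) : Prop :=
  ∃ K : Test X →L[ℂ] Test W,
    ∀ (φ : Test X) (s : Fin 4), ∀ᵐ p : R3, (K φ s : 𝓢(R3, ℂ)) p = κ.smearX φ s p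

/-- `κ ∈ L(E*, 𝓔*)` (strong duals): `κ`, as a map from `E` to `𝓔*`, extends continuously
to `E*`. -/
def Kernel.MemDual (κ : Kernel) (W : Submodule ℂ 𝓢(R3, ℂ)) (X : Submodule ℂ 𝓢(R4, ℂ)) : Prop :=
  ∃ K : StrongDual ℂ (Test W) →L[ℂ] StrongDual ℂ (Test X),
    ∀ (ξ : Test W) (φ : Test X),
      K (toDual ξ) φ = ∑ a, ∫ x, κ.smearP ξ a x * (φ a : 𝓢(R4, ℂ)) x

/-! ### The algebra of multipliers -/

/-- The smooth functions on space-time all of whose derivatives grow at most polynomially. -/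
def multiplierSubmodule : Submodule ℂ (R4 → ℂ) where
  carrier := {f | f.HasTemperateGrowth}
  zero_mem' := Function.HasTemperateGrowth.const 0
  add_mem' hf hg := Function.HasTemperateGrowth.add hf hg
  smul_mem' c _ hf := (Function.HasTemperateGrowth.const c).mul hf

/-- Schwartz's algebra `O_M(ℝ⁴)`. -/
def OM : Type := multiplierSubmodule

instance : AddCommGroup OM := inferInstanceAs (AddCommGroup multiplierSubmodule)

instance : Module ℂ OM := inferInstanceAs (Module ℂ multiplierSubmodule)

/-- A multiplier as an operator in the Schwartz space. -/
def OM.toOperator : OM →ₗ[ℂ] (𝓢(R4, ℂ) →L[ℂ] 𝓢(R4, ℂ)) where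
  toFun f := SchwartzMap.smulLeftCLM ℂ f.1
  map_add' f g := SchwartzMap.smulLeftCLM_add f.2 g.2
  map_smul' c f := SchwartzMap.smulLeftCLM_smul f.2 c

/-- The operator topology of `O_M`, induced by the topology of uniform convergence on bounded sets
of operators in the Schwartz space. -/
instance : TopologicalSpace OM := TopologicalSpace.induced OM.toOperator inferInstance

/-- `κ ∈ L(E, O_M)`. -/
def Kernel.MemOM (κ : Kernel) (W : Submodule ℂ 𝓢(R3, ℂ)) : Prop :=
  ∃ K : Test W →L[ℂ] (Fin 4 → OM), ∀ (ξ : Test W) (a : Fin 4), (K ξ a).1 = κ.smearP ξ a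

/-- All the functions `κ(ξ)`, `ξ ∈ E`, are smooth with all derivatives bounded. -/
def Kernel.SmoothBounded (κ : Kernel) (W : Submodule ℂ 𝓢(R3, ℂ)) : Prop :=
  ∀ (ξ : Test W) (a : Fin 4), ContDiff ℝ ∞ (κ.smearP ξ a) ∧
    ∀ n : ℕ, ∃ C : ℝ, ∀ x, ‖iteratedFDeriv ℝ n (κ.smearP ξ a) x‖ ≤ C

/-! ### The plane-wave kernels -/

/-- The Minkowski product `p · x` of `(E, p)` and `x`. -/
def mdot (E : ℝ) (p : R3) (x : R4) : ℝ := E * x 0 - ∑ i : Fin 3, p i * x i.succ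

/-- The Minkowski metric `diag(1, -1, -1, -1)`. -/
def metric : Matrix (Fin 4) (Fin 4) ℝ := Matrix.diagonal ![1, -1, -1, -1]

/-- The kernel `κ₀₁` of the electromagnetic potential. -/
def potential₀₁ : Kernel := fun ν p μ x =>
  ((metric ν μ / ((2 * Real.pi) ^ (3 / 2 : ℝ) * Real.sqrt (2 * ‖p‖)) : ℝ) : ℂ) *
    Complex.exp (-(Complex.I * (mdot ‖p‖ p x : ℂ)))

/-- The kernel `κ₁₀` of the electromagnetic potential. -/
def potential₁₀ : Kernel := fun ν p μ x =>
  ((metric ν μ / ((2 * Real.pi) ^ (3 / 2 : ℝ) * Real.sqrt (2 * ‖p‖)) : ℝ) : ℂ) *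
    Complex.exp (Complex.I * (mdot ‖p‖ p x : ℂ))

/-- The energy on the mass shell. -/
def energy (m : ℝ) (p : R3) : ℝ := Real.sqrt (‖p‖ ^ 2 + m ^ 2)

/-- `p · σ` with the Pauli matrices `σ`. -/
def pauli (p : R3) : Matrix (Fin 2) (Fin 2) ℂ :=
  (p 0 : ℂ) • !![0, 1; 1, 0] + (p 1 : ℂ) • !![0, -Complex.I; Complex.I, 0] +
    (p 2 : ℂ) • !![1, 0; 0, -1]

/-- The standard basis `χ₁, χ₂` of `ℂ²`. -/
def chi (s : Fin 2) : Fin 2 → ℂ := Pi.single s 1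

/-- The vector `(p · σ) χₛ / (E(p) + m)`. -/
def chiBoost (m : ℝ) (s : Fin 2) (p : R3) : Fin 2 → ℂ :=
  ((1 / (energy m p + m) : ℝ) : ℂ) • (pauli p).mulVec (chi s)

/-- The normalization factor of the Dirac spinors. -/
def spinorNorm (m : ℝ) (p : R3) : ℂ :=
  ((1 / Real.sqrt 2 * Real.sqrt ((energy m p + m) / (2 * energy m p)) : ℝ) : ℂ)

/-- The positive energy Dirac spinors. -/
def spinorU (m : ℝ) (s : Fin 2) (p : R3) : Fin 4 → ℂ :=
  spinorNorm m p • Fin.append (chi s + chiBoost m s p) (chi s - chiBoost m s p)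

/-- The negative energy Dirac spinors. -/
def spinorV (m : ℝ) (s : Fin 2) (p : R3) : Fin 4 → ℂ :=
  spinorNorm m p • Fin.append (chi s + chiBoost m s p) (-(chi s - chiBoost m s p))

/-- The kernel `κ₀₁` of the Dirac field of mass `m`. -/
def dirac₀₁ (m : ℝ) : Kernel := fun s p a x =>
  (((2 * Real.pi) ^ (-(3 / 2) : ℝ) : ℝ) : ℂ) *
    (![spinorU m 0 p, spinorU m 1 p, 0, 0] : Fin 4 → Fin 4 → ℂ) s a *
    Complex.exp (-(Complex.I * (mdot (energy m p) p x : ℂ)))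

/-- The kernel `κ₁₀` of the Dirac field of mass `m`. -/
def dirac₁₀ (m : ℝ) : Kernel := fun s p a x =>
  (((2 * Real.pi) ^ (-(3 / 2) : ℝ) : ℝ) : ℂ) *
    (![0, 0, spinorV m 0 p, spinorV m 1 p] : Fin 4 → Fin 4 → ℂ) s a *
    Complex.exp (Complex.I * (mdot (energy m p) p x : ℂ))

end FreeField

end

/-!
Let `E` and `𝓔` denote the single-particle and the space-time test space. Both kernels of either
field are superpositions of plane waves, `κ(s, p; a, x) = amp s a p · e^{-2πi ⟨x, k(p)⟩}`, where
`k(p)` runs through a mass shell (`IsPlaneWave`). Hence `κ(φ)(s, p) = ∑ₐ amp s a p · 𝓕φₐ(k(p))`: up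
to the amplitude, `κ(φ)` is the restriction of the Fourier transform of `φ` to the mass shell.

*Sufficiency of the condition on the test spaces.* For `m > 0` the energy and the spinor amplitudes
are smooth with temperate growth, so `φ ↦ κ(φ)` consists of a Fourier transform, a composition and a
multiplication, all continuous in the Schwartz space (`IsPlaneWave.memTest_top`). For the potential
the shell is the light cone, singular at the origin, and the amplitude is a multiple of
`|p|^{-1/2}`. But if `G` vanishes to infinite order at the origin, then `p ↦ |p|^r G(k(p))` is a
Schwartz function of the same kind for every real `r`: its derivative has the same form, with
`r - 2` in place of `r` and with `G` replaced by a combination of `G` and its derivative with polynomial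
coefficients (`FlatAtZero.hasFDerivAt_cone`), and all these functions are bounded
(`norm_rpow_mul_le`).

*From kernels to the field.* The field is the sum of an annihilation operator, smeared with
`κ₀₁(φ)`, and a creation operator, smeared with `κ₁₀(φ)`. They act on the components of a Hida
vector by contraction and by the (anti)symmetrized tensor product. As the oscillator Hamiltonian
satisfies `H ≥ 4`, one additional power of `H ⊗ ⋯ ⊗ H` absorbs all factors that depend on the
particle number, and both operators are continuous in the Hida space, with bounds that are
continuous in the smearing function (`hidaSq_annFamily_le`, `hidaSq_creFamily_le`,
`exists_clm_of_bound`). That they have the right matrix elements is Fubini's theorem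
(`pairing_field`). The extension of `κ : E → 𝓔*` to `E*` is the transpose of `κ : 𝓔 → E`, again by
Fubini's theorem (`IsPlaneWave.memDual_of_memTest`).

*Necessity.* If the field is an operator field, the one-particle part of the field applied to the
vacuum dominates the functional `η ↦ ∫ κ₁₀(φ) η` by a continuous function; if `κ₁₀` extends to `E*`,
continuity in the strong topology does so, by a function that bounds a bounded subset of `E`. In
both cases the dominating function vanishes at the origin if `E` consists of flat functions
(`Kernel.Dominated`). Bump functions turn this into a pointwise bound (`norm_le_of_dominated`). For
the potential and unrestricted `𝓔` it contradicts the unboundedness of `|p|^{-1/2}` at the origin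
(`not_dominated_potential₁₀`). For the Dirac field and flat `E` it contradicts the fact that the
amplitude does not vanish at the origin, where the wave vector `k(0) ≠ 0` is within reach of the
Fourier transforms even of functions in `S⁰⁰` (`not_dominated_dirac₁₀`).

*Multipliers.* For `ξ ∈ E` the function `κ(ξ)` is the Fourier transform of a rapidly decreasing
density on the mass shell, so all its derivatives are bounded, by continuous seminorms of `ξ`
(`contDiff_superposition`, `IsPlaneWave.norm_iteratedFDeriv_smearP_le`).
-/

noncomputable section

namespace FreeField

/-! ### Integrating out a variable of a Schwartz function -/

section PartialIntegral

variable {A B D V : Type} [NormedAddCommGroup A] [NormedSpace ℝ A] [NormedAddCommGroup B]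
  [NormedSpace ℝ B] [NormedAddCommGroup D] [NormedSpace ℝ D] [NormedAddCommGroup V]
  [NormedSpace ℝ V] (iA : A →L[ℝ] D) (iB : B →L[ℝ] D)

/-- Decay of a Schwartz function in two independent directions at once. -/
theorem exists_seminorm_bound_add (hA : ∀ a b, ‖a‖ ≤ ‖iA a + iB b‖)
    (hB : ∀ a b, ‖b‖ ≤ ‖iA a + iB b‖) (k l : ℕ) :
    ∃ (s : Finset (ℕ × ℕ)) (C : ℝ), 0 ≤ C ∧ ∀ (G : 𝓢(D, V)) (a : A) (b : B),
      ‖b‖ ^ k * ‖G (iA a + iB b)‖ ≤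
        (1 + ‖a‖) ^ (-(l : ℝ)) * (C * s.sup (schwartzSeminormFamily ℝ D V) G) := by
  refine ⟨Finset.Iic (k + l, 0), 2 ^ (k + l), by positivity, fun G a b => ?_⟩
  have h := one_add_le_sup_seminorm_apply (𝕜 := ℝ) (m := (k + l, 0)) le_rfl le_rfl G (iA a + iB b)
  rw [norm_iteratedFDeriv_zero] at h
  have hp : 0 < (1 + ‖a‖) ^ l := by positivity
  rw [Real.rpow_neg (by positivity), Real.rpow_natCast, ← div_eq_inv_mul, le_div_iff₀' hp]
  refine le_trans ?_ h
  rw [← mul_assoc]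
  gcongr
  rw [pow_add, mul_comm]
  gcongr
  · exact (hB a b).trans (by simp)
  · exact hA a b

/-- The derivative of a function on `D` in the directions of `B`. -/
def partialFDeriv : 𝓢(D, V) →L[ℝ] 𝓢(D, B →L[ℝ] V) :=
  (SchwartzMap.postcompCLM ((ContinuousLinearMap.compL ℝ B D V).flip iB)).comp
    (SchwartzMap.fderivCLM ℝ D V)

theorem partialFDeriv_apply (G : 𝓢(D, V)) (z : D) :
    partialFDeriv iB G z = (fderiv ℝ G z).comp iB := rfl

variable [MeasurableSpace A] [BorelSpace A] [SecondCountableTopology A]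
  (μ : Measure A) [μ.HasTemperateGrowth]

theorem integrable_add (hA : ∀ a b, ‖a‖ ≤ ‖iA a + iB b‖) (hB : ∀ a b, ‖b‖ ≤ ‖iA a + iB b‖)
    (G : 𝓢(D, V)) (b : B) : Integrable (fun a => G (iA a + iB b)) μ := by
  obtain ⟨s, C, hC, h⟩ := exists_seminorm_bound_add (V := V) iA iB hA hB 0 μ.integrablePower
  refine ((Measure.integrable_pow_neg_integrablePower μ).mul_const
    (C * s.sup (schwartzSeminormFamily ℝ D V) G)).mono'
    (by fun_prop) (.of_forall fun a => ?_)
  simpa using h G a b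

theorem hasFDerivAt_integral_add (hA : ∀ a b, ‖a‖ ≤ ‖iA a + iB b‖)
    (hB : ∀ a b, ‖b‖ ≤ ‖iA a + iB b‖) (G : 𝓢(D, V)) (b : B) :
    HasFDerivAt (fun b => ∫ a, G (iA a + iB b) ∂μ)
      (∫ a, partialFDeriv iB G (iA a + iB b) ∂μ) b := by
  obtain ⟨s, C, hC, h⟩ :=
    exists_seminorm_bound_add (V := B →L[ℝ] V) iA iB hA hB 0 μ.integrablePower
  refine hasFDerivAt_integral_of_dominated_of_fderiv_le (s := (Set.univ : Set B))
    (F' := fun b a => partialFDeriv iB G (iA a + iB b)) Filter.univ_mem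
    (bound := fun a => (1 + ‖a‖) ^ (-(μ.integrablePower : ℝ)) *
      (C * s.sup (schwartzSeminormFamily ℝ D (B →L[ℝ] V)) (partialFDeriv iB G))) ?_ ?_ ?_ ?_ ?_ ?_
  · exact .of_forall fun b => (integrable_add iA iB μ hA hB G b).aestronglyMeasurable
  · exact integrable_add iA iB μ hA hB G b
  · exact (integrable_add iA iB μ hA hB (partialFDeriv iB G) b).aestronglyMeasurable
  · exact .of_forall fun a b _ => by simpa using h (partialFDeriv iB G) a b
  · exact (Measure.integrable_pow_neg_integrablePower μ).mul_const _
  · refine .of_forall fun a b _ => ?_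
    rw [partialFDeriv_apply]
    exact (G.hasFDerivAt (iA a + iB b)).comp b (iB.hasFDerivAt.const_add _)

theorem fderiv_integral_add (hA : ∀ a b, ‖a‖ ≤ ‖iA a + iB b‖)
    (hB : ∀ a b, ‖b‖ ≤ ‖iA a + iB b‖) (G : 𝓢(D, V)) :
    fderiv ℝ (fun b => ∫ a, G (iA a + iB b) ∂μ) =
      fun b => ∫ a, partialFDeriv iB G (iA a + iB b) ∂μ :=
  funext fun b => (hasFDerivAt_integral_add iA iB μ hA hB G b).fderiv

/-- The induction on the order of differentiability runs over all target spaces at once, since the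
derivative of a `V`-valued integral is an integral with values in `B →L[ℝ] V`. -/
theorem contDiff_integral_add (hA : ∀ a b, ‖a‖ ≤ ‖iA a + iB b‖)
    (hB : ∀ a b, ‖b‖ ≤ ‖iA a + iB b‖) (m : ℕ) :
    ∀ {V : Type} [NormedAddCommGroup V] [NormedSpace ℝ V] (G : 𝓢(D, V)),
      ContDiff ℝ m (fun b => ∫ a, G (iA a + iB b) ∂μ) := by
  induction m with
  | zero =>
    intro V _ _ G
    exact contDiff_zero.2 (continuous_iff_continuousAt.2 fun b =>
      (hasFDerivAt_integral_add iA iB μ hA hB G b).continuousAt)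
  | succ m ih =>
    intro V _ _ G
    rw [Nat.cast_succ]
    refine contDiff_succ_iff_fderiv.2 ⟨fun b =>
      (hasFDerivAt_integral_add iA iB μ hA hB G b).differentiableAt,
        fun h => absurd h (by simp), ?_⟩
    rw [fderiv_integral_add iA iB μ hA hB]
    exact ih _

/-- The Schwartz seminorms of an integral over the directions of `A` are continuous seminorms of the
integrand. As in `contDiff_integral_add`, the induction runs over all target spaces. -/
theorem exists_seminorm_bound_integral_add (hA : ∀ a b, ‖a‖ ≤ ‖iA a + iB b‖)
    (hB : ∀ a b, ‖b‖ ≤ ‖iA a + iB b‖) (k m : ℕ) :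
    ∀ (V : Type) [NormedAddCommGroup V] [NormedSpace ℝ V],
      ∃ (s : Finset (ℕ × ℕ)) (C : ℝ), 0 ≤ C ∧ ∀ (G : 𝓢(D, V)) (b : B),
        ‖b‖ ^ k * ‖iteratedFDeriv ℝ m (fun b => ∫ a, G (iA a + iB b) ∂μ) b‖ ≤
          C * s.sup (schwartzSeminormFamily ℝ D V) G := by
  induction m with
  | zero =>
    intro V _ _
    obtain ⟨s, C, hC, h⟩ := exists_seminorm_bound_add (V := V) iA iB hA hB k μ.integrablePower
    refine ⟨s, (∫ a, (1 + ‖a‖) ^ (-(μ.integrablePower : ℝ)) ∂μ) * C, by positivity,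
      fun G b => ?_⟩
    rw [norm_iteratedFDeriv_zero, mul_assoc, ← integral_mul_const]
    calc ‖b‖ ^ k * ‖∫ a, G (iA a + iB b) ∂μ‖
        ≤ ‖b‖ ^ k * ∫ a, ‖G (iA a + iB b)‖ ∂μ := by
          gcongr
          exact norm_integral_le_integral_norm _
      _ = ∫ a, ‖b‖ ^ k * ‖G (iA a + iB b)‖ ∂μ := (integral_const_mul _ _).symm
      _ ≤ _ := integral_mono ((integrable_add iA iB μ hA hB G b).norm.const_mul _)
          ((Measure.integrable_pow_neg_integrablePower μ).mul_const _) fun a => h G a b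
  | succ m ih =>
    intro V _ _
    obtain ⟨s, C, hC, h⟩ := ih (B →L[ℝ] V)
    let q : Seminorm ℝ 𝓢(D, B →L[ℝ] V) := s.sup (schwartzSeminormFamily ℝ D (B →L[ℝ] V))
    have hq : Continuous q :=
      Seminorm.continuous_finsetSup fun i _ => (schwartz_withSeminorms ℝ D _).continuous_seminorm i
    have hcont : Continuous (q.comp
        (partialFDeriv iB : 𝓢(D, V) →L[ℝ] 𝓢(D, B →L[ℝ] V)).toLinearMap) :=
      hq.comp (partialFDeriv iB).continuous
    obtain ⟨s', C', -, h'⟩ := Seminorm.bound_of_continuous (schwartz_withSeminorms ℝ D V) _ hcont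
    refine ⟨s', C * C', by positivity, fun G b => ?_⟩
    rw [← norm_iteratedFDeriv_fderiv, fderiv_integral_add iA iB μ hA hB]
    refine (h _ b).trans ?_
    rw [mul_assoc]
    gcongr
    exact h' G

theorem sup_schwartzSeminormFamily_real_eq_complex [NormedSpace ℂ V] [SMulCommClass ℝ ℂ V]
    (s : Finset (ℕ × ℕ)) (G : 𝓢(D, V)) :
    s.sup (schwartzSeminormFamily ℝ D V) G = s.sup (schwartzSeminormFamily ℂ D V) G := by
  rw [Seminorm.finset_sup_apply, Seminorm.finset_sup_apply]
  rfl

/-- Integration over the directions of `A`, as an operator of Schwartz spaces. -/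
def partialIntegral (hA : ∀ a b, ‖a‖ ≤ ‖iA a + iB b‖) (hB : ∀ a b, ‖b‖ ≤ ‖iA a + iB b‖) :
    𝓢(D, ℂ) →L[ℂ] 𝓢(B, ℂ) :=
  SchwartzMap.mkCLM (fun G b => ∫ a, G (iA a + iB b) ∂μ)
    (fun f g b => integral_add (integrable_add iA iB μ hA hB f b)
      (integrable_add iA iB μ hA hB g b))
    (fun c f b => integral_const_mul c _)
    (fun f => contDiff_infty.2 fun m => contDiff_integral_add iA iB μ hA hB m f)
    fun n => by
      obtain ⟨s, C, hC, h⟩ := exists_seminorm_bound_integral_add iA iB μ hA hB n.1 n.2 ℂ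
      exact ⟨s, C, hC, fun f x => by
        rw [← sup_schwartzSeminormFamily_real_eq_complex]; exact h f x⟩

theorem partialIntegral_apply (hA : ∀ a b, ‖a‖ ≤ ‖iA a + iB b‖)
    (hB : ∀ a b, ‖b‖ ≤ ‖iA a + iB b‖) (G : 𝓢(D, ℂ)) (b : B) :
    partialIntegral iA iB μ hA hB G b = ∫ a, G (iA a + iB b) ∂μ := rfl

theorem lineDerivOp_partialIntegral (hA : ∀ a b, ‖a‖ ≤ ‖iA a + iB b‖)
    (hB : ∀ a b, ‖b‖ ≤ ‖iA a + iB b‖) (G : 𝓢(D, ℂ)) (v : B) :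
    LineDeriv.lineDerivOp v (partialIntegral iA iB μ hA hB G) =
      partialIntegral iA iB μ hA hB (LineDeriv.lineDerivOp (iB v) G) := by
  ext b
  rw [SchwartzMap.lineDerivOp_apply_eq_fderiv, partialIntegral_apply]
  change (fderiv ℝ (fun b => ∫ a, G (iA a + iB b) ∂μ) b) v = _
  rw [fderiv_integral_add iA iB μ hA hB,
    ContinuousLinearMap.integral_apply (integrable_add iA iB μ hA hB _ b)]
  rfl

end PartialIntegral

/-! ### Tensor products and contractions of Schwartz functions of several momenta -/

/-- The inclusion of the first of `n + 1` momenta. -/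
def consHead (n : ℕ) : R3 →L[ℝ] (Fin (n + 1) → R3) :=
  ContinuousLinearMap.single ℝ (fun _ : Fin (n + 1) => R3) 0

/-- The inclusion of the last `n` of `n + 1` momenta. -/
def consTail (n : ℕ) : (Fin n → R3) →L[ℝ] (Fin (n + 1) → R3) :=
  ContinuousLinearMap.pi (Fin.cons 0 fun i => ContinuousLinearMap.proj i)

theorem consHead_apply (n : ℕ) (p : R3) : consHead n p = Fin.cons p 0 := by
  ext i : 1
  refine Fin.cases ?_ (fun i => ?_) i <;> simp [consHead]

theorem consTail_apply (n : ℕ) (q : Fin n → R3) : consTail n q = Fin.cons 0 q := by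
  ext i : 1
  refine Fin.cases ?_ (fun i => ?_) i <;> simp [consTail]

theorem consHead_add_consTail {n : ℕ} (p : R3) (q : Fin n → R3) :
    consHead n p + consTail n q = Fin.cons p q := by
  rw [consHead_apply, consTail_apply]
  ext i : 1
  refine Fin.cases ?_ (fun i => ?_) i <;> simp

theorem norm_head_le {n : ℕ} (p : R3) (q : Fin n → R3) : ‖p‖ ≤ ‖consHead n p + consTail n q‖ := by
  rw [consHead_add_consTail]
  exact norm_le_pi_norm (Fin.cons p q : Fin (n + 1) → R3) 0

theorem norm_tail_le {n : ℕ} (p : R3) (q : Fin n → R3) : ‖q‖ ≤ ‖consHead n p + consTail n q‖ := by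
  rw [consHead_add_consTail]
  refine (pi_norm_le_iff_of_nonneg (norm_nonneg _)).2 fun i => ?_
  exact norm_le_pi_norm (Fin.cons p q : Fin (n + 1) → R3) i.succ

/-- Discarding the first of `n + 1` momenta. -/
def tailCLM (n : ℕ) : (Fin (n + 1) → R3) →L[ℝ] (Fin n → R3) :=
  ContinuousLinearMap.pi fun i => ContinuousLinearMap.proj i.succ

theorem norm_tailCLM_le (n : ℕ) : ‖tailCLM n‖ ≤ 1 := by
  refine ContinuousLinearMap.opNorm_le_bound _ zero_le_one fun P => ?_
  rw [one_mul]
  exact (pi_norm_le_iff_of_nonneg (norm_nonneg _)).2 fun i => norm_le_pi_norm P i.succ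

/-- The first of `n + 1` momenta. -/
def headCLM (n : ℕ) : (Fin (n + 1) → R3) →L[ℝ] R3 := ContinuousLinearMap.proj 0

theorem norm_headCLM_le (n : ℕ) : ‖headCLM n‖ ≤ 1 := by
  refine ContinuousLinearMap.opNorm_le_bound _ zero_le_one fun P => ?_
  rw [one_mul]
  exact norm_le_pi_norm P 0

theorem norm_iteratedFDeriv_comp_le_of_norm_le_one {D B : Type} [NormedAddCommGroup D]
    [NormedSpace ℝ D] [NormedAddCommGroup B] [NormedSpace ℝ B] (L : D →L[ℝ] B) (hL : ‖L‖ ≤ 1)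
    (G : 𝓢(B, ℂ)) (i : ℕ) (P : D) :
    ‖iteratedFDeriv ℝ i (fun P => G (L P)) P‖ ≤ ‖iteratedFDeriv ℝ i G (L P)‖ := by
  have h := L.iteratedFDeriv_comp_right (G.smooth i) P (i := i) le_rfl
  rw [Function.comp_def] at h
  rw [h]
  refine (ContinuousMultilinearMap.norm_compContinuousLinearMap_le _ _).trans ?_
  refine mul_le_of_le_one_right (norm_nonneg _) ?_
  simpa using pow_le_one₀ (norm_nonneg _) hL

/-- Decay in the first momentum and decay in the others together give decay in all momenta. -/
theorem norm_le_one_add_norm_mul_one_add_norm {n : ℕ} (P : Fin (n + 1) → R3) :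
    ‖P‖ ≤ (1 + ‖headCLM n P‖) * (1 + ‖tailCLM n P‖) := by
  have h : ‖P‖ ≤ ‖headCLM n P‖ + ‖tailCLM n P‖ := by
    refine (pi_norm_le_iff_of_nonneg (by positivity)).2 fun i => ?_
    refine Fin.cases ?_ (fun i => ?_) i
    · exact le_add_of_nonneg_right (norm_nonneg _)
    · exact (norm_le_pi_norm (tailCLM n P) i).trans (le_add_of_nonneg_left (norm_nonneg _))
  nlinarith [norm_nonneg (headCLM n P), norm_nonneg (tailCLM n P),
    mul_nonneg (norm_nonneg (headCLM n P)) (norm_nonneg (tailCLM n P))]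

/-- The tensor product `f ⊗ G : (p, q) ↦ f(p) G(q)`, as an operator in `G`. -/
def tensor {n : ℕ} (f : 𝓢(R3, ℂ)) : 𝓢(Fin n → R3, ℂ) →L[ℂ] 𝓢(Fin (n + 1) → R3, ℂ) :=
  SchwartzMap.mkCLM (fun G P => f (headCLM n P) * G (tailCLM n P))
    (fun F G P => by simp [mul_add]) (fun c G P => by simp; ring)
    (fun G => (f.smooth'.comp (headCLM n).contDiff).mul (G.smooth'.comp (tailCLM n).contDiff)) <| by
  rintro ⟨k, m⟩
  let q := (Finset.Iic (k, m)).sup (fun m => SchwartzMap.seminorm ℂ m.1 m.2) f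
  refine ⟨Finset.Iic (k, m), ∑ i ∈ Finset.range (m + 1), (m.choose i : ℝ) * (2 ^ k * q) * 2 ^ k,
    by positivity, fun G P => ?_⟩
  simp only
  have h1 := norm_iteratedFDeriv_mul_le (n := m) (N := ∞) (f.smooth'.comp (headCLM n).contDiff)
    (G.smooth'.comp (tailCLM n).contDiff) P (mod_cast le_top)
  refine (mul_le_mul_of_nonneg_left h1 (by positivity)).trans ?_
  rw [Finset.mul_sum, Finset.sum_mul]
  refine Finset.sum_le_sum fun i hi => ?_
  have hi' : i ≤ m := Finset.mem_range_succ_iff.1 hi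
  have hf : (1 + ‖headCLM n P‖) ^ k * ‖iteratedFDeriv ℝ i (fun P => f (headCLM n P)) P‖
      ≤ 2 ^ k * q :=
    (mul_le_mul_of_nonneg_left (norm_iteratedFDeriv_comp_le_of_norm_le_one _
      (norm_headCLM_le n) f i P) (by positivity)).trans
      (one_add_le_sup_seminorm_apply (m := (k, m)) le_rfl hi' f _)
  have hG : (1 + ‖tailCLM n P‖) ^ k * ‖iteratedFDeriv ℝ (m - i) (fun P => G (tailCLM n P)) P‖
      ≤ 2 ^ k * (Finset.Iic (k, m)).sup (schwartzSeminormFamily ℂ _ _) G :=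
    (mul_le_mul_of_nonneg_left (norm_iteratedFDeriv_comp_le_of_norm_le_one _
      (norm_tailCLM_le n) G (m - i) P) (by positivity)).trans
      (one_add_le_sup_seminorm_apply (m := (k, m)) le_rfl (Nat.sub_le m i) G _)
  calc _ ≤ ((1 + ‖headCLM n P‖) * (1 + ‖tailCLM n P‖)) ^ k * (m.choose i *
        ‖iteratedFDeriv ℝ i (fun P => f (headCLM n P)) P‖ *
        ‖iteratedFDeriv ℝ (m - i) (fun P => G (tailCLM n P)) P‖) := by
        gcongr ?_ ^ k * _
        exact norm_le_one_add_norm_mul_one_add_norm P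
    _ = m.choose i * ((1 + ‖headCLM n P‖) ^ k *
        ‖iteratedFDeriv ℝ i (fun P => f (headCLM n P)) P‖) * ((1 + ‖tailCLM n P‖) ^ k *
        ‖iteratedFDeriv ℝ (m - i) (fun P => G (tailCLM n P)) P‖) := by
        rw [mul_pow]; ring
    _ ≤ m.choose i * (2 ^ k * q) * (2 ^ k *
        (Finset.Iic (k, m)).sup (schwartzSeminormFamily ℂ _ _) G) := by
        gcongr
    _ = _ := by ring

theorem tensor_apply {n : ℕ} (f : 𝓢(R3, ℂ)) (G : 𝓢(Fin n → R3, ℂ)) (P : Fin (n + 1) → R3) :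
    tensor f G P = f (P 0) * G (Fin.tail P) := rfl

theorem head_hasTemperateGrowth (n : ℕ) (f : 𝓢(R3, ℂ)) :
    (fun P : Fin (n + 1) → R3 => f (P 0)).HasTemperateGrowth :=
  f.hasTemperateGrowth.comp (headCLM n).hasTemperateGrowth

/-- The contraction `q ↦ ∫ f(p) G(p, q) dp` of the first momentum with `f`. -/
def contract {n : ℕ} (f : 𝓢(R3, ℂ)) : 𝓢(Fin (n + 1) → R3, ℂ) →L[ℂ] 𝓢(Fin n → R3, ℂ) :=
  (partialIntegral (consHead n) (consTail n) volume norm_head_le norm_tail_le).comp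
    (SchwartzMap.smulLeftCLM ℂ fun P : Fin (n + 1) → R3 => f (P 0))

theorem contract_apply {n : ℕ} (f : 𝓢(R3, ℂ)) (G : 𝓢(Fin (n + 1) → R3, ℂ)) (q : Fin n → R3) :
    contract f G q = ∫ p, f p * G (Fin.cons p q) := by
  rw [contract, ContinuousLinearMap.comp_apply, partialIntegral_apply]
  simp_rw [SchwartzMap.smulLeftCLM_apply_apply (head_hasTemperateGrowth n f),
    consHead_add_consTail, smul_eq_mul, Fin.cons_zero]

/-! ### Fubini's theorem for the first momentum -/

/-- Splitting off the first of `n + 1` momenta. -/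
def splitHead (n : ℕ) : (Fin (n + 1) → R3) ≃ᵐ R3 × (Fin n → R3) :=
  MeasurableEquiv.piFinSuccAbove (fun _ => R3) 0

theorem splitHead_symm_apply {n : ℕ} (z : R3 × (Fin n → R3)) :
    (splitHead n).symm z = Fin.cons z.1 z.2 := by
  simp [splitHead, MeasurableEquiv.piFinSuccAbove, Fin.insertNthEquiv]

theorem measurePreserving_splitHead_symm (n : ℕ) :
    MeasurePreserving (splitHead n).symm (volume : Measure (R3 × (Fin n → R3))) volume :=
  (volume_preserving_piFinSuccAbove (fun _ : Fin (n + 1) => R3) 0).symm _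

theorem integrable_cons {V : Type} [NormedAddCommGroup V] {n : ℕ} {H : (Fin (n + 1) → R3) → V}
    (hH : Integrable H) :
    Integrable (fun z : R3 × (Fin n → R3) => H (Fin.cons z.1 z.2)) (volume.prod volume) := by
  have := (measurePreserving_splitHead_symm n).integrable_comp_of_integrable hH
  simp only [Function.comp_def, splitHead_symm_apply] at this
  exact this

theorem integral_cons {V : Type} [NormedAddCommGroup V] [NormedSpace ℝ V] {n : ℕ}
    (H : (Fin (n + 1) → R3) → V) :
    ∫ P, H P = ∫ z : R3 × (Fin n → R3), H (Fin.cons z.1 z.2) ∂(volume.prod volume) := by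
  rw [← (measurePreserving_splitHead_symm n).integral_comp' H]
  simp_rw [splitHead_symm_apply]
  rfl

theorem lintegral_cons {n : ℕ} (H : (Fin (n + 1) → R3) → ENNReal) :
    ∫⁻ P, H P = ∫⁻ z : R3 × (Fin n → R3), H (Fin.cons z.1 z.2) ∂(volume.prod volume) := by
  rw [← (measurePreserving_splitHead_symm n).lintegral_comp_emb
    (splitHead n).symm.measurableEmbedding H]
  simp_rw [splitHead_symm_apply]
  rfl

/-! ### The square of the `L²` norm -/

theorem rpow_half_sq (x : ENNReal) : (x ^ (1 / 2 : ℝ)) ^ 2 = x := by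
  rw [← ENNReal.rpow_two, ← ENNReal.rpow_mul]
  norm_num

/-- The square of the `L²` norm of a Schwartz function. -/
def sqNorm {D : Type} [NormedAddCommGroup D] [NormedSpace ℝ D] [MeasureSpace D] (F : 𝓢(D, ℂ)) :
    ENNReal :=
  ∫⁻ x, ‖F x‖ₑ ^ 2

section SqNorm

variable {D : Type} [NormedAddCommGroup D] [NormedSpace ℝ D] [MeasureSpace D] [BorelSpace D]
  [(volume : Measure D).HasTemperateGrowth]

theorem sqNorm_eq_enorm_toLp (F : 𝓢(D, ℂ)) : sqNorm F = ‖F.toLp 2 volume‖ₑ ^ 2 := by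
  rw [SchwartzMap.toLp, Lp.enorm_toLp, eLpNorm_eq_lintegral_rpow_enorm_toReal (by simp) (by simp)]
  simp only [ENNReal.toReal_ofNat, ENNReal.rpow_ofNat, one_div]
  rw [← ENNReal.rpow_two, ← ENNReal.rpow_mul]
  simp [sqNorm]

theorem sqNorm_lt_top (F : 𝓢(D, ℂ)) : sqNorm F < ⊤ := by
  rw [sqNorm_eq_enorm_toLp]
  simp

theorem sqNorm_smul (c : ℂ) (F : 𝓢(D, ℂ)) : sqNorm (c • F) = ‖c‖ₑ ^ 2 * sqNorm F := by
  simp only [sqNorm_eq_enorm_toLp]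
  rw [← mul_pow, ← enorm_smul]
  rfl

theorem sqNorm_sum_le {ι : Type} (s : Finset ι) (F : ι → 𝓢(D, ℂ)) :
    sqNorm (∑ i ∈ s, F i) ≤ s.card * ∑ i ∈ s, sqNorm (F i) := by
  have h1 : sqNorm (∑ i ∈ s, F i) ≤ (∑ i ∈ s, ‖(F i).toLp 2 volume‖ₑ) ^ 2 := by
    rw [sqNorm_eq_enorm_toLp]
    have : (∑ i ∈ s, F i).toLp 2 volume = ∑ i ∈ s, (F i).toLp 2 (volume : Measure D) :=
      map_sum (SchwartzMap.toLpCLM ℂ ℂ 2 (volume : Measure D)) F s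
    rw [this]
    gcongr
    exact enorm_sum_le _ _
  refine h1.trans ?_
  simp only [sqNorm_eq_enorm_toLp]
  have := ENNReal.inner_le_Lp_mul_Lq s (fun _ => 1) (fun i => ‖(F i).toLp 2 (volume : Measure D)‖ₑ)
    Real.HolderConjugate.two_two
  simp only [one_mul, Finset.sum_const, nsmul_eq_mul, ENNReal.rpow_two] at this
  calc _ ≤ _ := pow_le_pow_left' this 2
    _ = _ := by
      rw [mul_pow, rpow_half_sq, rpow_half_sq, one_pow, mul_one]

end SqNorm

theorem sqNorm_tensor {n : ℕ} (f : 𝓢(R3, ℂ)) (G : 𝓢(Fin n → R3, ℂ)) :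
    sqNorm (tensor f G) = sqNorm f * sqNorm G := by
  rw [sqNorm, lintegral_cons]
  simp_rw [tensor_apply, Fin.cons_zero, Fin.tail_cons, enorm_mul, mul_pow]
  exact lintegral_prod_mul (f.continuous.aemeasurable.enorm.pow_const 2)
    (G.continuous.aemeasurable.enorm.pow_const 2)

/-- The Cauchy–Schwarz inequality in the contracted momentum. -/
theorem sqNorm_contract_le {n : ℕ} (f : 𝓢(R3, ℂ)) (G : 𝓢(Fin (n + 1) → R3, ℂ)) :
    sqNorm (contract f G) ≤ sqNorm f * sqNorm G := by
  have hm : Measurable fun z : R3 × (Fin n → R3) => ‖G (Fin.cons z.1 z.2)‖ₑ ^ 2 := by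
    have : (fun z : R3 × (Fin n → R3) => ‖G (Fin.cons z.1 z.2)‖ₑ ^ 2) =
        fun z => ‖G ((splitHead n).symm z)‖ₑ ^ 2 := by simp_rw [splitHead_symm_apply]
    rw [this]
    exact (G.continuous.measurable.comp (splitHead n).symm.measurable).enorm.pow_const 2
  have h (q : Fin n → R3) : ‖contract f G q‖ₑ ^ 2 ≤ sqNorm f * ∫⁻ p, ‖G (Fin.cons p q)‖ₑ ^ 2 := by
    have hG : Continuous fun p : R3 => G (Fin.cons p q) := by
      simp_rw [← consHead_add_consTail]
      fun_prop
    have h1 : ‖contract f G q‖ₑ ≤ ∫⁻ p, ‖f p‖ₑ * ‖G (Fin.cons p q)‖ₑ := by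
      rw [contract_apply]
      refine (enorm_integral_le_lintegral_enorm _).trans ?_
      simp_rw [enorm_mul]
      exact le_rfl
    have h2 := ENNReal.lintegral_mul_le_Lp_mul_Lq volume Real.HolderConjugate.two_two
      (f := fun p => ‖f p‖ₑ) (g := fun p : R3 => ‖G (Fin.cons p q)‖ₑ) (by fun_prop) (by fun_prop)
    simp only [Pi.mul_apply, ENNReal.rpow_two] at h2
    calc _ ≤ _ := pow_le_pow_left' (h1.trans h2) 2
      _ = _ := by
        rw [mul_pow, rpow_half_sq, rpow_half_sq, sqNorm]
  calc sqNorm (contract f G) ≤ ∫⁻ q, sqNorm f * ∫⁻ p, ‖G (Fin.cons p q)‖ₑ ^ 2 := lintegral_mono h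
    _ = sqNorm f * sqNorm G := by
      rw [lintegral_const_mul _ hm.lintegral_prod_left', sqNorm, sqNorm, lintegral_cons,
        lintegral_prod_symm' _ hm]

/-- The contraction with `f` is the transpose of the tensor product with `f`. -/
theorem integral_contract_mul {n : ℕ} (f : 𝓢(R3, ℂ)) (G : 𝓢(Fin (n + 1) → R3, ℂ))
    (F : 𝓢(Fin n → R3, ℂ)) :
    ∫ q, contract f G q * F q = ∫ P, tensor f F P * G P := by
  have hint : Integrable fun P => tensor f F P * G P :=
    ((SchwartzMap.pairing (ContinuousLinearMap.mul ℂ ℂ)) (tensor f F) G).integrable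
  rw [integral_cons, integral_prod_symm _ (integrable_cons hint)]
  congr 1 with q
  rw [contract_apply, ← integral_mul_const]
  congr 1 with p
  rw [tensor_apply, Fin.cons_zero, Fin.tail_cons]
  ring

/-! ### Line derivatives and multiplication operators -/

section LineDerivative

open LineDeriv

variable {D : Type} [NormedAddCommGroup D] [NormedSpace ℝ D]

theorem lineDerivOp_comm (v w : D) (F : 𝓢(D, ℂ)) :
    lineDerivOp v (lineDerivOp w F) = lineDerivOp w (lineDerivOp v F) := by
  have h (v w : D) (x : D) :
      lineDerivOp v (lineDerivOp w F) x = fderiv ℝ (fderiv ℝ F) x v w := by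
    rw [SchwartzMap.lineDerivOp_apply_eq_fderiv]
    have : ((lineDerivOp w F : 𝓢(D, ℂ)) : D → ℂ) = fun y => fderiv ℝ F y w :=
      funext fun y => SchwartzMap.lineDerivOp_apply_eq_fderiv w F y
    have hd : DifferentiableAt ℝ (fderiv ℝ F) x := (SchwartzMap.fderivCLM ℝ D ℂ F).differentiableAt
    rw [this, fderiv_clm_apply hd (differentiableAt_const w)]
    simp
  ext x
  rw [h, h]
  exact ((F.contDiffAt 2).isSymmSndFDerivAt (by simp)).eq v w

/-- A line derivative commutes with the multiplication by a function which is constant in the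
direction of the derivative. -/
theorem lineDerivOp_smulLeftCLM {u : D → ℂ} (hu : u.HasTemperateGrowth) (v : D)
    (h : ∀ x (t : ℝ), u (x + t • v) = u x) (F : 𝓢(D, ℂ)) :
    lineDerivOp v (SchwartzMap.smulLeftCLM ℂ u F) =
      SchwartzMap.smulLeftCLM ℂ u (lineDerivOp v F) := by
  ext x
  rw [SchwartzMap.smulLeftCLM_apply_apply hu, SchwartzMap.lineDerivOp_apply,
    SchwartzMap.lineDerivOp_apply, lineDeriv, lineDeriv]
  simp_rw [SchwartzMap.smulLeftCLM_apply_apply hu, h, smul_eq_mul]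
  exact deriv_const_mul_field _

/-- The product rule for a coordinate `u` with `∂ᵥ u = 1`. -/
theorem lineDerivOp_smulLeftCLM_of_linear {u : D →L[ℝ] ℝ} (v : D) (h : u v = 1) (F : 𝓢(D, ℂ)) :
    lineDerivOp v (SchwartzMap.smulLeftCLM ℂ (fun x => (u x : ℂ)) F) =
      F + SchwartzMap.smulLeftCLM ℂ (fun x => (u x : ℂ)) (lineDerivOp v F) := by
  have hu : (fun x => (u x : ℂ)).HasTemperateGrowth := (Complex.ofRealCLM.comp u).hasTemperateGrowth
  ext x
  rw [add_apply, SchwartzMap.smulLeftCLM_apply_apply hu, SchwartzMap.lineDerivOp_apply_eq_fderiv,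
    SchwartzMap.lineDerivOp_apply_eq_fderiv]
  have h1 : HasFDerivAt (fun x => (u x : ℂ)) (Complex.ofRealCLM.comp u) x :=
    (Complex.ofRealCLM.comp u).hasFDerivAt
  have h2 := (h1.mul (F.hasFDerivAt x)).fderiv
  have h3 : (SchwartzMap.smulLeftCLM ℂ (fun x => (u x : ℂ)) F : D → ℂ) =
      (fun x => (u x : ℂ)) * F := by
    ext x
    rw [SchwartzMap.smulLeftCLM_apply_apply hu]
    rfl
  rw [h3, h2]
  simp [h, add_comm]

end LineDerivative

/-! ### The oscillator Hamiltonians -/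

section Oscillator

open LineDeriv

/-- The unit vector in the direction of the `j`-th component of the `i`-th momentum. -/
def unitVec (n : ℕ) (i : Fin n) (j : Fin 3) : Fin n → R3 :=
  Pi.single i (EuclideanSpace.single j (1 : ℝ))

/-- The potential `|pᵢ|² + 1` as a multiplication operator. -/
def oscPot (n : ℕ) (i : Fin n) : 𝓢(Fin n → R3, ℂ) →L[ℂ] 𝓢(Fin n → R3, ℂ) :=
  SchwartzMap.smulLeftCLM ℂ (fun p : Fin n → R3 => ((‖p i‖ ^ 2 + 1 : ℝ) : ℂ))

theorem oscPot_apply (n : ℕ) (i : Fin n) (F : 𝓢(Fin n → R3, ℂ)) (p : Fin n → R3) :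
    oscPot n i F p = ((‖p i‖ ^ 2 + 1 : ℝ) : ℂ) * F p :=
  SchwartzMap.smulLeftCLM_apply_apply (oscPotential_hasTemperateGrowth n i) F p

theorem osc_eq (n : ℕ) (i : Fin n) :
    osc n i = oscPot n i -
      ∑ j : Fin 3, (lineDerivOpCLM ℂ 𝓢(Fin n → R3, ℂ) (unitVec n i j)) ^ 2 := rfl

theorem osc_apply (n : ℕ) (i : Fin n) (F : 𝓢(Fin n → R3, ℂ)) :
    osc n i F = oscPot n i F -
      ∑ j : Fin 3, lineDerivOp (unitVec n i j) (lineDerivOp (unitVec n i j) F) := by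
  rw [osc_eq, sub_apply, sum_apply]
  simp [pow_two]

theorem commute_osc (n : ℕ) {i k : Fin n} (hik : i ≠ k) : Commute (osc n i) (osc n k) := by
  have hMM : Commute (oscPot n i) (oscPot n k) := by
    ext F p
    simp only [mul_apply_eq_comp, oscPot_apply]
    ring
  have hMD (a b : Fin n) (hab : a ≠ b) (j : Fin 3) :
      Commute (oscPot n a) (lineDerivOpCLM ℂ 𝓢(Fin n → R3, ℂ) (unitVec n b j)) := by
    refine ContinuousLinearMap.ext fun F => ?_
    rw [mul_apply_eq_comp, mul_apply_eq_comp, lineDerivOpCLM_apply,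
      lineDerivOpCLM_apply]
    refine (lineDerivOp_smulLeftCLM (oscPotential_hasTemperateGrowth n a) _ (fun x t => ?_) F).symm
    simp [unitVec, hab]
  have hDD (j l : Fin 3) : Commute (lineDerivOpCLM ℂ 𝓢(Fin n → R3, ℂ) (unitVec n i j))
      (lineDerivOpCLM ℂ 𝓢(Fin n → R3, ℂ) (unitVec n k l)) := by
    refine ContinuousLinearMap.ext fun F => ?_
    simp only [mul_apply_eq_comp, lineDerivOpCLM_apply]
    exact lineDerivOp_comm _ _ _
  rw [osc_eq, osc_eq]
  refine Commute.sub_left (Commute.sub_right hMM ?_) (Commute.sub_right ?_ ?_)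
  · exact Commute.sum_right _ _ _ fun j _ => (hMD i k hik j).pow_right 2
  · exact Commute.sum_left _ _ _ fun j _ => ((hMD k i hik.symm j).pow_right 2).symm
  · exact Commute.sum_left _ _ _ fun j _ => Commute.sum_right _ _ _ fun l _ => (hDD j l).pow_pow 2 2

/-- The `L²` inner product of Schwartz functions. -/
def innerL2 {n : ℕ} (F G : 𝓢(Fin n → R3, ℂ)) : ℂ :=
  inner ℂ (SchwartzMap.toLpCLM ℂ ℂ 2 volume F) (SchwartzMap.toLpCLM ℂ ℂ 2 volume G)

theorem innerL2_add_left {n : ℕ} (F G H : 𝓢(Fin n → R3, ℂ)) :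
    innerL2 (F + G) H = innerL2 F H + innerL2 G H := by
  rw [innerL2, map_add, inner_add_left]; rfl

theorem innerL2_add_right {n : ℕ} (F G H : 𝓢(Fin n → R3, ℂ)) :
    innerL2 F (G + H) = innerL2 F G + innerL2 F H := by
  rw [innerL2, map_add, inner_add_right]; rfl

theorem innerL2_eq {n : ℕ} (F G : 𝓢(Fin n → R3, ℂ)) :
    innerL2 F G = ∫ p, inner ℂ (F p) (G p) :=
  SchwartzMap.inner_toL2_toL2_eq F G volume

theorem innerL2_self {n : ℕ} (F : 𝓢(Fin n → R3, ℂ)) :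
    innerL2 F F = ((‖SchwartzMap.toLpCLM ℂ ℂ 2 volume F‖ ^ 2 : ℝ) : ℂ) := by
  rw [innerL2, inner_self_eq_norm_sq_to_K]
  simp

theorem innerL2_lineDerivOp {n : ℕ} (v : Fin n → R3) (F G : 𝓢(Fin n → R3, ℂ)) :
    innerL2 F (lineDerivOp v G) = -innerL2 (lineDerivOp v F) G := by
  rw [innerL2_eq, innerL2_eq]
  have := SchwartzMap.integral_bilinear_lineDerivOp_right_eq_neg_left (μ := volume) F G
    ((ContinuousLinearMap.mul ℝ ℂ).comp (Complex.conjCLE : ℂ →L[ℝ] ℂ)) v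
  simpa [mul_comm] using this

theorem innerL2_smulLeftCLM {n : ℕ} (u : (Fin n → R3) →L[ℝ] ℝ) (F G : 𝓢(Fin n → R3, ℂ)) :
    innerL2 F (SchwartzMap.smulLeftCLM ℂ (fun x => (u x : ℂ)) G) =
      innerL2 (SchwartzMap.smulLeftCLM ℂ (fun x => (u x : ℂ)) F) G := by
  have hu : (fun x => (u x : ℂ)).HasTemperateGrowth := (Complex.ofRealCLM.comp u).hasTemperateGrowth
  rw [innerL2_eq, innerL2_eq]
  congr 1 with p
  simp only [SchwartzMap.smulLeftCLM_apply_apply hu, smul_eq_mul, RCLike.inner_apply, map_mul,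
    Complex.conj_ofReal]
  ring

/-- The `j`-th component of the `i`-th momentum. -/
def coordCLM (n : ℕ) (i : Fin n) (j : Fin 3) : (Fin n → R3) →L[ℝ] ℝ :=
  (EuclideanSpace.proj j).comp (ContinuousLinearMap.proj i)

/-- The operator of multiplication by `pᵢⱼ`. -/
def coordMul (n : ℕ) (i : Fin n) (j : Fin 3) : 𝓢(Fin n → R3, ℂ) →L[ℂ] 𝓢(Fin n → R3, ℂ) :=
  SchwartzMap.smulLeftCLM ℂ fun p => (coordCLM n i j p : ℂ)

theorem coordMul_apply (n : ℕ) (i : Fin n) (j : Fin 3) (F : 𝓢(Fin n → R3, ℂ)) (p : Fin n → R3) :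
    coordMul n i j F p = (p i j : ℂ) * F p :=
  SchwartzMap.smulLeftCLM_apply_apply (Complex.ofRealCLM.comp (coordCLM n i j)).hasTemperateGrowth
    F p

/-- The annihilation operator `A = x + ∂` of a one-dimensional oscillator satisfies
`A†A = x² - ∂² - 1`. -/
theorem innerL2_ladder {n : ℕ} (i : Fin n) (j : Fin 3) (F : 𝓢(Fin n → R3, ℂ)) :
    innerL2 F (coordMul n i j (coordMul n i j F)) -
        innerL2 F (lineDerivOp (unitVec n i j) (lineDerivOp (unitVec n i j) F)) =
      innerL2 (coordMul n i j F + lineDerivOp (unitVec n i j) F)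
        (coordMul n i j F + lineDerivOp (unitVec n i j) F) + innerL2 F F := by
  have h1 : lineDerivOp (unitVec n i j) (coordMul n i j F) =
      F + coordMul n i j (lineDerivOp (unitVec n i j) F) :=
    lineDerivOp_smulLeftCLM_of_linear _ (by simp [coordCLM, unitVec]) F
  have h2 (F G) : innerL2 F (coordMul n i j G) = innerL2 (coordMul n i j F) G :=
    innerL2_smulLeftCLM _ F G
  have h3 : innerL2 (lineDerivOp (unitVec n i j) F) (coordMul n i j F) =
      -innerL2 F F - innerL2 (coordMul n i j F) (lineDerivOp (unitVec n i j) F) := by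
    rw [← h2, ← neg_eq_iff_eq_neg.2 (innerL2_lineDerivOp (unitVec n i j) F (coordMul n i j F)),
      h1, innerL2_add_right]
    ring
  rw [innerL2_lineDerivOp, h2, innerL2_add_left, innerL2_add_right, innerL2_add_right, h3]
  ring

theorem oscPot_eq (n : ℕ) (i : Fin n) (F : 𝓢(Fin n → R3, ℂ)) :
    oscPot n i F = ∑ j, coordMul n i j (coordMul n i j F) + F := by
  ext p
  rw [oscPot_apply, add_apply, sum_apply, EuclideanSpace.norm_sq_eq]
  simp only [coordMul_apply, Real.norm_eq_abs, sq_abs]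
  push_cast
  rw [add_mul, Finset.sum_mul, one_mul]
  congr 1
  exact Finset.sum_congr rfl fun j _ => by ring

/-- The spectrum of `-Δ + |p|² + 1` in three dimensions starts at `4`. -/
theorem four_mul_norm_le_norm_osc {n : ℕ} (i : Fin n) (F : 𝓢(Fin n → R3, ℂ)) :
    4 * ‖SchwartzMap.toLpCLM ℂ ℂ 2 volume F‖ ≤
      ‖SchwartzMap.toLpCLM ℂ ℂ 2 volume (osc n i F)‖ := by
  set N := ‖SchwartzMap.toLpCLM ℂ ℂ 2 volume F‖ with hN
  have h1 : innerL2 F (osc n i F) = ∑ j : Fin 3, (innerL2 F (coordMul n i j (coordMul n i j F)) -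
      innerL2 F (lineDerivOp (unitVec n i j) (lineDerivOp (unitVec n i j) F))) + innerL2 F F := by
    rw [osc_apply, oscPot_eq, Finset.sum_sub_distrib]
    simp only [innerL2, map_sub, map_add, map_sum, inner_sub_right, inner_add_right, inner_sum]
    ring
  have h2 : (innerL2 F (osc n i F)).re = ∑ j : Fin 3,
      (innerL2 (coordMul n i j F + lineDerivOp (unitVec n i j) F)
        (coordMul n i j F + lineDerivOp (unitVec n i j) F)).re + 4 * N ^ 2 := by
    rw [h1]
    simp_rw [innerL2_ladder, Finset.sum_add_distrib, Complex.add_re, Complex.re_sum, innerL2_self,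
      Complex.ofReal_re]
    simp only [Finset.sum_const, Finset.card_univ, Fintype.card_fin, nsmul_eq_mul]
    push_cast
    ring
  have h3 : 4 * N ^ 2 ≤ (innerL2 F (osc n i F)).re := by
    rw [h2]
    refine le_add_of_nonneg_left (Finset.sum_nonneg fun j _ => ?_)
    rw [innerL2_self, Complex.ofReal_re]
    positivity
  have h4 : (innerL2 F (osc n i F)).re ≤
      N * ‖SchwartzMap.toLpCLM ℂ ℂ 2 volume (osc n i F)‖ :=
    (Complex.re_le_norm _).trans (norm_inner_le_norm _ _)
  rcases (norm_nonneg (SchwartzMap.toLpCLM ℂ ℂ 2 volume F)).eq_or_lt with h | h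
  · rw [hN, ← h]; simp
  · exact le_of_mul_le_mul_left (by nlinarith) (hN ▸ h)

theorem sqNorm_le_sqNorm_osc {n : ℕ} (i : Fin n) (F : 𝓢(Fin n → R3, ℂ)) :
    16 * sqNorm F ≤ sqNorm (osc n i F) := by
  rw [sqNorm_eq_enorm_toLp, sqNorm_eq_enorm_toLp]
  have h : (4 : ENNReal) * ‖F.toLp 2 volume‖ₑ ≤ ‖(osc n i F).toLp 2 volume‖ₑ := by
    rw [← ofReal_norm, ← ofReal_norm, ← ENNReal.ofReal_ofNat, ← ENNReal.ofReal_mul (by norm_num)]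
    exact ENNReal.ofReal_le_ofReal (four_mul_norm_le_norm_osc i F)
  calc _ = ((4 : ENNReal) * ‖F.toLp 2 volume‖ₑ) ^ 2 := by rw [mul_pow]; norm_num
    _ ≤ _ := pow_le_pow_left' h 2

theorem sqNorm_le_sqNorm_list_prod {n : ℕ} (l : List (Fin n)) (F : 𝓢(Fin n → R3, ℂ)) :
    16 ^ l.length * sqNorm F ≤ sqNorm ((l.map (osc n)).prod F) := by
  induction l with
  | nil => simp
  | cons i l ih =>
    rw [List.map_cons, List.prod_cons, mul_apply_eq_comp, List.length_cons, pow_succ',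
      mul_assoc]
    exact (mul_le_mul_right ih 16).trans (sqNorm_le_sqNorm_osc i _)

theorem sqNorm_le_sqNorm_oscTensor {n : ℕ} (F : 𝓢(Fin n → R3, ℂ)) :
    16 ^ n * sqNorm F ≤ sqNorm (oscTensor n F) := by
  have := sqNorm_le_sqNorm_list_prod (List.ofFn fun i : Fin n => i) F
  rwa [List.length_ofFn, List.map_ofFn] at this

/-- The tensor power of the oscillator Hamiltonian is bounded below by `4ⁿ` on `n` particles. Hence
a single additional power of it absorbs every factor that grows at most like `16ⁿ` with the particle
number. -/
theorem sqNorm_pow_succ {n : ℕ} (k : ℕ) (F : 𝓢(Fin n → R3, ℂ)) :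
    16 ^ n * sqNorm ((oscTensor n ^ k) F) ≤ sqNorm ((oscTensor n ^ (k + 1)) F) := by
  rw [pow_succ', mul_apply_eq_comp]
  exact sqNorm_le_sqNorm_oscTensor _

theorem sqNorm_le_sqNorm_osc_pow {n : ℕ} (i : Fin n) (k : ℕ) (F : 𝓢(Fin n → R3, ℂ)) :
    sqNorm F ≤ sqNorm ((osc n i ^ k) F) := by
  induction k with
  | zero => simp
  | succ k ih =>
    rw [pow_succ', mul_apply_eq_comp]
    refine ih.trans (le_trans ?_ (sqNorm_le_sqNorm_osc i _))
    exact le_mul_of_one_le_left zero_le (by norm_num)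

/-! ### The oscillator Hamiltonians and permutations -/

/-- The composition of functions of `n` momenta with a permutation of the momenta. -/
def permCLM {n : ℕ} (σ : Equiv.Perm (Fin n)) : 𝓢(Fin n → R3, ℂ) →L[ℂ] 𝓢(Fin n → R3, ℂ) :=
  SchwartzMap.compCLMOfContinuousLinearEquiv ℂ
    (LinearEquiv.funCongrLeft ℝ R3 σ).toContinuousLinearEquiv

theorem permCLM_apply {n : ℕ} (σ : Equiv.Perm (Fin n)) (F : 𝓢(Fin n → R3, ℂ)) (p : Fin n → R3) :
    permCLM σ F p = F (p ∘ σ) := rfl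

theorem measurePreserving_comp_perm {n : ℕ} (σ : Equiv.Perm (Fin n)) :
    MeasurePreserving (fun p : Fin n → R3 => p ∘ σ) :=
  volume_preserving_arrowCongr' σ.symm (MeasurableEquiv.refl R3) (MeasurePreserving.id _)

theorem measurableEmbedding_comp_perm {n : ℕ} (σ : Equiv.Perm (Fin n)) :
    MeasurableEmbedding (fun p : Fin n → R3 => p ∘ σ) :=
  (MeasurableEquiv.arrowCongr' σ.symm (MeasurableEquiv.refl R3)).measurableEmbedding

theorem sqNorm_permCLM {n : ℕ} (σ : Equiv.Perm (Fin n)) (F : 𝓢(Fin n → R3, ℂ)) :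
    sqNorm (permCLM σ F) = sqNorm F :=
  (measurePreserving_comp_perm σ).lintegral_comp_emb (measurableEmbedding_comp_perm σ)
    fun p => ‖F p‖ₑ ^ 2

theorem osc_permCLM {n : ℕ} (σ : Equiv.Perm (Fin n)) (i : Fin n) :
    osc n i * permCLM σ = permCLM σ * osc n (σ.symm i) := by
  refine ContinuousLinearMap.ext fun F => ?_
  have h (j : Fin 3) (G) : lineDerivOp (unitVec n i j) (permCLM σ G) =
      permCLM σ (lineDerivOp (unitVec n (σ.symm i) j) G) := by
    rw [permCLM, SchwartzMap.lineDerivOp_compCLMOfContinuousLinearEquiv]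
    congr 2
    ext k : 1
    change unitVec n i j (σ k) = _
    simp only [unitVec, Pi.single_apply, Equiv.eq_symm_apply]
  rw [mul_apply_eq_comp, mul_apply_eq_comp, osc_apply, osc_apply, map_sub, map_sum]
  simp_rw [h]
  congr 1
  ext p
  simp [oscPot_apply, permCLM_apply]

/-- The product of the Hamiltonians is symmetric in the particles because its factors commute. -/
theorem oscTensor_permCLM {n : ℕ} (σ : Equiv.Perm (Fin n)) :
    Commute (oscTensor n) (permCLM σ) := by
  have h (l : List (Fin n)) : (l.map (osc n)).prod * permCLM σ =
      permCLM σ * (l.map fun i => osc n (σ.symm i)).prod := by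
    induction l with
    | nil => simp
    | cons i l ih =>
      rw [List.map_cons, List.map_cons, List.prod_cons, List.prod_cons, mul_assoc, ih, ← mul_assoc,
        osc_permCLM, mul_assoc]
  have h1 := h (List.ofFn fun i : Fin n => i)
  rw [List.map_ofFn, List.map_ofFn] at h1
  have h2 : (List.ofFn fun i => osc n (σ.symm i)).prod = oscTensor n := by
    refine (List.Perm.prod_eq' (Equiv.Perm.ofFn_comp_perm σ.symm (osc n)).symm ?_).symm
    rw [List.pairwise_ofFn]
    exact fun i j hij => commute_osc n hij.ne
  exact h1.trans (congrArg _ h2)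

theorem sqNorm_oscTensor_permCLM {n : ℕ} (σ : Equiv.Perm (Fin n)) (k : ℕ)
    (F : 𝓢(Fin n → R3, ℂ)) :
    sqNorm ((oscTensor n ^ k) (permCLM σ F)) = sqNorm ((oscTensor n ^ k) F) := by
  have := DFunLike.congr_fun ((oscTensor_permCLM σ).pow_left k).eq F
  rw [mul_apply_eq_comp, mul_apply_eq_comp] at this
  rw [this, sqNorm_permCLM]

/-! ### The oscillator Hamiltonians, tensor products and contractions -/

theorem normSq_hasTemperateGrowth :
    (fun p : R3 => ((‖p‖ ^ 2 + 1 : ℝ) : ℂ)).HasTemperateGrowth :=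
  Complex.ofRealCLM.hasTemperateGrowth.comp
    ((Function.hasTemperateGrowth_norm_sq R3).add (.const 1))

/-- The oscillator Hamiltonian `-Δ + |p|² + 1` of a single particle. -/
def oscOne : 𝓢(R3, ℂ) →L[ℂ] 𝓢(R3, ℂ) :=
  SchwartzMap.smulLeftCLM ℂ (fun p : R3 => ((‖p‖ ^ 2 + 1 : ℝ) : ℂ)) -
    ∑ j : Fin 3, (lineDerivOpCLM ℂ 𝓢(R3, ℂ) (EuclideanSpace.single j (1 : ℝ))) ^ 2

theorem oscOne_apply (f : 𝓢(R3, ℂ)) :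
    oscOne f = SchwartzMap.smulLeftCLM ℂ (fun p : R3 => ((‖p‖ ^ 2 + 1 : ℝ) : ℂ)) f -
      ∑ j : Fin 3, lineDerivOp (EuclideanSpace.single j (1 : ℝ) : R3)
        (lineDerivOp (EuclideanSpace.single j (1 : ℝ) : R3) f) := by
  rw [oscOne, sub_apply, sum_apply]
  simp [pow_two]

theorem unitVec_zero (n : ℕ) (j : Fin 3) :
    unitVec (n + 1) 0 j = consHead n (EuclideanSpace.single j 1) := rfl

theorem unitVec_succ (n : ℕ) (i : Fin n) (j : Fin 3) :
    unitVec (n + 1) i.succ j = consTail n (unitVec n i j) := by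
  rw [consTail_apply]
  ext k : 1
  refine Fin.cases ?_ (fun k => ?_) k
  · simp [unitVec, (Fin.succ_ne_zero i).symm]
  · simp [unitVec, Pi.single_apply]

theorem lineDerivOp_tensor_tail {n : ℕ} (f : 𝓢(R3, ℂ)) (G : 𝓢(Fin n → R3, ℂ)) (v : Fin n → R3) :
    lineDerivOp (consTail n v) (tensor f G) = tensor f (lineDerivOp v G) := by
  ext P
  rw [tensor_apply, SchwartzMap.lineDerivOp_apply, SchwartzMap.lineDerivOp_apply, lineDeriv,
    lineDeriv]
  have h (t : ℝ) : tensor f G (P + t • consTail n v) = f (P 0) * G (Fin.tail P + t • v) := by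
    rw [tensor_apply, consTail_apply]
    congr 2
    simp
  simp_rw [h]
  exact deriv_const_mul_field _

theorem lineDerivOp_tensor_head {n : ℕ} (f : 𝓢(R3, ℂ)) (G : 𝓢(Fin n → R3, ℂ)) (v : R3) :
    lineDerivOp (consHead n v) (tensor f G) = tensor (lineDerivOp v f) G := by
  ext P
  rw [tensor_apply, SchwartzMap.lineDerivOp_apply, SchwartzMap.lineDerivOp_apply, lineDeriv,
    lineDeriv]
  have h (t : ℝ) : tensor f G (P + t • consHead n v) = f (P 0 + t • v) * G (Fin.tail P) := by
    rw [tensor_apply, consHead_apply]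
    congr 2
    · ext i : 1
      simp [Fin.tail]
  simp_rw [h]
  exact deriv_mul_const_field _

theorem osc_succ_tensor {n : ℕ} (i : Fin n) (f : 𝓢(R3, ℂ)) (G : 𝓢(Fin n → R3, ℂ)) :
    osc (n + 1) i.succ (tensor f G) = tensor f (osc n i G) := by
  rw [osc_apply, osc_apply, map_sub, map_sum]
  simp_rw [unitVec_succ, lineDerivOp_tensor_tail]
  congr 1
  ext P
  simp only [oscPot_apply, tensor_apply, Fin.tail]
  ring

theorem osc_zero_tensor {n : ℕ} (f : 𝓢(R3, ℂ)) (G : 𝓢(Fin n → R3, ℂ)) :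
    osc (n + 1) 0 (tensor f G) = tensor (oscOne f) G := by
  rw [osc_apply, oscOne_apply]
  simp_rw [unitVec_zero, lineDerivOp_tensor_head]
  ext P
  simp only [oscPot_apply, tensor_apply, sub_apply, sum_apply,
    SchwartzMap.smulLeftCLM_apply_apply normSq_hasTemperateGrowth, smul_eq_mul, sub_mul,
    Finset.sum_mul]
  ring

/-- Differentiation and multiplication in the remaining momenta pass under the integral over the
contracted one. -/
theorem osc_contract {n : ℕ} (i : Fin n) (f : 𝓢(R3, ℂ)) (G : 𝓢(Fin (n + 1) → R3, ℂ)) :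
    osc n i (contract f G) = contract f (osc (n + 1) i.succ G) := by
  have h (v : Fin n → R3) (G : 𝓢(Fin (n + 1) → R3, ℂ)) : lineDerivOp v (contract f G) =
      contract f (lineDerivOp (consTail n v) G) := by
    rw [contract, ContinuousLinearMap.comp_apply, ContinuousLinearMap.comp_apply,
      lineDerivOp_partialIntegral,
      lineDerivOp_smulLeftCLM (head_hasTemperateGrowth n f) _ fun P t => ?_]
    simp [consTail_apply]
  rw [osc_apply, osc_apply, map_sub, map_sum]
  simp_rw [h, unitVec_succ]
  congr 1
  ext q
  rw [oscPot_apply, contract_apply, contract_apply, ← integral_const_mul]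
  congr 1 with p
  rw [oscPot_apply, Fin.cons_succ]
  ring

/-- The product of the oscillator Hamiltonians of the last `n` of `n + 1` momenta. -/
def oscTail (n : ℕ) : 𝓢(Fin (n + 1) → R3, ℂ) →L[ℂ] 𝓢(Fin (n + 1) → R3, ℂ) :=
  (List.ofFn fun i : Fin n => osc (n + 1) i.succ).prod

theorem oscTensor_succ (n : ℕ) : oscTensor (n + 1) = osc (n + 1) 0 * oscTail n := by
  rw [oscTensor, List.ofFn_succ, List.prod_cons, oscTail]

theorem commute_osc_zero_oscTail (n : ℕ) : Commute (osc (n + 1) 0) (oscTail n) := by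
  refine Commute.list_prod_right _ _ fun x hx => ?_
  obtain ⟨i, rfl⟩ := List.mem_ofFn.1 hx
  exact commute_osc _ (Fin.succ_ne_zero i).symm

theorem oscTail_tensor {n : ℕ} (f : 𝓢(R3, ℂ)) (G : 𝓢(Fin n → R3, ℂ)) :
    oscTail n (tensor f G) = tensor f (oscTensor n G) := by
  have h (l : List (Fin n)) : (l.map fun i => osc (n + 1) i.succ).prod (tensor f G) =
      tensor f ((l.map (osc n)).prod G) := by
    induction l with
    | nil => simp
    | cons i l ih =>
      rw [List.map_cons, List.map_cons, List.prod_cons, List.prod_cons, mul_apply_eq_comp,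
        mul_apply_eq_comp, ih, osc_succ_tensor]
  have := h (List.ofFn fun i : Fin n => i)
  rwa [List.map_ofFn, List.map_ofFn] at this

theorem oscTensor_contract {n : ℕ} (f : 𝓢(R3, ℂ)) (G : 𝓢(Fin (n + 1) → R3, ℂ)) :
    oscTensor n (contract f G) = contract f (oscTail n G) := by
  have h (l : List (Fin n)) : (l.map (osc n)).prod (contract f G) =
      contract f ((l.map fun i => osc (n + 1) i.succ).prod G) := by
    induction l with
    | nil => simp
    | cons i l ih =>
      rw [List.map_cons, List.map_cons, List.prod_cons, List.prod_cons, mul_apply_eq_comp,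
        mul_apply_eq_comp, ih, osc_contract]
  have := h (List.ofFn fun i : Fin n => i)
  rwa [List.map_ofFn, List.map_ofFn] at this

theorem oscTensor_pow_tensor {n : ℕ} (k : ℕ) (f : 𝓢(R3, ℂ)) (G : 𝓢(Fin n → R3, ℂ)) :
    (oscTensor (n + 1) ^ k) (tensor f G) = tensor ((oscOne ^ k) f) ((oscTensor n ^ k) G) := by
  induction k with
  | zero => simp
  | succ k ih =>
    rw [pow_succ', mul_apply_eq_comp, ih, oscTensor_succ, mul_apply_eq_comp, oscTail_tensor,
      osc_zero_tensor, pow_succ', pow_succ', mul_apply_eq_comp, mul_apply_eq_comp]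

theorem oscTensor_pow_contract {n : ℕ} (k : ℕ) (f : 𝓢(R3, ℂ)) (G : 𝓢(Fin (n + 1) → R3, ℂ)) :
    (oscTensor n ^ k) (contract f G) = contract f ((oscTail n ^ k) G) := by
  induction k with
  | zero => simp
  | succ k ih =>
    rw [pow_succ', mul_apply_eq_comp, ih, oscTensor_contract, pow_succ', mul_apply_eq_comp]

theorem sqNorm_oscTensor_tensor {n : ℕ} (k : ℕ) (f : 𝓢(R3, ℂ)) (G : 𝓢(Fin n → R3, ℂ)) :
    sqNorm ((oscTensor (n + 1) ^ k) (tensor f G)) =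
      sqNorm ((oscOne ^ k) f) * sqNorm ((oscTensor n ^ k) G) := by
  rw [oscTensor_pow_tensor, sqNorm_tensor]

/-- The Hamiltonian of the contracted particle does not occur on the left; it may be inserted on the
right because it is bounded below by `1`. -/
theorem sqNorm_oscTensor_contract_le {n : ℕ} (k : ℕ) (f : 𝓢(R3, ℂ))
    (G : 𝓢(Fin (n + 1) → R3, ℂ)) :
    sqNorm ((oscTensor n ^ k) (contract f G)) ≤
      sqNorm f * sqNorm ((oscTensor (n + 1) ^ k) G) := by
  rw [oscTensor_pow_contract, oscTensor_succ, (commute_osc_zero_oscTail n).mul_pow,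
    mul_apply_eq_comp]
  exact (sqNorm_contract_le f _).trans (mul_le_mul_right (sqNorm_le_sqNorm_osc_pow 0 k _) _)

end Oscillator

/-! ### The Hida norms -/

/-- The families of Schwartz functions indexed by the components of a Fock space vector. -/
abbrev Family : Type := ∀ i : Idx, 𝓢(Fin i.1 → R3, ℂ)

/-- The square `∑ₙ n! |(H ⊗ ⋯ ⊗ H)ᵏ Φₙ|²` of the `k`-th Hida norm, which may be infinite. -/
def hidaSq (k : ℕ) (Φ : Family) : ENNReal :=
  ∑' i : Idx, (i.1.factorial : ENNReal) * sqNorm ((oscTensor i.1 ^ k) (Φ i))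

theorem enorm_weighted_sq (k : ℕ) (Φ : Family) (i : Idx) :
    ‖weighted k Φ i‖ₑ ^ 2 = (i.1.factorial : ENNReal) * sqNorm ((oscTensor i.1 ^ k) (Φ i)) := by
  rw [weighted, enorm_smul, mul_pow, sqNorm_eq_enorm_toLp, SchwartzMap.toLpCLM_apply]
  congr 1
  rw [← ofReal_norm, Complex.norm_real, Real.norm_of_nonneg (Real.sqrt_nonneg _),
    ← ENNReal.ofReal_pow (Real.sqrt_nonneg _), Real.sq_sqrt (by positivity), ENNReal.ofReal_natCast]

theorem ofReal_norm_weighted_rpow (k : ℕ) (Φ : Family) (i : Idx) :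
    ENNReal.ofReal (‖weighted k Φ i‖ ^ (2 : ENNReal).toReal) =
      (i.1.factorial : ENNReal) * sqNorm ((oscTensor i.1 ^ k) (Φ i)) := by
  rw [← enorm_weighted_sq, ENNReal.toReal_ofNat, Real.rpow_two,
    ENNReal.ofReal_pow (norm_nonneg _), ofReal_norm]

theorem memℓp_weighted_iff (k : ℕ) (Φ : Family) :
    Memℓp (weighted k Φ) 2 ↔ hidaSq k Φ < ⊤ := by
  rw [memℓp_gen_iff (by simp), hidaSq, lt_top_iff_ne_top]
  simp_rw [← ofReal_norm_weighted_rpow]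
  refine ⟨fun h => h.tsum_ofReal_ne_top, fun h => ?_⟩
  refine (ENNReal.summable_toReal h).congr fun i => ?_
  exact ENNReal.toReal_ofReal (by positivity)

theorem enorm_embed_sq {st : Stat} {W : Submodule ℂ 𝓢(R3, ℂ)} (k : ℕ) (Φ : Hida st W) :
    ‖Hida.embed st W k Φ‖ₑ ^ 2 = hidaSq k Φ.1 := by
  have h := lp.norm_rpow_eq_tsum (p := 2) (by simp) (Hida.embed st W k Φ)
  have h2 := (memℓp_gen_iff (p := 2) (by simp)).1 (Φ.2.2.2 k)
  rw [ENNReal.toReal_ofNat, Real.rpow_two] at h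
  rw [← ofReal_norm, ← ENNReal.ofReal_pow (norm_nonneg _), h, hidaSq]
  simp_rw [← ofReal_norm_weighted_rpow]
  rw [← ENNReal.ofReal_tsum_of_nonneg (fun i => by positivity) h2]
  rfl

/-- Adding a particle in front. This map identifies the pairs of a spin and a component with the
components of at least one particle. -/
def consIdx (z : Fin 4 × Idx) : Idx := ⟨z.2.1 + 1, Fin.cons z.1 z.2.2⟩

theorem consIdx_injective : Function.Injective consIdx := by
  rintro ⟨a, n, s⟩ ⟨b, m, t⟩ h
  simp only [consIdx, Sigma.mk.injEq, Nat.add_right_cancel_iff] at h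
  obtain ⟨rfl, h⟩ := h
  have h := Fin.cons_inj.1 (eq_of_heq h)
  rw [h.1, h.2]

theorem mem_range_consIdx {n : ℕ} (s : Fin (n + 1) → Fin 4) :
    (⟨n + 1, s⟩ : Idx) ∈ Set.range consIdx :=
  ⟨(s 0, ⟨n, Fin.tail s⟩), by simp [consIdx]⟩

/-- A sum over the components of a Fock space vector without vacuum component. -/
theorem tsum_consIdx {M : Type} [AddCommMonoid M] [TopologicalSpace M] (g : Idx → M)
    (hg : ∀ s, g ⟨0, s⟩ = 0) : ∑' z, g (consIdx z) = ∑' i, g i := by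
  refine consIdx_injective.tsum_eq fun i hi => ?_
  obtain ⟨n, s⟩ := i
  cases n with
  | zero => exact absurd (hg s) hi
  | succ n => exact mem_range_consIdx s

theorem tsum_prod_fin_four (g : Fin 4 × Idx → ENNReal) :
    ∑' z, g z = ∑ a, ∑' i, g (a, i) :=
  (ENNReal.tsum_prod (f := fun a i => g (a, i))).trans (tsum_fintype _)

/-- The ratio `n + 1` of consecutive factorials in the Hida norms is absorbed by one more power of
the oscillator Hamiltonian. -/
theorem factorial_succ_mul_sqNorm_le (n k : ℕ) (F : 𝓢(Fin n → R3, ℂ)) :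
    ((n + 1).factorial : ENNReal) * sqNorm ((oscTensor n ^ k) F) ≤
      n.factorial * sqNorm ((oscTensor n ^ (k + 1)) F) := by
  have h1 : ((n + 1 : ℕ) : ENNReal) ≤ 16 ^ n := by
    have : n + 1 ≤ 16 ^ n := Nat.lt_pow_self (by norm_num)
    exact_mod_cast this
  calc ((n + 1).factorial : ENNReal) * sqNorm ((oscTensor n ^ k) F)
      = n.factorial * ((n + 1 : ℕ) * sqNorm ((oscTensor n ^ k) F)) := by
        rw [Nat.factorial_succ, Nat.cast_mul]; ring
    _ ≤ n.factorial * (16 ^ n * sqNorm ((oscTensor n ^ k) F)) := by gcongr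
    _ ≤ _ := by
      gcongr
      exact sqNorm_pow_succ k F

/-! ### Annihilation, creation and symmetrization of families -/

/-- The smeared annihilation operator `∑ₛ ∫ fₛ(p) a_s(p) dp`. -/
def annFamily (f : Fin 4 → 𝓢(R3, ℂ)) (Φ : Family) : Family :=
  fun i => ((i.1 : ℂ) + 1) • ∑ a, contract (f a) (Φ ⟨i.1 + 1, Fin.cons a i.2⟩)

/-- The tensor product of a one-particle function and a Fock space vector. -/
def tensorFamily (f : Fin 4 → 𝓢(R3, ℂ)) (Φ : Family) : Family
  | ⟨0, _⟩ => 0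
  | ⟨n + 1, s⟩ => tensor (f (s 0)) (Φ ⟨n, Fin.tail s⟩)

theorem tensorFamily_consIdx (f : Fin 4 → 𝓢(R3, ℂ)) (Φ : Family) (z : Fin 4 × Idx) :
    tensorFamily f Φ (consIdx z) = tensor (f z.1) (Φ z.2) := rfl

/-- The (anti)symmetrization of a family. -/
def symFamily (st : Stat) (F : Family) : Family :=
  fun i => ((i.1.factorial : ℂ)⁻¹) •
    ∑ σ : Equiv.Perm (Fin i.1), st.factor σ • permCLM σ (F ⟨i.1, i.2 ∘ σ⟩)

theorem norm_factor (st : Stat) {n : ℕ} (σ : Equiv.Perm (Fin n)) : ‖st.factor σ‖ₑ = 1 := by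
  rw [← ofReal_norm]
  cases st with
  | bose => simp [Stat.factor]
  | fermi => rcases Int.units_eq_one_or (Equiv.Perm.sign σ) with h | h <;> simp [Stat.factor, h]

/-- Contraction lowers the particle number; the factors `(n + 1)² n! / (n + 1)! = n + 1` cost one
power of the oscillator Hamiltonian. Only the `L²` norm of `f` enters. -/
theorem hidaSq_annFamily_le (k : ℕ) (f : Fin 4 → 𝓢(R3, ℂ)) (Φ : Family) :
    hidaSq k (annFamily f Φ) ≤ 4 * (∑ a, sqNorm (f a)) * hidaSq (k + 1) Φ := by
  set S := ∑ a, sqNorm (f a) with hS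
  let w : Idx → ENNReal := fun i => (i.1.factorial : ENNReal) *
    sqNorm ((oscTensor i.1 ^ (k + 1)) (Φ i))
  have h1 (i : Idx) : (i.1.factorial : ENNReal) * sqNorm ((oscTensor i.1 ^ k) (annFamily f Φ i)) ≤
      4 * S * ∑ a, w (consIdx (a, i)) := by
    obtain ⟨n, s⟩ := i
    have hn : ‖((n : ℂ) + 1)‖ₑ = ((n + 1 : ℕ) : ENNReal) := by
      rw [← ofReal_norm, ← Nat.cast_succ, Complex.norm_natCast, ENNReal.ofReal_natCast]
    have h2 (a : Fin 4) : (n.factorial : ENNReal) * (((n + 1 : ℕ) : ENNReal) ^ 2 *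
        sqNorm ((oscTensor (n + 1) ^ k) (Φ ⟨n + 1, Fin.cons a s⟩))) ≤ w (consIdx (a, ⟨n, s⟩)) := by
      -- `n! (n + 1)² ≤ (n + 2)!`
      refine le_trans ?_ (factorial_succ_mul_sqNorm_le (n + 1) k (Φ ⟨n + 1, Fin.cons a s⟩))
      rw [← mul_assoc]
      gcongr
      rw [Nat.factorial_succ, Nat.factorial_succ]
      norm_cast
      nlinarith [Nat.factorial_pos n]
    change (n.factorial : ENNReal) * sqNorm ((oscTensor n ^ k) (((n : ℂ) + 1) •
      ∑ a, contract (f a) (Φ ⟨n + 1, Fin.cons a s⟩))) ≤ _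
    rw [map_smul, map_sum, sqNorm_smul, hn]
    calc _ ≤ (n.factorial : ENNReal) * (((n + 1 : ℕ) : ENNReal) ^ 2 * (4 *
          ∑ a, S * sqNorm ((oscTensor (n + 1) ^ k) (Φ ⟨n + 1, Fin.cons a s⟩)))) := by
          gcongr
          refine (sqNorm_sum_le _ _).trans ?_
          rw [Finset.card_univ, Fintype.card_fin, Nat.cast_ofNat]
          gcongr with a
          refine (sqNorm_oscTensor_contract_le k (f a) _).trans ?_
          gcongr
          exact Finset.single_le_sum (f := fun a => sqNorm (f a)) (fun _ _ => zero_le)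
            (Finset.mem_univ a)
      _ = 4 * S * ∑ a, (n.factorial : ENNReal) * (((n + 1 : ℕ) : ENNReal) ^ 2 *
          sqNorm ((oscTensor (n + 1) ^ k) (Φ ⟨n + 1, Fin.cons a s⟩))) := by
          simp_rw [Finset.mul_sum]
          exact Finset.sum_congr rfl fun a _ => by ring
      _ ≤ _ := by
          gcongr with a
          exact h2 a
  calc hidaSq k (annFamily f Φ) ≤ ∑' i, 4 * S * ∑ a, w (consIdx (a, i)) := ENNReal.tsum_le_tsum h1
    _ = 4 * S * ∑' z, w (consIdx z) := by
      rw [ENNReal.tsum_mul_left, tsum_prod_fin_four, Summable.tsum_finsetSum]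
      exact fun _ _ => ENNReal.summable
    _ ≤ 4 * S * hidaSq (k + 1) Φ := by
      gcongr
      exact ENNReal.tsum_comp_le_tsum_of_injective consIdx_injective w

/-- The tensor product raises the particle number; the ratio `(n + 1)! / n!` costs one power of the
oscillator Hamiltonian. -/
theorem hidaSq_tensorFamily_le (k : ℕ) (f : Fin 4 → 𝓢(R3, ℂ)) (Φ : Family) :
    hidaSq k (tensorFamily f Φ) ≤ (∑ a, sqNorm ((oscOne ^ k) (f a))) * hidaSq (k + 1) Φ := by
  rw [hidaSq, ← tsum_consIdx _ (fun s => by simp [tensorFamily, sqNorm]), tsum_prod_fin_four,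
    Finset.sum_mul]
  refine Finset.sum_le_sum fun a _ => ?_
  rw [hidaSq, ← ENNReal.tsum_mul_left]
  refine ENNReal.tsum_le_tsum fun i => ?_
  calc _ = sqNorm ((oscOne ^ k) (f a)) *
        (((i.1 + 1).factorial : ENNReal) * sqNorm ((oscTensor i.1 ^ k) (Φ i))) := by
        rw [tensorFamily_consIdx]
        change ((i.1 + 1).factorial : ENNReal) *
          sqNorm ((oscTensor (i.1 + 1) ^ k) (tensor (f a) (Φ i))) = _
        rw [sqNorm_oscTensor_tensor]
        ring
    _ ≤ _ := mul_le_mul_right (factorial_succ_mul_sqNorm_le _ _ _) _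

theorem sum_comp_perm {M : Type} [AddCommMonoid M] {n : ℕ} (σ : Equiv.Perm (Fin n))
    (g : (Fin n → Fin 4) → M) : ∑ s : Fin n → Fin 4, g (s ∘ σ) = ∑ s, g s :=
  (σ.symm.arrowCongr (Equiv.refl (Fin 4))).sum_comp g

/-- The (anti)symmetrization is an average of isometries, hence a contraction for all Hida norms. -/
theorem hidaSq_symFamily_le (st : Stat) (k : ℕ) (F : Family) :
    hidaSq k (symFamily st F) ≤ hidaSq k F := by
  rw [hidaSq, hidaSq, ENNReal.tsum_sigma', ENNReal.tsum_sigma']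
  refine ENNReal.tsum_le_tsum fun n => ?_
  rw [tsum_fintype, tsum_fintype]
  have hn : (n.factorial : ENNReal) ≠ 0 := by exact_mod_cast n.factorial_ne_zero
  have hn' : (n.factorial : ENNReal) ≠ ⊤ := ENNReal.natCast_ne_top _
  have hc : ‖((n.factorial : ℂ)⁻¹)‖ₑ = (n.factorial : ENNReal)⁻¹ := by
    rw [enorm_inv (by exact_mod_cast n.factorial_ne_zero), ← ofReal_norm, Complex.norm_natCast,
      ENNReal.ofReal_natCast]
  have h1 (s : Fin n → Fin 4) : sqNorm ((oscTensor n ^ k) (symFamily st F ⟨n, s⟩)) ≤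
      (n.factorial : ENNReal)⁻¹ * ∑ σ : Equiv.Perm (Fin n),
        sqNorm ((oscTensor n ^ k) (F ⟨n, s ∘ σ⟩)) := by
    change sqNorm ((oscTensor n ^ k) (((n.factorial : ℂ)⁻¹) •
      ∑ σ : Equiv.Perm (Fin n), st.factor σ • permCLM σ (F ⟨n, s ∘ σ⟩))) ≤ _
    rw [map_smul, map_sum, sqNorm_smul, hc]
    refine (mul_le_mul_right (sqNorm_sum_le _ _) _).trans ?_
    rw [Finset.card_univ, Fintype.card_perm, Fintype.card_fin, pow_two, mul_assoc,
      ← mul_assoc (n.factorial : ENNReal)⁻¹ (n.factorial : ENNReal), ENNReal.inv_mul_cancel hn hn',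
      one_mul]
    gcongr with σ
    rw [map_smul, sqNorm_smul, norm_factor, one_pow, one_mul, sqNorm_oscTensor_permCLM]
  calc _ ≤ ∑ s : Fin n → Fin 4, (n.factorial : ENNReal) * ((n.factorial : ENNReal)⁻¹ *
        ∑ σ : Equiv.Perm (Fin n), sqNorm ((oscTensor n ^ k) (F ⟨n, s ∘ σ⟩))) := by
        gcongr with s
        exact h1 s
    _ = ∑ s : Fin n → Fin 4, ∑ σ : Equiv.Perm (Fin n),
        sqNorm ((oscTensor n ^ k) (F ⟨n, s ∘ σ⟩)) := by
        refine Finset.sum_congr rfl fun s _ => ?_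
        rw [← mul_assoc, ENNReal.mul_inv_cancel hn hn', one_mul]
    _ = ∑ σ : Equiv.Perm (Fin n), ∑ s : Fin n → Fin 4,
        sqNorm ((oscTensor n ^ k) (F ⟨n, s⟩)) := by
        rw [Finset.sum_comm]
        exact Finset.sum_congr rfl fun σ _ =>
          sum_comp_perm σ fun s => sqNorm ((oscTensor n ^ k) (F ⟨n, s⟩))
    _ = _ := by
        rw [Finset.sum_const, Finset.card_univ, Fintype.card_perm, Fintype.card_fin, nsmul_eq_mul,
          Finset.mul_sum]

section

/-! ### Operators between completed tensor powers -/

/-- The constant function `1` of no momenta. -/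
def oneFun : 𝓢(Fin 0 → R3, ℂ) :=
  HasCompactSupport.toSchwartzMap (f := fun _ => 1) (HasCompactSupport.of_compactSpace _)
    contDiff_const

theorem oneFun_apply (p : Fin 0 → R3) : oneFun p = 1 := rfl

/-- The product function `w₁(p₁) ⋯ wₙ(pₙ)`. -/
def prodFun : {n : ℕ} → (Fin n → 𝓢(R3, ℂ)) → 𝓢(Fin n → R3, ℂ)
  | 0, _ => oneFun
  | _ + 1, w => tensor (w 0) (prodFun fun i => w i.succ)

theorem prodFun_apply {n : ℕ} (w : Fin n → 𝓢(R3, ℂ)) (p : Fin n → R3) :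
    prodFun w p = ∏ i, w i (p i) := by
  induction n with
  | zero => simp [prodFun, oneFun_apply]
  | succ n ih =>
    rw [prodFun, tensor_apply, ih, Fin.prod_univ_succ]
    rfl

variable {W : Submodule ℂ 𝓢(R3, ℂ)}

/-- The product functions with factors in `W`. -/
def prodSet (W : Submodule ℂ 𝓢(R3, ℂ)) (n : ℕ) : Set 𝓢(Fin n → R3, ℂ) :=
  {F | ∃ w : Fin n → W, ∀ p, F p = ∏ i, (w i : 𝓢(R3, ℂ)) (p i)}

/-- A continuous operator respects the completed tensor powers of `W` if it does so on products. -/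
theorem map_mem_tensorPow {n m : ℕ} (L : 𝓢(Fin n → R3, ℂ) →L[ℂ] 𝓢(Fin m → R3, ℂ))
    (h : ∀ F ∈ prodSet W n, L F ∈ Submodule.span ℂ (prodSet W m)) {F : 𝓢(Fin n → R3, ℂ)}
    (hF : F ∈ tensorPow W n) : L F ∈ tensorPow W m := by
  refine map_mem_closure L.continuous hF fun G hG => ?_
  have : Submodule.span ℂ (prodSet W n) ≤ (Submodule.span ℂ (prodSet W m)).comap L.toLinearMap :=
    Submodule.span_le.2 h
  exact this hG

theorem contract_mem_tensorPow {n : ℕ} (f : 𝓢(R3, ℂ)) {F : 𝓢(Fin (n + 1) → R3, ℂ)}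
    (hF : F ∈ tensorPow W (n + 1)) : contract f F ∈ tensorPow W n := by
  refine map_mem_tensorPow _ (fun F hF => ?_) hF
  obtain ⟨w, hw⟩ := hF
  have : contract f F = (∫ p, f p * (w 0 : 𝓢(R3, ℂ)) p) •
      prodFun fun i => (w i.succ : 𝓢(R3, ℂ)) := by
    ext q
    rw [contract_apply, smul_apply, prodFun_apply, smul_eq_mul, ← integral_mul_const]
    congr 1 with p
    rw [hw, Fin.prod_univ_succ]
    simp only [Fin.cons_zero, Fin.cons_succ]
    ring
  rw [this]
  exact Submodule.smul_mem _ _ (Submodule.subset_span ⟨fun i => w i.succ, prodFun_apply _⟩)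

theorem tensor_mem_tensorPow {n : ℕ} {f : 𝓢(R3, ℂ)} (hf : f ∈ W) {F : 𝓢(Fin n → R3, ℂ)}
    (hF : F ∈ tensorPow W n) : tensor f F ∈ tensorPow W (n + 1) := by
  refine map_mem_tensorPow _ (fun F hF => Submodule.subset_span ?_) hF
  obtain ⟨w, hw⟩ := hF
  refine ⟨Fin.cons ⟨f, hf⟩ w, fun P => ?_⟩
  rw [tensor_apply, hw, Fin.prod_univ_succ]
  rfl

theorem permCLM_mem_tensorPow {n : ℕ} (σ : Equiv.Perm (Fin n)) {F : 𝓢(Fin n → R3, ℂ)}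
    (hF : F ∈ tensorPow W n) : permCLM σ F ∈ tensorPow W n := by
  refine map_mem_tensorPow _ (fun F hF => Submodule.subset_span ?_) hF
  obtain ⟨w, hw⟩ := hF
  refine ⟨w ∘ σ.symm, fun P => ?_⟩
  rw [permCLM_apply, hw]
  exact Fintype.prod_equiv σ _ _ fun i => by simp

/-! ### Annihilation and creation operators in the Hida space -/

theorem factor_mul (st : Stat) {n : ℕ} (σ τ : Equiv.Perm (Fin n)) :
    st.factor (σ * τ) = st.factor σ * st.factor τ := by
  cases st <;> simp [Stat.factor]

theorem factor_mul_self (st : Stat) {n : ℕ} (σ : Equiv.Perm (Fin n)) :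
    st.factor σ * st.factor σ = 1 := by
  cases st with
  | bose => simp [Stat.factor]
  | fermi => rcases Int.units_eq_one_or (Equiv.Perm.sign σ) with h | h <;> simp [Stat.factor, h]

/-- The extension of a permutation of `n` particles which fixes an additional first particle. -/
def extendPerm {n : ℕ} (σ : Equiv.Perm (Fin n)) : Equiv.Perm (Fin (n + 1)) :=
  Equiv.Perm.decomposeFin.symm (0, σ)

theorem factor_extendPerm (st : Stat) {n : ℕ} (σ : Equiv.Perm (Fin n)) :
    st.factor (extendPerm σ) = st.factor σ := by
  cases st <;> simp [Stat.factor, extendPerm, Equiv.Perm.decomposeFin.symm_sign]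

theorem cons_comp_extendPerm {n : ℕ} {α : Type} (σ : Equiv.Perm (Fin n)) (a : α) (b : Fin n → α) :
    (Fin.cons a b : Fin (n + 1) → α) ∘ extendPerm σ = Fin.cons a (b ∘ σ) := by
  ext i
  refine Fin.cases ?_ (fun i => ?_) i <;> simp [extendPerm]

theorem annFamily_apply (f : Fin 4 → 𝓢(R3, ℂ)) (Φ : Family) (n : ℕ) (s : Fin n → Fin 4)
    (q : Fin n → R3) :
    annFamily f Φ ⟨n, s⟩ q =
      ((n : ℂ) + 1) * ∑ a, ∫ p, f a p * Φ ⟨n + 1, Fin.cons a s⟩ (Fin.cons p q) := by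
  change (((n : ℂ) + 1) • ∑ a, contract (f a) (Φ ⟨n + 1, Fin.cons a s⟩)) q = _
  rw [smul_apply, sum_apply, smul_eq_mul]
  simp_rw [contract_apply]

theorem symFamily_apply (st : Stat) (F : Family) (n : ℕ) (s : Fin n → Fin 4) (p : Fin n → R3) :
    symFamily st F ⟨n, s⟩ p = (n.factorial : ℂ)⁻¹ *
      ∑ σ : Equiv.Perm (Fin n), st.factor σ * F ⟨n, s ∘ σ⟩ (p ∘ σ) := by
  change (((n.factorial : ℂ)⁻¹) •
    ∑ σ : Equiv.Perm (Fin n), st.factor σ • permCLM σ (F ⟨n, s ∘ σ⟩)) p = _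
  rw [smul_apply, sum_apply, smul_eq_mul]
  rfl

theorem annFamily_mem {st : Stat} (f : Fin 4 → 𝓢(R3, ℂ)) {Φ : Family}
    (hΦ : Φ ∈ hidaSubmodule st W) : annFamily f Φ ∈ hidaSubmodule st W := by
  refine ⟨fun i => ?_, fun n σ s q => ?_, fun k => (memℓp_weighted_iff k _).2 ?_⟩
  · refine Submodule.smul_mem _ _ (Submodule.sum_mem _ fun a _ => contract_mem_tensorPow _ ?_)
    exact hΦ.1 ⟨i.1 + 1, Fin.cons a i.2⟩
  · rw [annFamily_apply, annFamily_apply]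
    have h (a : Fin 4) (p : R3) : Φ ⟨n + 1, Fin.cons a (s ∘ σ)⟩ (Fin.cons p (q ∘ σ)) =
        st.factor σ * Φ ⟨n + 1, Fin.cons a s⟩ (Fin.cons p q) := by
      rw [← factor_extendPerm, ← hΦ.2.1 (n + 1) (extendPerm σ) (Fin.cons a s) (Fin.cons p q),
        cons_comp_extendPerm, cons_comp_extendPerm]
    simp_rw [h, mul_left_comm _ (st.factor σ), integral_const_mul, ← Finset.mul_sum]
    ring
  · refine (hidaSq_annFamily_le k f Φ).trans_lt (ENNReal.mul_lt_top ?_ ?_)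
    · exact ENNReal.mul_lt_top (by simp) (ENNReal.sum_lt_top.2 fun a _ => sqNorm_lt_top _)
    · exact (memℓp_weighted_iff _ Φ).1 (hΦ.2.2 (k + 1))

theorem hidaSq_creFamily_le (st : Stat) (k : ℕ) (f : Fin 4 → 𝓢(R3, ℂ)) (Φ : Family) :
    hidaSq k (symFamily st (tensorFamily f Φ)) ≤
      (∑ a, sqNorm ((oscOne ^ k) (f a))) * hidaSq (k + 1) Φ :=
  (hidaSq_symFamily_le st k _).trans (hidaSq_tensorFamily_le k f Φ)

theorem creFamily_mem {st : Stat} {f : Fin 4 → 𝓢(R3, ℂ)} (hf : ∀ a, f a ∈ W) {Φ : Family}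
    (hΦ : Φ ∈ hidaSubmodule st W) : symFamily st (tensorFamily f Φ) ∈ hidaSubmodule st W := by
  refine ⟨fun i => ?_, fun n τ s p => ?_, fun k => (memℓp_weighted_iff k _).2 ?_⟩
  · refine Submodule.smul_mem _ _ (Submodule.sum_mem _ fun σ _ => Submodule.smul_mem _ _
      (permCLM_mem_tensorPow σ ?_))
    obtain ⟨n, s⟩ := i
    cases n with
    | zero => exact Submodule.zero_mem _
    | succ n => exact tensor_mem_tensorPow (hf _) (hΦ.1 ⟨n, _⟩)
  · rw [symFamily_apply, symFamily_apply, mul_left_comm]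
    congr 1
    rw [Finset.mul_sum]
    refine Fintype.sum_equiv (Equiv.mulLeft τ) _ _ fun σ => ?_
    rw [Equiv.coe_mulLeft, factor_mul, ← mul_assoc, ← mul_assoc, factor_mul_self, one_mul]
    rfl
  · refine (hidaSq_creFamily_le st k f Φ).trans_lt (ENNReal.mul_lt_top ?_ ?_)
    · exact ENNReal.sum_lt_top.2 fun a _ => sqNorm_lt_top _
    · exact (memℓp_weighted_iff _ Φ).1 (hΦ.2.2 (k + 1))

theorem contract_add_left {n : ℕ} (f g : 𝓢(R3, ℂ)) (F : 𝓢(Fin (n + 1) → R3, ℂ)) :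
    contract (f + g) F = contract f F + contract g F := by
  rw [contract, contract, contract]
  simp only [ContinuousLinearMap.comp_apply]
  rw [← map_add, ← add_apply, ← SchwartzMap.smulLeftCLM_add (head_hasTemperateGrowth n f)
    (head_hasTemperateGrowth n g)]
  rfl

theorem contract_smul_left {n : ℕ} (c : ℂ) (f : 𝓢(R3, ℂ)) (F : 𝓢(Fin (n + 1) → R3, ℂ)) :
    contract (c • f) F = c • contract f F := by
  ext q
  rw [smul_apply, contract_apply, contract_apply, smul_eq_mul, ← integral_const_mul]
  simp only [smul_apply, smul_eq_mul, mul_assoc]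

/-- The annihilation part of a field: `f ↦ ∑ₛ ∫ fₛ(p) a_s(p) dp`. -/
def annihilationOp (st : Stat) (W : Submodule ℂ 𝓢(R3, ℂ)) :
    Test W →ₗ[ℂ] Hida st W →ₗ[ℂ] Hida st W :=
  LinearMap.mk₂ ℂ (fun f Φ => ⟨annFamily (fun a => f a) Φ.1, annFamily_mem _ Φ.2⟩)
    (fun f g Φ => Subtype.ext <| funext fun i => by
      change annFamily _ _ i = annFamily _ _ i + annFamily _ _ i
      simp only [annFamily, Pi.add_apply, Submodule.coe_add, contract_add_left,
        Finset.sum_add_distrib, smul_add])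
    (fun c f Φ => Subtype.ext <| funext fun i => by
      change annFamily _ _ i = c • annFamily _ _ i
      simp only [annFamily, Pi.smul_apply, Submodule.coe_smul, contract_smul_left,
        ← Finset.smul_sum]
      rw [smul_comm])
    (fun f Φ Ψ => Subtype.ext <| funext fun i => by
      change annFamily _ (Φ.1 + Ψ.1) i = annFamily _ _ i + annFamily _ _ i
      simp only [annFamily, Pi.add_apply, map_add, Finset.sum_add_distrib, smul_add])
    (fun c f Φ => Subtype.ext <| funext fun i => by
      change annFamily _ (c • Φ.1) i = c • annFamily _ _ i
      simp only [annFamily, Pi.smul_apply, map_smul, ← Finset.smul_sum]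
      rw [smul_comm])

theorem tensorFamily_add_left (f g : Fin 4 → 𝓢(R3, ℂ)) (Φ : Family) :
    tensorFamily (f + g) Φ = tensorFamily f Φ + tensorFamily g Φ := by
  ext ⟨n, s⟩ p
  cases n with
  | zero => simp [tensorFamily]
  | succ n => exact add_mul _ _ _

theorem tensorFamily_smul_left (c : ℂ) (f : Fin 4 → 𝓢(R3, ℂ)) (Φ : Family) :
    tensorFamily (c • f) Φ = c • tensorFamily f Φ := by
  ext ⟨n, s⟩ p
  cases n with
  | zero => simp [tensorFamily]
  | succ n => exact mul_assoc _ _ _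

theorem tensorFamily_add_right (f : Fin 4 → 𝓢(R3, ℂ)) (Φ Ψ : Family) :
    tensorFamily f (Φ + Ψ) = tensorFamily f Φ + tensorFamily f Ψ := by
  ext ⟨n, s⟩ p
  cases n with
  | zero => simp [tensorFamily]
  | succ n => exact mul_add _ _ _

theorem tensorFamily_smul_right (c : ℂ) (f : Fin 4 → 𝓢(R3, ℂ)) (Φ : Family) :
    tensorFamily f (c • Φ) = c • tensorFamily f Φ := by
  ext ⟨n, s⟩ p
  cases n with
  | zero => simp [tensorFamily]
  | succ n => exact mul_left_comm _ _ _

theorem symFamily_add (st : Stat) (F G : Family) :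
    symFamily st (F + G) = symFamily st F + symFamily st G := by
  funext i
  simp only [symFamily, Pi.add_apply, map_add, smul_add, Finset.sum_add_distrib]

theorem symFamily_smul (st : Stat) (c : ℂ) (F : Family) :
    symFamily st (c • F) = c • symFamily st F := by
  funext i
  simp only [symFamily, Pi.smul_apply, map_smul, smul_comm _ c, ← Finset.smul_sum]

/-- The creation part of a field: `f ↦ ∑ₛ ∫ fₛ(p) a_s(p)⁺ dp`, the (anti)symmetrized tensor
product with `f`. -/
def creationOp (st : Stat) (W : Submodule ℂ 𝓢(R3, ℂ)) :
    Test W →ₗ[ℂ] Hida st W →ₗ[ℂ] Hida st W :=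
  LinearMap.mk₂ ℂ (fun f Φ => ⟨symFamily st (tensorFamily (fun a => f a) Φ.1),
      creFamily_mem (fun a => (f a).2) Φ.2⟩)
    (fun _ _ _ => Subtype.ext <|
      (congrArg _ (tensorFamily_add_left _ _ _)).trans (symFamily_add _ _ _))
    (fun _ _ _ => Subtype.ext <|
      (congrArg _ (tensorFamily_smul_left _ _ _)).trans (symFamily_smul _ _ _))
    (fun _ _ _ => Subtype.ext <|
      (congrArg _ (tensorFamily_add_right _ _ _)).trans (symFamily_add _ _ _))
    (fun _ _ _ => Subtype.ext <|
      (congrArg _ (tensorFamily_smul_right _ _ _)).trans (symFamily_smul _ _ _))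

/-! ### Continuity of the annihilation and creation operators -/

/-- The Hida norms as a family of seminorms. -/
def hidaSeminorm (st : Stat) (W : Submodule ℂ 𝓢(R3, ℂ)) : SeminormFamily ℂ (Hida st W) ℕ :=
  fun k => (normSeminorm ℂ Fock).comp (Hida.embed st W k)

theorem withSeminorms_hida (st : Stat) (W : Submodule ℂ 𝓢(R3, ℂ)) :
    WithSeminorms (hidaSeminorm st W) := by
  have h := withSeminorms_iInf (t := fun k : ℕ => .induced (Hida.embed st W k) inferInstance)
    fun k : ℕ => LinearMap.withSeminorms_induced (norm_withSeminorms ℂ Fock) (Hida.embed st W k)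
  exact h.congr_equiv (Equiv.sigmaUnique ℕ _).symm

/-- A bilinear map with seminorm bounds is a continuous linear map into the space of operators
with the topology of uniform convergence on bounded sets. -/
theorem exists_clm_of_bound {E F G ι ι' : Type} [AddCommGroup E] [Module ℂ E]
    [TopologicalSpace E] [IsTopologicalAddGroup E] [AddCommGroup F] [Module ℂ F]
    [TopologicalSpace F] [AddCommGroup G] [Module ℂ G] [TopologicalSpace G]
    [IsTopologicalAddGroup G] [ContinuousSMul ℂ G]
    {p : SeminormFamily ℂ F ι} {q : SeminormFamily ℂ G ι'} (hp : WithSeminorms p)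
    (hq : WithSeminorms q) (B : E →ₗ[ℂ] F →ₗ[ℂ] G)
    (hB : ∀ k, ∃ (b : E → ℝ) (s : Finset ι), Continuous b ∧ b 0 = 0 ∧
      ∀ f x, q k (B f x) ≤ b f * s.sup p x) :
    ∃ T : E →L[ℂ] (F →L[ℂ] G), ∀ f x, T f x = B f x := by
  have hcont (f : E) : Continuous (B f) := by
    refine hp.continuous_of_isBounded hq _ ?_
    refine Seminorm.IsBounded.of_real fun k => ?_
    obtain ⟨b, s, -, -, h⟩ := hB k
    exact ⟨s, b f, fun x => by simpa using h f x⟩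
  let T : E →ₗ[ℂ] (F →L[ℂ] G) :=
    { toFun := fun f => ⟨B f, hcont f⟩
      map_add' := fun f g => ContinuousLinearMap.ext fun x => by
        change B (f + g) x = B f x + B g x
        rw [map_add]; rfl
      map_smul' := fun c f => ContinuousLinearMap.ext fun x => by
        change B (c • f) x = c • B f x
        rw [map_smul]; rfl }
  refine ⟨⟨T, ?_⟩, fun f x => rfl⟩
  refine continuous_of_continuousAt_zero T ?_
  -- A neighbourhood of `0` in `F →L[ℂ] G` consists of the maps that send a bounded set `S` into
  -- a seminorm ball; on `S` the seminorms `s.sup p` are bounded, so small values of `b f` suffice.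
  rw [ContinuousAt, map_zero,
    (ContinuousLinearMap.hasBasis_nhds_zero_of_basis hq.hasBasis).tendsto_right_iff]
  rintro ⟨S, U⟩ ⟨hS, hU⟩
  obtain ⟨t, r, hr, rfl⟩ := q.basisSets_iff.1 hU
  have h1 : ∀ k ∈ t, ∀ᶠ f in nhds (0 : E), ∀ x ∈ S, q k (T f x) < r := by
    intro k _
    obtain ⟨b, s, hb, hb0, h⟩ := hB k
    obtain ⟨R, hR, hSR⟩ := (hp.isVonNBounded_iff_finset_seminorm_bounded.1 hS) s
    have h2 : ∀ᶠ f in nhds (0 : E), |b f| * R < r := by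
      have : Filter.Tendsto (fun f => |b f| * R) (nhds 0) (nhds (|b 0| * R)) :=
        (hb.abs.mul_const R).tendsto 0
      rw [hb0, abs_zero, zero_mul] at this
      exact this.eventually_lt_const hr
    filter_upwards [h2] with f hf x hx
    refine lt_of_le_of_lt ?_ hf
    refine (h f x).trans ?_
    gcongr
    · exact le_abs_self _
    · exact (hSR x hx).le
  filter_upwards [(Filter.eventually_all_finset t).2 h1] with f hf x hx
  refine (Seminorm.mem_ball_zero _).2 ?_
  exact Seminorm.finset_sup_apply_lt hr fun k hk => hf k hk x hx

theorem norm_embed_le_of_hidaSq_le {st : Stat} {k k' : ℕ} {Φ Ψ : Hida st W} {C : ℝ} (hC : 0 ≤ C)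
    (h : hidaSq k Φ.1 ≤ ENNReal.ofReal C ^ 2 * hidaSq k' Ψ.1) :
    ‖Hida.embed st W k Φ‖ ≤ C * ‖Hida.embed st W k' Ψ‖ := by
  rw [← enorm_embed_sq, ← enorm_embed_sq, ← mul_pow] at h
  have h1 := (ENNReal.pow_le_pow_left_iff two_ne_zero).1 h
  rwa [← ofReal_norm, ← ofReal_norm, ← ENNReal.ofReal_mul hC,
    ENNReal.ofReal_le_ofReal_iff (by positivity)] at h1

theorem sum_sqNorm_le {D : Type} [NormedAddCommGroup D] [NormedSpace ℝ D] [MeasureSpace D]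
    [BorelSpace D] [(volume : Measure D).HasTemperateGrowth] [SecondCountableTopology D]
    (f : Fin 4 → 𝓢(D, ℂ)) :
    ∑ a, sqNorm (f a) ≤
      ENNReal.ofReal (∑ a, ‖SchwartzMap.toLpCLM ℂ ℂ 2 (volume : Measure D) (f a)‖) ^ 2 := by
  rw [ENNReal.ofReal_sum_of_nonneg fun _ _ => norm_nonneg _]
  simp_rw [sqNorm_eq_enorm_toLp, ofReal_norm, SchwartzMap.toLpCLM_apply]
  exact Finset.sum_sq_le_sq_sum_of_nonneg fun _ _ => zero_le

theorem exists_annihilationOp_clm (st : Stat) (W : Submodule ℂ 𝓢(R3, ℂ)) :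
    ∃ T : Test W →L[ℂ] (Hida st W →L[ℂ] Hida st W), ∀ f Φ, T f Φ = annihilationOp st W f Φ := by
  refine exists_clm_of_bound (withSeminorms_hida st W) (withSeminorms_hida st W) _ fun k =>
    ⟨fun f => 2 * ∑ a,
    ‖SchwartzMap.toLpCLM ℂ ℂ 2 (volume : Measure R3) (f a)‖, {k + 1}, ?_, ?_, fun f Φ => ?_⟩
  · fun_prop
  · simp [-SchwartzMap.toLpCLM_apply]
  · rw [Finset.sup_singleton]
    refine norm_embed_le_of_hidaSq_le (by positivity) ?_
    refine (hidaSq_annFamily_le k _ Φ.1).trans (mul_le_mul_left ?_ _)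
    rw [ENNReal.ofReal_mul (by norm_num), mul_pow, ENNReal.ofReal_ofNat]
    norm_num1
    exact mul_le_mul_right (sum_sqNorm_le _) 4

theorem exists_creationOp_clm (st : Stat) (W : Submodule ℂ 𝓢(R3, ℂ)) :
    ∃ T : Test W →L[ℂ] (Hida st W →L[ℂ] Hida st W), ∀ f Φ, T f Φ = creationOp st W f Φ := by
  refine exists_clm_of_bound (withSeminorms_hida st W) (withSeminorms_hida st W) _ fun k =>
    ⟨fun f => ∑ a,
    ‖SchwartzMap.toLpCLM ℂ ℂ 2 (volume : Measure R3) ((oscOne ^ k) (f a))‖, {k + 1}, ?_, ?_,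
    fun f Φ => ?_⟩
  · fun_prop
  · simp [-SchwartzMap.toLpCLM_apply]
  · rw [Finset.sup_singleton]
    refine norm_embed_le_of_hidaSq_le (by positivity) ?_
    refine (hidaSq_creFamily_le st k _ Φ.1).trans (mul_le_mul_left ?_ _)
    exact sum_sqNorm_le _

end

section

variable {W : Submodule ℂ 𝓢(R3, ℂ)}

/-! ### The pairing of Fock space vectors -/

/-- The functions underlying a family of Schwartz functions. -/
def Family.fn (F : Family) (i : Idx) : (Fin i.1 → R3) → ℂ := F i

theorem integrable_mul {n : ℕ} (F G : 𝓢(Fin n → R3, ℂ)) : Integrable fun p => F p * G p :=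
  ((SchwartzMap.pairing (ContinuousLinearMap.mul ℂ ℂ)) F G).integrable

/-- Since `ab ≤ max(a, b)² ≤ a² + b²`. -/
theorem lintegral_enorm_mul_le {n : ℕ} (F G : 𝓢(Fin n → R3, ℂ)) :
    ∫⁻ p, ‖F p * G p‖ₑ ≤ sqNorm F + sqNorm G := by
  rw [sqNorm, sqNorm, ← lintegral_add_left (F.continuous.measurable.enorm.pow_const 2)]
  refine lintegral_mono fun p => ?_
  rw [enorm_mul]
  rcases le_total ‖F p‖ₑ ‖G p‖ₑ with h | h
  · exact (mul_le_mul_left h _).trans (by rw [← pow_two]; exact le_add_self)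
  · exact (mul_le_mul_right h _).trans (by rw [← pow_two]; exact le_self_add)

/-- The pairing of two vectors with finite Fock space norm converges absolutely. -/
theorem summable_pairing_norm {F G : Family} (hF : hidaSq 0 F < ⊤) (hG : hidaSq 0 G < ⊤) :
    Summable fun i : Idx => (i.1.factorial : ℝ) * ∫ p, ‖F i p * G i p‖ := by
  have h : ∑' i : Idx, (i.1.factorial : ENNReal) * ∫⁻ p, ‖F i p * G i p‖ₑ < ⊤ := by
    refine lt_of_le_of_lt (b := hidaSq 0 F + hidaSq 0 G) ?_ (ENNReal.add_lt_top.2 ⟨hF, hG⟩)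
    rw [hidaSq, hidaSq, ← ENNReal.tsum_add]
    refine ENNReal.tsum_le_tsum fun i => ?_
    rw [← mul_add]
    exact mul_le_mul_right (lintegral_enorm_mul_le (F i) (G i)) _
  refine (ENNReal.summable_toReal h.ne).congr fun i => ?_
  rw [ENNReal.toReal_mul, ENNReal.toReal_natCast, integral_norm_eq_lintegral_enorm]
  exact (integrable_mul (F i) (G i)).aestronglyMeasurable

theorem summable_pairing {F G : Family} (hF : hidaSq 0 F < ⊤) (hG : hidaSq 0 G < ⊤) :
    Summable fun i : Idx => (i.1.factorial : ℂ) * ∫ p, F i p * G i p := by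
  refine Summable.of_norm_bounded (summable_pairing_norm hF hG) fun i => ?_
  rw [norm_mul, Complex.norm_natCast]
  gcongr
  exact norm_integral_le_integral_norm _

theorem pairing_comm (F G : ∀ i : Idx, (Fin i.1 → R3) → ℂ) : pairing F G = pairing G F := by
  simp only [pairing, mul_comm]

theorem pairing_add_left {F F' G : Family} (hF : hidaSq 0 F < ⊤) (hF' : hidaSq 0 F' < ⊤)
    (hG : hidaSq 0 G < ⊤) :
    pairing (F + F').fn G.fn = pairing F.fn G.fn + pairing F'.fn G.fn := by
  simp only [pairing]
  refine Eq.trans ?_ ((summable_pairing hF hG).tsum_add (summable_pairing hF' hG))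
  congr 1 with i
  rw [← mul_add]
  congr 1
  refine Eq.trans ?_ (integral_add (integrable_mul (F i) (G i)) (integrable_mul (F' i) (G i)))
  congr 1 with p
  exact add_mul _ _ _

theorem hidaSq_tensorFamily_lt_top (f : Fin 4 → 𝓢(R3, ℂ)) {Ψ : Family} (hΨ : hidaSq 1 Ψ < ⊤) :
    hidaSq 0 (tensorFamily f Ψ) < ⊤ :=
  (hidaSq_tensorFamily_le 0 f Ψ).trans_lt (ENNReal.mul_lt_top
    (ENNReal.sum_lt_top.2 fun _ _ => sqNorm_lt_top _) hΨ)

/-- The pairing with a tensor product as a sum over the spin of the additional particle. -/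
theorem pairing_tensorFamily {f : Fin 4 → 𝓢(R3, ℂ)} {Φ Ψ : Family} (hΦ : hidaSq 0 Φ < ⊤)
    (hΨ : hidaSq 1 Ψ < ⊤) :
    pairing (tensorFamily f Ψ).fn Φ.fn = ∑ a, ∑' i : Idx, ((i.1 + 1).factorial : ℂ) *
      ∫ P, tensor (f a) (Ψ i) P * Φ ⟨i.1 + 1, Fin.cons a i.2⟩ P := by
  have hs := summable_pairing (hidaSq_tensorFamily_lt_top f hΨ) hΦ
  have h := tsum_consIdx (fun i : Idx => (i.1.factorial : ℂ) *
    ∫ p, tensorFamily f Ψ i p * Φ i p) (fun s => by simp [tensorFamily])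
  rw [pairing]
  refine h.symm.trans ((hs.comp_injective consIdx_injective).tsum_prod.trans ?_)
  rw [tsum_fintype]
  rfl

/-- The tensor product with `f` is the transpose of the annihilation operator smeared with `f`. -/
theorem pairing_annFamily {f : Fin 4 → 𝓢(R3, ℂ)} {Φ Ψ : Family} (hΦ : hidaSq 0 Φ < ⊤)
    (hΨ : hidaSq 1 Ψ < ⊤) :
    pairing (annFamily f Φ).fn Ψ.fn = pairing (tensorFamily f Ψ).fn Φ.fn := by
  have hs := summable_pairing (hidaSq_tensorFamily_lt_top f hΨ) hΦ
  have hs' (a : Fin 4) : Summable fun i : Idx => ((i.1 + 1).factorial : ℂ) *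
      ∫ P, tensor (f a) (Ψ i) P * Φ ⟨i.1 + 1, Fin.cons a i.2⟩ P :=
    hs.comp_injective (i := fun i => consIdx (a, i))
      (consIdx_injective.comp (Prod.mk_right_injective a))
  rw [pairing_tensorFamily hΦ hΨ, ← Summable.tsum_finsetSum fun a _ => hs' a, pairing]
  congr 1 with i
  obtain ⟨n, s⟩ := i
  have h (q : Fin n → R3) : (annFamily f Φ).fn ⟨n, s⟩ q * Ψ.fn ⟨n, s⟩ q =
      ((n : ℂ) + 1) * ∑ a, contract (f a) (Φ ⟨n + 1, Fin.cons a s⟩) q * Ψ ⟨n, s⟩ q := by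
    rw [Family.fn, annFamily_apply, ← Finset.sum_mul, ← mul_assoc]
    simp_rw [contract_apply]
    rfl
  simp_rw [h]
  rw [integral_const_mul, integral_finsetSum _ fun a _ => integrable_mul _ _]
  simp_rw [integral_contract_mul]
  rw [← mul_assoc, Finset.mul_sum, Nat.factorial_succ]
  push_cast
  refine Finset.sum_congr rfl fun a _ => ?_
  ring

/-- The (anti)symmetrization may be omitted in the pairing with an (anti)symmetric vector. -/
theorem pairing_symFamily {st : Stat} {F Ψ : Family}
    (hΨ : ∀ (n : ℕ) (σ : Equiv.Perm (Fin n)) (s : Fin n → Fin 4) (p : Fin n → R3),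
      Ψ ⟨n, s ∘ σ⟩ (p ∘ σ) = st.factor σ * Ψ ⟨n, s⟩ p)
    (hF : hidaSq 0 F < ⊤) (hΨ' : hidaSq 0 Ψ < ⊤) :
    pairing (symFamily st F).fn Ψ.fn = pairing F.fn Ψ.fn := by
  have h1 := summable_pairing ((hidaSq_symFamily_le st 0 F).trans_lt hF) hΨ'
  have h2 := summable_pairing hF hΨ'
  rw [pairing, pairing]
  refine (h1.tsum_sigma).trans ((h2.tsum_sigma).trans ?_).symm
  congr 1 with n
  rw [tsum_fintype, tsum_fintype]
  have hn : (n.factorial : ℂ) ≠ 0 := by exact_mod_cast n.factorial_ne_zero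
  have h3 (s : Fin n → Fin 4) : (n.factorial : ℂ) *
      ∫ p, symFamily st F ⟨n, s⟩ p * Ψ ⟨n, s⟩ p =
      ∑ σ : Equiv.Perm (Fin n), ∫ p, F ⟨n, s ∘ σ⟩ p * Ψ ⟨n, s ∘ σ⟩ p := by
    have h4 (p : Fin n → R3) : symFamily st F ⟨n, s⟩ p * Ψ ⟨n, s⟩ p = (n.factorial : ℂ)⁻¹ *
        ∑ σ : Equiv.Perm (Fin n),
          permCLM σ (F ⟨n, s ∘ σ⟩) p * permCLM σ (Ψ ⟨n, s ∘ σ⟩) p := by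
      rw [symFamily_apply, mul_assoc, Finset.sum_mul]
      congr 1
      refine Finset.sum_congr rfl fun σ _ => ?_
      rw [permCLM_apply, permCLM_apply, hΨ]
      ring
    simp_rw [h4]
    rw [integral_const_mul, ← mul_assoc, mul_inv_cancel₀ hn, one_mul,
      integral_finsetSum _ fun σ _ => integrable_mul _ _]
    refine Finset.sum_congr rfl fun σ _ => ?_
    exact (measurePreserving_comp_perm σ).integral_comp (measurableEmbedding_comp_perm σ)
      fun p => F ⟨n, s ∘ σ⟩ p * Ψ ⟨n, s ∘ σ⟩ p
  change ∑ s : Fin n → Fin 4, (n.factorial : ℂ) * ∫ p, F ⟨n, s⟩ p * Ψ ⟨n, s⟩ p =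
    ∑ s : Fin n → Fin 4, (n.factorial : ℂ) * ∫ p, symFamily st F ⟨n, s⟩ p * Ψ ⟨n, s⟩ p
  simp_rw [h3]
  rw [Finset.sum_comm]
  have h5 (σ : Equiv.Perm (Fin n)) : ∑ s : Fin n → Fin 4,
      ∫ p, F ⟨n, s ∘ σ⟩ p * Ψ ⟨n, s ∘ σ⟩ p = ∑ s : Fin n → Fin 4, ∫ p, F ⟨n, s⟩ p * Ψ ⟨n, s⟩ p :=
    sum_comp_perm σ fun s => ∫ p, F ⟨n, s⟩ p * Ψ ⟨n, s⟩ p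
  simp_rw [h5]
  rw [Finset.sum_const, Finset.card_univ, Fintype.card_perm, Fintype.card_fin, nsmul_eq_mul,
    Finset.mul_sum]

/-- The matrix elements of an annihilation operator at a point, smeared afterwards, are those of
the smeared operator: the sum over the components and the integral may be interchanged. -/
theorem sum_integral_mul_pairing_annihilate {f : Fin 4 → 𝓢(R3, ℂ)} {Φ Ψ : Family}
    (hΦ : hidaSq 0 Φ < ⊤) (hΨ : hidaSq 1 Ψ < ⊤) :
    ∑ a, ∫ p, f a p * pairing (annihilate a p Φ.fn) Ψ.fn =
      pairing (tensorFamily f Ψ).fn Φ.fn := by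
  rw [pairing_tensorFamily hΦ hΨ]
  refine Finset.sum_congr rfl fun a _ => ?_
  let H (i : Idx) (P : Fin (i.1 + 1) → R3) : ℂ :=
    tensor (f a) (Ψ i) P * Φ ⟨i.1 + 1, Fin.cons a i.2⟩ P
  have hH (i : Idx) : Integrable (H i) := integrable_mul _ _
  let g (i : Idx) (p : R3) : ℂ := ((i.1 + 1).factorial : ℂ) * ∫ q, H i (Fin.cons p q)
  have hg (i : Idx) : Integrable (g i) := (integrable_cons (hH i)).integral_prod_left.const_mul _
  have hs : Summable fun i : Idx => ∫ p, ‖g i p‖ := by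
    have h1 := (summable_pairing_norm (hidaSq_tensorFamily_lt_top f hΨ) hΦ).comp_injective
      (i := fun i => consIdx (a, i)) (consIdx_injective.comp (Prod.mk_right_injective a))
    refine Summable.of_nonneg_of_le (fun i => by positivity) (fun i => ?_) h1
    change ∫ p, ‖g i p‖ ≤ ((i.1 + 1).factorial : ℝ) * ∫ P, ‖H i P‖
    simp only [g, norm_mul, Complex.norm_natCast]
    rw [integral_const_mul]
    gcongr
    rw [integral_cons, integral_prod _ (integrable_cons (hH i).norm)]
    refine integral_mono (integrable_cons (hH i)).integral_prod_left.norm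
      (integrable_cons (hH i)).norm.integral_prod_left fun p => ?_
    exact norm_integral_le_integral_norm _
  have h := (hasSum_integral_of_summable_integral_norm hg hs).tsum_eq
  have h1 (p : R3) : f a p * pairing (annihilate a p Φ.fn) Ψ.fn = ∑' i, g i p := by
    rw [pairing, ← tsum_mul_left]
    congr 1 with i
    simp only [g, H, annihilate, Family.fn, tensor_apply, Fin.cons_zero, Fin.tail_cons]
    rw [Nat.factorial_succ]
    simp_rw [mul_assoc, integral_const_mul]
    push_cast
    simp_rw [mul_comm (Ψ i _)]
    ring
  simp_rw [h1]
  rw [← h]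
  congr 1 with i
  simp only [g]
  rw [integral_const_mul, integral_cons, integral_prod _ (integrable_cons (hH i))]

/-- The annihilation operator smeared with `f` plus the creation operator smeared with `g` has the
matrix elements that define the field with `κ₀₁(φ) = f` and `κ₁₀(φ) = g`. -/
theorem pairing_field {st : Stat} (f g : Fin 4 → 𝓢(R3, ℂ)) {Φ Ψ : Family}
    (hΦ : Φ ∈ hidaSubmodule st W) (hΨ : Ψ ∈ hidaSubmodule st W) :
    pairing (annFamily f Φ + symFamily st (tensorFamily g Φ)).fn Ψ.fn =
      (∑ a, ∫ p, f a p * pairing (annihilate a p Φ.fn) Ψ.fn) +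
        ∑ a, ∫ p, g a p * pairing Φ.fn (annihilate a p Ψ.fn) := by
  have h1 (k : ℕ) : hidaSq k Φ < ⊤ := (memℓp_weighted_iff k Φ).1 (hΦ.2.2 k)
  have h2 (k : ℕ) : hidaSq k Ψ < ⊤ := (memℓp_weighted_iff k Ψ).1 (hΨ.2.2 k)
  have h3 : hidaSq 0 (annFamily f Φ) < ⊤ :=
    (memℓp_weighted_iff 0 _).1 ((annFamily_mem f hΦ).2.2 0)
  have h4 := hidaSq_tensorFamily_lt_top g (h1 1)
  rw [pairing_add_left h3 ((hidaSq_symFamily_le st 0 _).trans_lt h4) (h2 0),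
    pairing_annFamily (h1 0) (h2 1), pairing_symFamily hΨ.2.1 h4 (h2 0),
    ← sum_integral_mul_pairing_annihilate (h1 0) (h2 1),
    ← sum_integral_mul_pairing_annihilate (h2 0) (h1 1)]
  simp_rw [pairing_comm Φ.fn]

/-! ### Fields with kernels in `L(𝓔, E)` -/

/-- If the kernels map test functions to test functions, continuously, then the field is a
continuous map into the operators of the Hida space. -/
theorem fieldMem_of_memTest (st : Stat) {κ₀₁ κ₁₀ : Kernel} {X : Submodule ℂ 𝓢(R4, ℂ)}
    (h₀₁ : κ₀₁.MemTest W X) (h₁₀ : κ₁₀.MemTest W X) : FieldMem st κ₀₁ κ₁₀ W X := by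
  obtain ⟨K, hK⟩ := h₀₁
  obtain ⟨L, hL⟩ := h₁₀
  obtain ⟨A, hA⟩ := exists_annihilationOp_clm st W
  obtain ⟨C, hC⟩ := exists_creationOp_clm st W
  refine ⟨A.comp K + C.comp L, fun φ Φ Ψ => ?_⟩
  have h1 : ((A.comp K + C.comp L) φ Φ).comp =
      (annFamily (fun a => K φ a) Φ.1 + symFamily st (tensorFamily (fun a => L φ a) Φ.1)).fn := by
    change (A (K φ) Φ + C (L φ) Φ).comp = _
    rw [hA, hC]
    rfl
  rw [h1]
  refine (pairing_field _ _ Φ.2 Ψ.2).trans ?_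
  rw [fieldForm]
  congr 1
  · refine Finset.sum_congr rfl fun s _ => integral_congr_ae ?_
    filter_upwards [hK φ s] with p hp
    rw [hp]
    rfl
  · refine Finset.sum_congr rfl fun s _ => integral_congr_ae ?_
    filter_upwards [hL φ s] with p hp
    rw [hp]
    rfl

end

/-! ### Superpositions of plane waves -/

/-- A superposition of plane waves with rapidly decreasing weight is a Fourier integral of a
measure on the image of `mom`; hence it is smooth with bounded derivatives. -/
theorem contDiff_superposition {mom : R3 → R4} {back : R4 →L[ℝ] R3} (hmom : Continuous mom)
    (hback : ∀ p, back (mom p) = p) {h : R3 → ℂ} (hm : AEStronglyMeasurable h)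
    (hi : ∀ n : ℕ, Integrable fun p => ‖mom p‖ ^ n * ‖h p‖) :
    ContDiff ℝ ∞ (fun x : R4 => ∫ p, (𝐞 (-inner ℝ x (mom p)) : ℂ) * h p) ∧
      ∀ (n : ℕ) (x : R4), ‖iteratedFDeriv ℝ n
        (fun x : R4 => ∫ p, (𝐞 (-inner ℝ x (mom p)) : ℂ) * h p) x‖ ≤
          (2 * Real.pi) ^ n * ∫ p, ‖mom p‖ ^ n * ‖h p‖ := by
  have hemb : MeasurableEmbedding mom :=
    hmom.measurableEmbedding (Function.LeftInverse.injective hback)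
  set μ : Measure R4 := (volume : Measure R3).map mom
  let L : R4 →L[ℝ] R4 →L[ℝ] ℝ := innerSL ℝ
  let f : R4 → ℂ := fun v => h (back v)
  have hfm : AEStronglyMeasurable f μ := by
    rw [hemb.aestronglyMeasurable_map_iff]
    refine hm.congr (Filter.Eventually.of_forall fun p => ?_)
    simp [f, hback]
  have hfi (n : ℕ) : Integrable (fun v => ‖v‖ ^ n * ‖f v‖) μ := by
    rw [hemb.integrable_map_iff]
    refine (hi n).congr (Filter.Eventually.of_forall fun p => ?_)
    simp [f, hback]
  have hJ : (fun x : R4 => ∫ p, (𝐞 (-inner ℝ x (mom p)) : ℂ) * h p) =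
      VectorFourier.fourierIntegral 𝐞 μ L.toLinearMap₁₂ f := by
    funext x
    rw [VectorFourier.fourierIntegral, hemb.integral_map]
    refine integral_congr_ae (Filter.Eventually.of_forall fun p => ?_)
    have h1 : L (mom p) x = inner ℝ x (mom p) := by
      rw [real_inner_comm]; rfl
    simp [f, hback, h1, Circle.smul_def]
  have hL : ‖L‖ ≤ 1 := norm_innerSL_le ℝ
  rw [hJ]
  refine ⟨VectorFourier.contDiff_fourierIntegral L fun n _ => hfi n, fun n x => ?_⟩
  rw [VectorFourier.iteratedFDeriv_fourierIntegral (N := ⊤) L (fun n _ => hfi n) hfm le_top]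
  refine (VectorFourier.norm_fourierIntegral_le_integral_norm _ _ _ _ _).trans ?_
  have h1 : ∫ p, ‖mom p‖ ^ n * ‖h p‖ = ∫ v, ‖v‖ ^ n * ‖f v‖ ∂μ := by
    rw [hemb.integral_map]
    simp [f, hback]
  rw [h1, ← integral_const_mul]
  refine integral_mono_of_nonneg (Filter.Eventually.of_forall fun v => norm_nonneg _)
    ((hfi n).const_mul _) (Filter.Eventually.of_forall fun v => ?_)
  refine (VectorFourier.norm_fourierPowSMulRight_le L f v n).trans ?_
  rw [mul_assoc]
  refine mul_le_mul_of_nonneg_right ?_ (by positivity)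
  refine pow_le_pow_left₀ (by positivity) ?_ n
  exact mul_le_of_le_one_right (by positivity) hL

/-- `κ` is a superposition of plane waves: `κ(s, p; a, x) = amp s a p · e^{-2πi ⟨x, mom p⟩}`, with
an amplitude that is integrable up to a polynomial factor and a wave vector `mom p` that depends
continuously on `p`, grows at most linearly and determines `p` linearly. -/
structure IsPlaneWave (κ : Kernel) (amp : Fin 4 → Fin 4 → R3 → ℂ) (mom : R3 → R4)
    (back : R4 →L[ℝ] R3) : Prop where
  eq : ∀ s p a x, κ s p a x = amp s a p * 𝐞 (-inner ℝ x (mom p))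
  continuous_mom : Continuous mom
  back_mom : ∀ p, back (mom p) = p
  norm_mom_le : ∃ C : ℝ, 0 ≤ C ∧ ∀ p, ‖mom p‖ ≤ C * (1 + ‖p‖)
  measurable_amp : ∀ s a, Measurable (amp s a)
  integrable_amp : ∃ N : ℕ, ∀ s a, Integrable fun p => ((1 + ‖p‖) ^ N)⁻¹ * ‖amp s a p‖

variable {κ : Kernel} {amp : Fin 4 → Fin 4 → R3 → ℂ} {mom : R3 → R4} {back : R4 →L[ℝ] R3}
  {W : Submodule ℂ 𝓢(R3, ℂ)} {X : Submodule ℂ 𝓢(R4, ℂ)}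

namespace IsPlaneWave

/-- `κ(φ)` is the product of the amplitude and the Fourier transform of `φ`. -/
theorem smearX_eq (h : IsPlaneWave κ amp mom back) (φ : Test X) (s : Fin 4) (p : R3) :
    κ.smearX φ s p = ∑ a, amp s a p * 𝓕 (φ a : 𝓢(R4, ℂ)) (mom p) := by
  refine Finset.sum_congr rfl fun a _ => ?_
  rw [SchwartzMap.fourier_coe, Real.fourier_eq, ← integral_const_mul]
  refine integral_congr_ae (Filter.Eventually.of_forall fun x => ?_)
  simp only [h.eq, Circle.smul_def, smul_eq_mul, mul_assoc]

/-- All moments of `amp · ξ` along the wave vector are bounded by a continuous seminorm of `ξ`: its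
rapid decrease outweighs the growth of the amplitude and of `mom`. -/
theorem weighted_bound (h : IsPlaneWave κ amp mom back) (n : ℕ) :
    ∃ (C : ℝ) (m : ℕ), 0 ≤ C ∧ ∀ (s a : Fin 4) (ξ : 𝓢(R3, ℂ)),
      Integrable (fun p => ‖mom p‖ ^ n * ‖amp s a p * ξ p‖) ∧
        ∫ p, ‖mom p‖ ^ n * ‖amp s a p * ξ p‖ ≤
          C * (Finset.Iic (m, 0)).sup (schwartzSeminormFamily ℂ R3 ℂ) ξ := by
  obtain ⟨C, hC, hmom⟩ := h.norm_mom_le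
  obtain ⟨N, hN⟩ := h.integrable_amp
  set I : ℝ := ∑ s, ∑ a, ∫ p, ((1 + ‖p‖) ^ N)⁻¹ * ‖amp s a p‖
  have hI0 (s a) : 0 ≤ ∫ p, ((1 + ‖p‖) ^ N)⁻¹ * ‖amp s a p‖ :=
    integral_nonneg fun p => by positivity
  have hI (s a) : ∫ p, ((1 + ‖p‖) ^ N)⁻¹ * ‖amp s a p‖ ≤ I :=
    (Finset.single_le_sum (f := fun a => ∫ p, ((1 + ‖p‖) ^ N)⁻¹ * ‖amp s a p‖)
      (fun a _ => hI0 s a) (Finset.mem_univ a)).trans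
    (Finset.single_le_sum (f := fun s => ∑ a, ∫ p, ((1 + ‖p‖) ^ N)⁻¹ * ‖amp s a p‖)
      (fun s _ => Finset.sum_nonneg fun a _ => hI0 s a) (Finset.mem_univ s))
  have hI1 : 0 ≤ I := (hI0 0 0).trans (hI 0 0)
  refine ⟨C ^ n * 2 ^ (n + N) * I, n + N, by positivity, fun s a ξ => ?_⟩
  set S := (Finset.Iic (n + N, 0)).sup (schwartzSeminormFamily ℂ R3 ℂ) ξ
  have hS : 0 ≤ S := apply_nonneg _ _
  have key (p : R3) : ‖mom p‖ ^ n * ‖amp s a p * ξ p‖ ≤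
      C ^ n * 2 ^ (n + N) * S * (((1 + ‖p‖) ^ N)⁻¹ * ‖amp s a p‖) := by
    have h1 := SchwartzMap.one_add_le_sup_seminorm_apply (𝕜 := ℂ) (m := (n + N, 0)) le_rfl le_rfl
      ξ p
    rw [norm_iteratedFDeriv_zero] at h1
    have h2 : ‖mom p‖ ^ n ≤ C ^ n * (1 + ‖p‖) ^ n := by
      rw [← mul_pow]
      exact pow_le_pow_left₀ (norm_nonneg _) (hmom p) n
    have h3 : (0 : ℝ) < (1 + ‖p‖) ^ N := by positivity
    calc ‖mom p‖ ^ n * ‖amp s a p * ξ p‖ ≤ C ^ n * (1 + ‖p‖) ^ n * ‖amp s a p * ξ p‖ := by gcongr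
      _ = C ^ n * ((1 + ‖p‖) ^ (n + N) * ‖ξ p‖) * (((1 + ‖p‖) ^ N)⁻¹ * ‖amp s a p‖) := by
        rw [norm_mul, pow_add]
        field_simp
      _ ≤ C ^ n * (2 ^ (n + N) * S) * (((1 + ‖p‖) ^ N)⁻¹ * ‖amp s a p‖) :=
        mul_le_mul_of_nonneg_right (mul_le_mul_of_nonneg_left h1 (by positivity)) (by positivity)
      _ = _ := by ring
  have hint : Integrable (fun p => ‖mom p‖ ^ n * ‖amp s a p * ξ p‖) := by
    refine ((hN s a).const_mul (C ^ n * 2 ^ (n + N) * S)).mono' ?_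
      (Filter.Eventually.of_forall fun p => ?_)
    · exact ((h.continuous_mom.norm.pow n).measurable.mul
        ((h.measurable_amp s a).mul ξ.continuous.measurable).norm).aestronglyMeasurable
    · rw [Real.norm_of_nonneg (by positivity)]
      exact key p
  refine ⟨hint, (integral_mono hint ((hN s a).const_mul _) key).trans ?_⟩
  rw [integral_const_mul]
  calc C ^ n * 2 ^ (n + N) * S * ∫ p, ((1 + ‖p‖) ^ N)⁻¹ * ‖amp s a p‖
      ≤ C ^ n * 2 ^ (n + N) * S * I := by gcongr; exact hI s a
    _ = _ := by ring

theorem integrable_amp_mul (h : IsPlaneWave κ amp mom back) (s a : Fin 4) (ξ : 𝓢(R3, ℂ)) :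
    Integrable fun p => amp s a p * ξ p := by
  obtain ⟨C, m, -, hC⟩ := h.weighted_bound 0
  have h1 := (hC s a ξ).1
  simp only [pow_zero, one_mul] at h1
  exact (integrable_norm_iff
    ((h.measurable_amp s a).mul ξ.continuous.measurable).aestronglyMeasurable).1 h1

theorem smearP_eq (h : IsPlaneWave κ amp mom back) (ξ : Test W) (a : Fin 4) :
    κ.smearP ξ a = fun x => ∑ s, ∫ p, (𝐞 (-inner ℝ x (mom p)) : ℂ) *
      (amp s a p * (ξ s : 𝓢(R3, ℂ)) p) := by
  funext x
  refine Finset.sum_congr rfl fun s _ => ?_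
  refine integral_congr_ae (Filter.Eventually.of_forall fun p => ?_)
  simp only [h.eq]
  ring

theorem contDiff_smearP (h : IsPlaneWave κ amp mom back) (ξ : Test W) (a : Fin 4) :
    ContDiff ℝ ∞ (κ.smearP ξ a) := by
  rw [h.smearP_eq]
  refine ContDiff.sum fun s _ => ?_
  exact (contDiff_superposition h.continuous_mom h.back_mom
    (h.integrable_amp_mul s a _).aestronglyMeasurable fun n => by
      obtain ⟨C, m, -, hC⟩ := h.weighted_bound n
      exact (hC s a _).1).1

/-- The derivatives of `κ(ξ)` are bounded uniformly on space-time by continuous seminorms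
of `ξ`. -/
theorem norm_iteratedFDeriv_smearP_le (h : IsPlaneWave κ amp mom back) (n : ℕ) :
    ∃ b : Test W → ℝ, Continuous b ∧ b 0 = 0 ∧ ∀ (ξ : Test W) (a : Fin 4) (x : R4),
      ‖iteratedFDeriv ℝ n (κ.smearP ξ a) x‖ ≤ b ξ := by
  obtain ⟨C, m, hC0, hC⟩ := h.weighted_bound n
  have hq : Continuous (⇑((Finset.Iic (m, 0)).sup (schwartzSeminormFamily ℂ R3 ℂ))) :=
    Seminorm.continuous_finsetSup fun i _ =>
      (schwartz_withSeminorms ℂ R3 ℂ).continuous_seminorm i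
  refine ⟨fun ξ => ∑ s, (2 * Real.pi) ^ n *
    (C * (Finset.Iic (m, 0)).sup (schwartzSeminormFamily ℂ R3 ℂ) (ξ s : 𝓢(R3, ℂ))), ?_, ?_,
    fun ξ a x => ?_⟩
  · refine continuous_finsetSum _ fun s _ => continuous_const.mul (continuous_const.mul ?_)
    exact hq.comp (continuous_subtype_val.comp (continuous_apply s))
  · simp
  have h1 (s : Fin 4) := contDiff_superposition h.continuous_mom h.back_mom
    (h.integrable_amp_mul s a (ξ s)).aestronglyMeasurable fun n => by
      obtain ⟨C, m, -, hC⟩ := h.weighted_bound n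
      exact (hC s a _).1
  rw [h.smearP_eq, iteratedFDeriv_fun_sum_apply
    fun s _ => ((h1 s).1.of_le (by exact_mod_cast le_top)).contDiffAt]
  refine (norm_sum_le _ _).trans (Finset.sum_le_sum fun s _ => ((h1 s).2 n x).trans ?_)
  gcongr
  exact (hC s a _).2

theorem smoothBounded (h : IsPlaneWave κ amp mom back) (W : Submodule ℂ 𝓢(R3, ℂ)) :
    κ.SmoothBounded W := by
  refine fun ξ a => ⟨h.contDiff_smearP ξ a, fun n => ?_⟩
  obtain ⟨b, -, -, hb⟩ := h.norm_iteratedFDeriv_smearP_le (W := W) n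
  exact ⟨b ξ, hb ξ a⟩

theorem hasTemperateGrowth_smearP (h : IsPlaneWave κ amp mom back) (ξ : Test W) (a : Fin 4) :
    (κ.smearP ξ a).HasTemperateGrowth := by
  refine ⟨h.contDiff_smearP ξ a, fun n => ?_⟩
  obtain ⟨b, -, -, hb⟩ := h.norm_iteratedFDeriv_smearP_le (W := W) n
  exact ⟨0, b ξ, fun x => by simpa using hb ξ a x⟩

theorem smearP_add (h : IsPlaneWave κ amp mom back) (ξ η : Test W) (a : Fin 4) :
    κ.smearP (ξ + η) a = κ.smearP ξ a + κ.smearP η a := by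
  have hint (ζ : Test W) (s : Fin 4) (x : R4) :
      Integrable fun p => κ s p a x * (ζ s : 𝓢(R3, ℂ)) p := by
    refine (h.integrable_amp_mul s a (ζ s)).norm.mono' ?_ (Filter.Eventually.of_forall fun p => ?_)
    · simp only [h.eq]
      have h1 : Continuous fun p : R3 => (𝐞 (-inner ℝ x (mom p)) : ℂ) := by
        have := h.continuous_mom
        fun_prop
      exact (((h.measurable_amp s a).mul h1.measurable).mul
        (ζ s : 𝓢(R3, ℂ)).continuous.measurable).aestronglyMeasurable
    · simp only [h.eq, norm_mul, Circle.norm_coe, mul_one]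
      exact le_rfl
  funext x
  simp only [Kernel.smearP, Pi.add_apply, Submodule.coe_add, add_apply, mul_add]
  rw [← Finset.sum_add_distrib]
  exact Finset.sum_congr rfl fun s _ => integral_add (hint ξ s x) (hint η s x)

theorem smearP_smul (c : ℂ) (ξ : Test W) (a : Fin 4) :
    κ.smearP (c • ξ) a = c • κ.smearP ξ a := by
  funext x
  simp only [Kernel.smearP, Pi.smul_apply, Submodule.coe_smul, smul_apply, smul_eq_mul,
    Finset.mul_sum, ← integral_const_mul]
  refine Finset.sum_congr rfl fun s _ => integral_congr_ae (Filter.Eventually.of_forall fun p => ?_)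
  ring

end IsPlaneWave

/-- The Schwartz seminorms of a product with a multiplier all of whose derivatives are bounded. -/
theorem seminorm_smulLeftCLM_le {g : R4 → ℂ} (hg : g.HasTemperateGrowth) (k n : ℕ) {b : ℕ → ℝ}
    (hb : ∀ i x, ‖iteratedFDeriv ℝ i g x‖ ≤ b i) (f : 𝓢(R4, ℂ)) :
    SchwartzMap.seminorm ℂ k n (SchwartzMap.smulLeftCLM ℂ g f) ≤
      (∑ i ∈ Finset.range (n + 1), (n.choose i : ℝ) * b i) *
        (Finset.Iic (k, n)).sup (schwartzSeminormFamily ℂ R4 ℂ) f := by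
  set S := (Finset.Iic (k, n)).sup (schwartzSeminormFamily ℂ R4 ℂ) f
  have hS : 0 ≤ S := apply_nonneg _ _
  have hb0 (i) : 0 ≤ b i := (norm_nonneg _).trans (hb i 0)
  refine SchwartzMap.seminorm_le_bound ℂ k n _
    (mul_nonneg (Finset.sum_nonneg fun i _ => mul_nonneg (Nat.cast_nonneg _) (hb0 i)) hS)
      fun x => ?_
  have h0 : (SchwartzMap.smulLeftCLM ℂ g f : R4 → ℂ) = fun x => g x * f x := by
    funext x
    rw [SchwartzMap.smulLeftCLM_apply_apply hg, smul_eq_mul]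
  rw [h0]
  refine (mul_le_mul_of_nonneg_left (norm_iteratedFDeriv_mul_le
    (hg.1.of_le (by exact_mod_cast le_top)) (f.smooth n) x le_rfl) (by positivity)).trans ?_
  rw [Finset.mul_sum, Finset.sum_mul]
  refine Finset.sum_le_sum fun i _ => ?_
  have h1 : ‖x‖ ^ k * ‖iteratedFDeriv ℝ (n - i) f x‖ ≤ S :=
    (SchwartzMap.le_seminorm ℂ k (n - i) f x).trans
      (Seminorm.le_finset_sup_apply (p := schwartzSeminormFamily ℂ R4 ℂ) (i := (k, n - i))
        (Finset.mem_Iic.2 ⟨le_rfl, Nat.sub_le _ _⟩))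
  calc ‖x‖ ^ k * (n.choose i * ‖iteratedFDeriv ℝ i g x‖ * ‖iteratedFDeriv ℝ (n - i) f x‖)
      = n.choose i * ‖iteratedFDeriv ℝ i g x‖ * (‖x‖ ^ k * ‖iteratedFDeriv ℝ (n - i) f x‖) := by
        ring
    _ ≤ n.choose i * b i * S :=
        mul_le_mul (mul_le_mul_of_nonneg_left (hb i x) (Nat.cast_nonneg _)) h1 (by positivity)
          (mul_nonneg (Nat.cast_nonneg _) (hb0 i))

namespace IsPlaneWave

/-- Multiplication by `κ(ξ)` is continuous in the Schwartz space, with bounds that depend on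
continuous seminorms of `ξ` only; this is continuity for the operator topology of `𝓞_M`. -/
theorem memOM (h : IsPlaneWave κ amp mom back) (W : Submodule ℂ 𝓢(R3, ℂ)) : κ.MemOM W := by
  let J (a : Fin 4) : Test W →ₗ[ℂ] OM :=
    { toFun := fun ξ => ⟨κ.smearP ξ a, h.hasTemperateGrowth_smearP ξ a⟩
      map_add' := fun ξ η => Subtype.ext (h.smearP_add ξ η a)
      map_smul' := fun c ξ => Subtype.ext (smearP_smul c ξ a) }
  have hJ (a : Fin 4) : Continuous (J a) := by
    rw [continuous_induced_rng]
    let B : Test W →ₗ[ℂ] 𝓢(R4, ℂ) →ₗ[ℂ] 𝓢(R4, ℂ) :=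
      (ContinuousLinearMap.coeLM ℂ).comp (OM.toOperator.comp (J a))
    choose b hb hb0 hbb using h.norm_iteratedFDeriv_smearP_le (W := W)
    obtain ⟨T, hT⟩ := exists_clm_of_bound (schwartz_withSeminorms ℂ R4 ℂ)
      (schwartz_withSeminorms ℂ R4 ℂ) B fun k =>
        ⟨fun ξ => ∑ i ∈ Finset.range (k.2 + 1), (k.2.choose i : ℝ) * b i ξ, Finset.Iic k,
          continuous_finsetSum _ fun i _ => continuous_const.mul (hb i), by simp [hb0],
          fun ξ f => seminorm_smulLeftCLM_le (h.hasTemperateGrowth_smearP ξ a) k.1 k.2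
            (b := fun i => b i ξ) (fun i x => hbb i ξ a x) f⟩
    have : OM.toOperator ∘ J a = T := by
      funext ξ
      exact ContinuousLinearMap.ext fun f => (hT ξ f).symm
    rw [this]
    exact T.continuous
  exact ⟨⟨LinearMap.pi J, continuous_pi hJ⟩, fun ξ a => rfl⟩

/-- Fubini's theorem for plane-wave kernels. -/
theorem sum_integral_smearP_mul (h : IsPlaneWave κ amp mom back) (ξ : Test W) (φ : Test X) :
    ∑ a, ∫ x, κ.smearP ξ a x * (φ a : 𝓢(R4, ℂ)) x =
      ∑ s, ∫ p, (ξ s : 𝓢(R3, ℂ)) p * κ.smearX φ s p := by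
  have hprod (s a : Fin 4) : Integrable (fun z : R4 × R3 =>
      κ s z.2 a z.1 * (ξ s : 𝓢(R3, ℂ)) z.2 * (φ a : 𝓢(R4, ℂ)) z.1) (volume.prod volume) := by
    have h1 := ((φ a : 𝓢(R4, ℂ)).integrable (μ := volume)).mul_prod (h.integrable_amp_mul s a (ξ s))
    refine h1.norm.mono' ?_ (Filter.Eventually.of_forall fun z => ?_)
    · simp only [h.eq]
      have h2 : Continuous fun z : R4 × R3 => (𝐞 (-inner ℝ z.1 (mom z.2)) : ℂ) := by
        have := h.continuous_mom
        fun_prop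
      exact (((((h.measurable_amp s a).comp measurable_snd).mul h2.measurable).mul
        ((ξ s : 𝓢(R3, ℂ)).continuous.measurable.comp measurable_snd)).mul
        ((φ a : 𝓢(R4, ℂ)).continuous.measurable.comp measurable_fst)).aestronglyMeasurable
    · simp only [h.eq, norm_mul, Circle.norm_coe, mul_one]
      exact le_of_eq (by ring)
  have h1 (a : Fin 4) : ∫ x, κ.smearP ξ a x * (φ a : 𝓢(R4, ℂ)) x =
      ∑ s, ∫ x, ∫ p, κ s p a x * (ξ s : 𝓢(R3, ℂ)) p * (φ a : 𝓢(R4, ℂ)) x := by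
    rw [← integral_finsetSum]
    · simp only [Kernel.smearP, Finset.sum_mul, ← integral_mul_const]
    · exact fun s _ => (hprod s a).integral_prod_left
  have h2 (s : Fin 4) : ∫ p, (ξ s : 𝓢(R3, ℂ)) p * κ.smearX φ s p =
      ∑ a, ∫ p, ∫ x, κ s p a x * (ξ s : 𝓢(R3, ℂ)) p * (φ a : 𝓢(R4, ℂ)) x := by
    rw [← integral_finsetSum]
    · simp only [Kernel.smearX, Finset.mul_sum, ← integral_const_mul]
      refine integral_congr_ae (Filter.Eventually.of_forall fun p => Finset.sum_congr rfl
        fun a _ => integral_congr_ae (Filter.Eventually.of_forall fun x => ?_))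
      ring
    · exact fun a _ => (hprod s a).integral_prod_right
  simp_rw [h1, h2]
  rw [Finset.sum_comm]
  exact Finset.sum_congr rfl fun s _ => Finset.sum_congr rfl fun a _ =>
    integral_integral_swap (hprod s a)

/-- The transpose of `κ : 𝓔 → E` extends `κ : E → 𝓔*`. -/
theorem memDual_of_memTest (h : IsPlaneWave κ amp mom back) (hκ : κ.MemTest W X) :
    κ.MemDual W X := by
  obtain ⟨K, hK⟩ := hκ
  refine ⟨ContinuousLinearMap.precomp ℂ K, fun ξ φ => ?_⟩
  rw [h.sum_integral_smearP_mul]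
  change toDual ξ (K φ) = _
  rw [toDual_apply]
  refine Finset.sum_congr rfl fun s _ => integral_congr_ae ?_
  filter_upwards [hK φ s] with p hp
  rw [hp]

end IsPlaneWave

/-! ### Wave vectors on a mass shell -/

/-- The time direction of space-time. -/
def timeAxis : R4 := EuclideanSpace.single 0 1

/-- The inclusion of space into space-time. -/
def spaceL : R3 →L[ℝ] R4 :=
  LinearMap.toContinuousLinearMap
    { toFun := fun p => WithLp.toLp 2 (Fin.cons 0 fun i => p i)
      map_add' := fun p q => by
        ext i
        refine Fin.cases ?_ (fun i => ?_) i <;> simp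
      map_smul' := fun c p => by
        ext i
        refine Fin.cases ?_ (fun i => ?_) i <;> simp }

/-- The projection of space-time onto space. -/
def spacePart : R4 →L[ℝ] R3 :=
  LinearMap.toContinuousLinearMap
    { toFun := fun x => WithLp.toLp 2 fun i => x i.succ
      map_add' := fun p q => by ext i; simp
      map_smul' := fun c p => by ext i; simp }

@[simp] theorem timeAxis_zero : timeAxis 0 = 1 := by simp [timeAxis]
@[simp] theorem timeAxis_succ (i : Fin 3) : timeAxis i.succ = 0 := by simp [timeAxis]
@[simp] theorem spaceL_zero (p : R3) : spaceL p 0 = 0 := rfl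
@[simp] theorem spaceL_succ (p : R3) (i : Fin 3) : spaceL p i.succ = p i := rfl
@[simp] theorem spacePart_apply (x : R4) (i : Fin 3) : spacePart x i = x i.succ := rfl

theorem norm_timeAxis : ‖timeAxis‖ = 1 := by simp [timeAxis]

theorem norm_spaceL (p : R3) : ‖spaceL p‖ = ‖p‖ := by
  rw [EuclideanSpace.norm_eq, EuclideanSpace.norm_eq, Fin.sum_univ_succ]
  simp

/-- The wave vector `ε (2π)⁻¹ (E, -p)`, for which `e^{-2πi⟨x, k⟩} = e^{-iε p·x}`. -/
def waveVector (ε E : ℝ) (p : R3) : R4 := (ε * (2 * Real.pi)⁻¹) • (E • timeAxis - spaceL p)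

/-- The linear map that recovers the momentum from the wave vector. -/
def waveBack (ε : ℝ) : R4 →L[ℝ] R3 := (-(ε * (2 * Real.pi))) • spacePart

theorem waveBack_waveVector {ε : ℝ} (hε : ε * ε = 1) (E : ℝ) (p : R3) :
    waveBack ε (waveVector ε E p) = p := by
  ext i
  have hπ := Real.pi_ne_zero
  simp only [waveBack, waveVector, smul_apply, PiLp.smul_apply, spacePart_apply, PiLp.sub_apply,
    timeAxis_succ, spaceL_succ, smul_eq_mul]
  field_simp
  linear_combination (p i) * hε

theorem inner_waveVector (ε E : ℝ) (p : R3) (x : R4) :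
    inner ℝ x (waveVector ε E p) = ε * (2 * Real.pi)⁻¹ * mdot E p x := by
  simp only [waveVector, inner_smul_right, PiLp.inner_apply, Fin.sum_univ_succ (n := 3), mdot]
  simp only [PiLp.sub_apply, PiLp.smul_apply, timeAxis_zero, timeAxis_succ, spaceL_zero,
    spaceL_succ, smul_eq_mul, RCLike.inner_apply, conj_trivial]
  simp only [mul_one, mul_zero, sub_zero, zero_sub, neg_mul, Finset.sum_neg_distrib]
  ring

theorem fourierChar_waveVector (ε E : ℝ) (p : R3) (x : R4) :
    (𝐞 (-inner ℝ x (waveVector ε E p)) : ℂ) =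
      Complex.exp (-(Complex.I * ((ε * mdot E p x : ℝ) : ℂ))) := by
  rw [Real.fourierChar_apply, inner_waveVector]
  congr 1
  have hπ : (Real.pi : ℂ) ≠ 0 := by exact_mod_cast Real.pi_ne_zero
  push_cast
  field_simp

theorem norm_waveVector_le {ε : ℝ} (hε : ε * ε = 1) (E : ℝ) (p : R3) :
    ‖waveVector ε E p‖ ≤ |E| + ‖p‖ := by
  have h1 : |ε| = 1 := by
    rcases mul_self_eq_one_iff.1 hε with h | h <;> simp [h]
  have h2 : (2 * Real.pi)⁻¹ ≤ 1 := inv_le_one_of_one_le₀ (by linarith [Real.pi_gt_three])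
  rw [waveVector, norm_smul, norm_mul, Real.norm_eq_abs, h1, one_mul,
    Real.norm_of_nonneg (by positivity)]
  refine (mul_le_of_le_one_left (norm_nonneg _) h2).trans ((norm_sub_le _ _).trans ?_)
  rw [norm_smul, norm_timeAxis, norm_spaceL, mul_one, Real.norm_eq_abs]

theorem continuous_waveVector (ε : ℝ) {e : R3 → ℝ} (he : Continuous e) :
    Continuous fun p => waveVector ε (e p) p := by
  unfold waveVector
  fun_prop

theorem waveVector_hasTemperateGrowth (ε : ℝ) {e : R3 → ℝ} (he : e.HasTemperateGrowth) :
    (fun p => waveVector ε (e p) p).HasTemperateGrowth := by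
  have h1 : (fun p => e p • timeAxis).HasTemperateGrowth := he.smul (.const _)
  have h2 := h1.sub spaceL.hasTemperateGrowth
  exact (Function.HasTemperateGrowth.const (ε * (2 * Real.pi)⁻¹)).smul h2

/-! ### Kernels with amplitudes of temperate growth -/

/-- The amplitudes grow at most polynomially, so a sufficiently high power of `(1 + |p|)⁻¹` makes
them integrable. -/
theorem isPlaneWave_of_hasTemperateGrowth {κ : Kernel} {amp : Fin 4 → Fin 4 → R3 → ℂ}
    {ε : ℝ} (hε : ε * ε = 1) {e : R3 → ℝ} (he : Continuous e) {C : ℝ} (hC : 0 ≤ C)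
    (heC : ∀ p, |e p| ≤ C * (1 + ‖p‖))
    (hκ : ∀ s p a x, κ s p a x = amp s a p * 𝐞 (-inner ℝ x (waveVector ε (e p) p)))
    (hamp : ∀ s a, (amp s a).HasTemperateGrowth) :
    IsPlaneWave κ amp (fun p => waveVector ε (e p) p) (waveBack ε) where
  eq := hκ
  continuous_mom := continuous_waveVector ε he
  back_mom p := waveBack_waveVector hε _ p
  norm_mom_le := ⟨C + 1, by positivity, fun p => (norm_waveVector_le hε _ p).trans (by
    linarith [heC p, norm_nonneg p])⟩
  measurable_amp s a := (hamp s a).1.continuous.measurable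
  integrable_amp := by
    have h1 (s a : Fin 4) : ∃ (k : ℕ) (C : ℝ), 0 ≤ C ∧ ∀ p, ‖amp s a p‖ ≤ C * (1 + ‖p‖) ^ k := by
      obtain ⟨k, C, hC, h⟩ := (hamp s a).norm_iteratedFDeriv_le_uniform 0
      exact ⟨k, C, hC, fun p => by simpa using h 0 le_rfl p⟩
    choose k D hD h using h1
    refine ⟨(∑ s, ∑ a, k s a) + 4, fun s a => ?_⟩
    have hk : k s a ≤ ∑ s, ∑ a, k s a :=
      (Finset.single_le_sum (f := fun a => k s a) (fun _ _ => Nat.zero_le _)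
        (Finset.mem_univ a)).trans (Finset.single_le_sum (f := fun s => ∑ a, k s a)
        (fun _ _ => Nat.zero_le _) (Finset.mem_univ s))
    have h4 : Integrable fun p : R3 => D s a * (1 + ‖p‖) ^ (-(4 : ℝ)) :=
      (integrable_one_add_norm (by simp; norm_num)).const_mul _
    refine h4.mono' ?_ (Filter.Eventually.of_forall fun p => ?_)
    · have := (hamp s a).1.continuous
      exact (Continuous.mul (Continuous.inv₀ (by fun_prop) fun p => by positivity)
        this.norm).aestronglyMeasurable
    · have h0 : (1 : ℝ) ≤ 1 + ‖p‖ := by linarith [norm_nonneg p]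
      rw [Real.norm_of_nonneg (by positivity), Real.rpow_neg (by positivity), pow_add, mul_inv,
        show ((4 : ℝ)) = ((4 : ℕ) : ℝ) by norm_num, Real.rpow_natCast]
      have h5 : ((1 + ‖p‖) ^ (∑ s, ∑ a, k s a))⁻¹ * ‖amp s a p‖ ≤ D s a := by
        rw [inv_mul_le_iff₀ (by positivity), mul_comm]
        refine (h s a p).trans ?_
        exact mul_le_mul_of_nonneg_left (pow_le_pow_right₀ h0 hk) (hD s a)
      calc _ = ((1 + ‖p‖) ^ (∑ s, ∑ a, k s a))⁻¹ * ‖amp s a p‖ * ((1 + ‖p‖) ^ 4)⁻¹ := by ring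
        _ ≤ _ := by gcongr

/-- If amplitude and wave vector have temperate growth, then `κ(φ)` is obtained from the Fourier
transform of `φ` by a composition and a multiplication in the Schwartz space. -/
theorem IsPlaneWave.memTest_top {κ : Kernel} {amp : Fin 4 → Fin 4 → R3 → ℂ} {mom : R3 → R4}
    {back : R4 →L[ℝ] R3} (h : IsPlaneWave κ amp mom back)
    (hamp : ∀ s a, (amp s a).HasTemperateGrowth) (hmom : mom.HasTemperateGrowth)
    (X : Submodule ℂ 𝓢(R4, ℂ)) : κ.MemTest ⊤ X := by
  have hup : ∃ (k : ℕ) (C : ℝ), ∀ p, ‖p‖ ≤ C * (1 + ‖mom p‖) ^ k := by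
    refine ⟨1, ‖back‖, fun p => ?_⟩
    calc ‖p‖ = ‖back (mom p)‖ := by rw [h.back_mom]
      _ ≤ ‖back‖ * ‖mom p‖ := back.le_opNorm _
      _ ≤ ‖back‖ * (1 + ‖mom p‖) ^ 1 := by gcongr; simp
  let K (s : Fin 4) : Test X →L[ℂ] 𝓢(R3, ℂ) :=
    ∑ a, (SchwartzMap.smulLeftCLM ℂ (amp s a)).comp
      ((SchwartzMap.compCLM ℂ hmom hup).comp ((FourierTransform.fourierCLM ℂ 𝓢(R4, ℂ)).comp
        (X.subtypeL.comp (ContinuousLinearMap.proj a))))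
  refine ⟨ContinuousLinearMap.pi fun s => (K s).codRestrict ⊤ fun _ => trivial,
    fun φ s => Filter.Eventually.of_forall fun p => ?_⟩
  rw [h.smearX_eq]
  change K s φ p = _
  simp only [K, sum_apply, ContinuousLinearMap.comp_apply]
  refine Finset.sum_congr rfl fun a _ => ?_
  rw [SchwartzMap.smulLeftCLM_apply_apply (hamp s a)]
  rfl

/-! ### The Dirac field -/

section Dirac

variable {m : ℝ}

theorem hasTemperateGrowth_coe {V : Type} [NormedAddCommGroup V] [NormedSpace ℝ V] {f : V → ℝ}
    (hf : f.HasTemperateGrowth) : (fun x => (f x : ℂ)).HasTemperateGrowth :=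
  Complex.ofRealCLM.hasTemperateGrowth.comp hf

theorem one_add_norm_sq_div_hasTemperateGrowth (m r : ℝ) :
    (fun p : R3 => (1 + ‖(m⁻¹ : ℝ) • p‖ ^ 2) ^ r).HasTemperateGrowth :=
  (Function.hasTemperateGrowth_one_add_norm_sq_rpow R3 r).comp
    ((Function.HasTemperateGrowth.const (m⁻¹ : ℝ)).smul Function.HasTemperateGrowth.id')

theorem one_add_norm_sq_div (hm : 0 < m) (p : R3) :
    1 + ‖(m⁻¹ : ℝ) • p‖ ^ 2 = (energy m p / m) ^ 2 := by
  rw [energy, div_pow, Real.sq_sqrt (by positivity), norm_smul, norm_inv, Real.norm_of_nonneg hm.le]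
  field_simp
  ring

theorem energy_pos (hm : 0 < m) (p : R3) : 0 < energy m p := Real.sqrt_pos.2 (by positivity)

theorem energy_le (hm : 0 < m) (p : R3) : energy m p ≤ ‖p‖ + m :=
  Real.sqrt_le_iff.2 ⟨by positivity, by nlinarith [norm_nonneg p]⟩

theorem energy_rpow (hm : 0 < m) (r : ℝ) (p : R3) :
    (1 + ‖(m⁻¹ : ℝ) • p‖ ^ 2) ^ (r / 2) = (energy m p / m) ^ r := by
  have := energy_pos hm p
  rw [one_add_norm_sq_div hm, ← Real.rpow_natCast, ← Real.rpow_mul (by positivity)]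
  congr 1
  push_cast
  ring

theorem energy_hasTemperateGrowth (hm : 0 < m) : (energy m).HasTemperateGrowth := by
  have h := (Function.HasTemperateGrowth.const m).mul
    (one_add_norm_sq_div_hasTemperateGrowth m (1 / 2))
  refine (congrArg Function.HasTemperateGrowth (funext fun p => ?_)).mp h
  simp only [Pi.mul_apply]
  rw [energy_rpow hm, Real.rpow_one]
  field_simp

/-- `1 / (E + m) = m⁻¹ (1 + z²)⁻¹` with `z = (E / m) ^ (1 / 2)`. -/
theorem inv_energy_add_hasTemperateGrowth (hm : 0 < m) :
    (fun p => 1 / (energy m p + m)).HasTemperateGrowth := by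
  have h := (Function.HasTemperateGrowth.const m⁻¹).mul
    ((Function.hasTemperateGrowth_one_add_norm_sq_rpow ℝ (-1)).comp
      (one_add_norm_sq_div_hasTemperateGrowth m (1 / 2 / 2)))
  refine (congrArg Function.HasTemperateGrowth (funext fun p => ?_)).mp h
  have he := energy_pos hm p
  simp only [Pi.mul_apply, Function.comp]
  rw [energy_rpow hm, Real.norm_of_nonneg (by positivity), ← Real.rpow_natCast,
    ← Real.rpow_mul (by positivity), Real.rpow_neg (by positivity), Real.rpow_one]
  norm_num
  field_simp
  ring

/-- `√((E + m) / 2E) = 2⁻¹ᐟ² (1 + y²)¹ᐟ²` with `y = (E / m) ^ (-1 / 2)`. -/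
theorem spinorNorm_hasTemperateGrowth (hm : 0 < m) : (spinorNorm m).HasTemperateGrowth := by
  have h := (Function.HasTemperateGrowth.const (1 / 2 : ℝ)).mul
    ((Function.hasTemperateGrowth_one_add_norm_sq_rpow ℝ (1 / 2)).comp
      (one_add_norm_sq_div_hasTemperateGrowth m (-1 / 2 / 2)))
  refine (congrArg Function.HasTemperateGrowth (funext fun p => ?_)).mp (hasTemperateGrowth_coe h)
  have he := energy_pos hm p
  simp only [Pi.mul_apply, Function.comp, spinorNorm]
  congr 1
  rw [energy_rpow hm, Real.norm_of_nonneg (by positivity), ← Real.rpow_natCast,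
    ← Real.rpow_mul (by positivity), ← Real.sqrt_eq_rpow]
  have h1 : (energy m p / m) ^ (-1 / 2 * ((2 : ℕ) : ℝ)) = m / energy m p := by
    norm_num
    rw [Real.rpow_neg (by positivity), Real.rpow_one, inv_div]
  rw [h1, show (1 : ℝ) + m / energy m p = 2 * ((energy m p + m) / (2 * energy m p)) by field_simp,
    Real.sqrt_mul (by norm_num)]
  have h2 : Real.sqrt 2 * Real.sqrt 2 = 2 := Real.mul_self_sqrt (by norm_num)
  field_simp
  linear_combination h2

theorem chiBoost_hasTemperateGrowth (hm : 0 < m) (s i : Fin 2) :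
    (fun p => chiBoost m s p i).HasTemperateGrowth := by
  have hc (j : Fin 3) : (fun p : R3 => (p j : ℂ)).HasTemperateGrowth :=
    hasTemperateGrowth_coe
      (EuclideanSpace.proj j : R3 →L[ℝ] ℝ).hasTemperateGrowth
  have h1 : (fun p => pauli p i s).HasTemperateGrowth := by
    have h (A B D : ℂ) : (fun p : R3 => (p 0 : ℂ) * A + (p 1 : ℂ) * B + (p 2 : ℂ) * D)
        |>.HasTemperateGrowth :=
      (((hc 0).mul (.const A)).add ((hc 1).mul (.const B))).add ((hc 2).mul (.const D))
    exact h _ _ _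
  have h2 := (hasTemperateGrowth_coe (inv_energy_add_hasTemperateGrowth hm)).mul h1
  refine (congrArg Function.HasTemperateGrowth (funext fun p => ?_)).mp h2
  simp [chiBoost, chi]

/-- The amplitude of the kernel `κ₀₁` of the Dirac field. -/
def diracAmp₀₁ (m : ℝ) (s a : Fin 4) (p : R3) : ℂ :=
  (((2 * Real.pi) ^ (-(3 / 2) : ℝ) : ℝ) : ℂ) *
    (![spinorU m 0 p, spinorU m 1 p, 0, 0] : Fin 4 → Fin 4 → ℂ) s a

/-- The amplitude of the kernel `κ₁₀` of the Dirac field. -/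
def diracAmp₁₀ (m : ℝ) (s a : Fin 4) (p : R3) : ℂ :=
  (((2 * Real.pi) ^ (-(3 / 2) : ℝ) : ℝ) : ℂ) *
    (![0, 0, spinorV m 0 p, spinorV m 1 p] : Fin 4 → Fin 4 → ℂ) s a

theorem append_hasTemperateGrowth {u v : R3 → Fin 2 → ℂ}
    (hu : ∀ i, (fun p => u p i).HasTemperateGrowth) (hv : ∀ i, (fun p => v p i).HasTemperateGrowth)
    (a : Fin 4) :
    (fun p => (Fin.append (u p) (v p) : Fin (2 + 2) → ℂ) a).HasTemperateGrowth := by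
  refine Fin.addCases (m := 2) (n := 2) (motive := fun a : Fin (2 + 2) =>
    (fun p => (Fin.append (u p) (v p) : Fin (2 + 2) → ℂ) a).HasTemperateGrowth)
    (fun i => ?_) (fun i => ?_) a
  · simpa using hu i
  · simpa only [Fin.append_right] using hv i

theorem spinorU_hasTemperateGrowth (hm : 0 < m) (s : Fin 2) (a : Fin 4) :
    (fun p => spinorU m s p a).HasTemperateGrowth :=
  (spinorNorm_hasTemperateGrowth hm).mul (append_hasTemperateGrowth
    (u := fun p => chi s + chiBoost m s p) (v := fun p => chi s - chiBoost m s p)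
    (fun i => (Function.HasTemperateGrowth.const (chi s i)).add
      (chiBoost_hasTemperateGrowth hm s i))
    (fun i => (Function.HasTemperateGrowth.const (chi s i)).sub
      (chiBoost_hasTemperateGrowth hm s i))
    a)

theorem spinorV_hasTemperateGrowth (hm : 0 < m) (s : Fin 2) (a : Fin 4) :
    (fun p => spinorV m s p a).HasTemperateGrowth :=
  (spinorNorm_hasTemperateGrowth hm).mul (append_hasTemperateGrowth
    (u := fun p => chi s + chiBoost m s p) (v := fun p => -(chi s - chiBoost m s p))
    (fun i => (Function.HasTemperateGrowth.const (chi s i)).add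
      (chiBoost_hasTemperateGrowth hm s i))
    (fun i => ((Function.HasTemperateGrowth.const (chi s i)).sub
      (chiBoost_hasTemperateGrowth hm s i)).neg) a)

theorem diracAmp₀₁_hasTemperateGrowth (hm : 0 < m) (s a : Fin 4) :
    (diracAmp₀₁ m s a).HasTemperateGrowth := by
  refine (Function.HasTemperateGrowth.const _).mul ?_
  fin_cases s
  exacts [spinorU_hasTemperateGrowth hm 0 a, spinorU_hasTemperateGrowth hm 1 a, .const 0, .const 0]

theorem diracAmp₁₀_hasTemperateGrowth (hm : 0 < m) (s a : Fin 4) :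
    (diracAmp₁₀ m s a).HasTemperateGrowth := by
  refine (Function.HasTemperateGrowth.const _).mul ?_
  fin_cases s
  exacts [.const 0, .const 0, spinorV_hasTemperateGrowth hm 0 a, spinorV_hasTemperateGrowth hm 1 a]

theorem abs_energy_le (hm : 0 < m) (p : R3) : |energy m p| ≤ (1 + m) * (1 + ‖p‖) := by
  rw [abs_of_pos (energy_pos hm p)]
  nlinarith [energy_le hm p, norm_nonneg p, mul_nonneg hm.le (norm_nonneg p)]

theorem isPlaneWave_dirac₀₁ (hm : 0 < m) : IsPlaneWave (dirac₀₁ m) (diracAmp₀₁ m)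
    (fun p => waveVector 1 (energy m p) p) (waveBack 1) :=
  isPlaneWave_of_hasTemperateGrowth (by norm_num) (energy_hasTemperateGrowth hm).1.continuous
    (by positivity) (abs_energy_le hm)
    (fun s p a x => by rw [fourierChar_waveVector, one_mul]; rfl)
    (diracAmp₀₁_hasTemperateGrowth hm)

theorem isPlaneWave_dirac₁₀ (hm : 0 < m) : IsPlaneWave (dirac₁₀ m) (diracAmp₁₀ m)
    (fun p => waveVector (-1) (energy m p) p) (waveBack (-1)) :=
  isPlaneWave_of_hasTemperateGrowth (by norm_num) (energy_hasTemperateGrowth hm).1.continuous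
    (by positivity) (abs_energy_le hm)
    (fun s p a x => by
      rw [fourierChar_waveVector, neg_one_mul, Complex.ofReal_neg, mul_neg, neg_neg]; rfl)
    (diracAmp₁₀_hasTemperateGrowth hm)

theorem dirac₀₁_memTest (hm : 0 < m) (X : Submodule ℂ 𝓢(R4, ℂ)) : (dirac₀₁ m).MemTest ⊤ X :=
  (isPlaneWave_dirac₀₁ hm).memTest_top (diracAmp₀₁_hasTemperateGrowth hm)
    (waveVector_hasTemperateGrowth 1 (energy_hasTemperateGrowth hm)) X

theorem dirac₁₀_memTest (hm : 0 < m) (X : Submodule ℂ 𝓢(R4, ℂ)) : (dirac₁₀ m).MemTest ⊤ X :=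
  (isPlaneWave_dirac₁₀ hm).memTest_top (diracAmp₁₀_hasTemperateGrowth hm)
    (waveVector_hasTemperateGrowth (-1) (energy_hasTemperateGrowth hm)) X

end Dirac

/-! ### Restriction to the light cone -/

section Cone

variable {E V : Type} [NormedAddCommGroup E] [NormedSpace ℝ E] [NormedAddCommGroup V]
  [NormedSpace ℝ V]

/-- The function and all its derivatives vanish at the origin. -/
def FlatAtZero (G : 𝓢(E, V)) : Prop := ∀ n : ℕ, iteratedFDeriv ℝ n G 0 = 0

theorem FlatAtZero.apply_zero {G : 𝓢(E, V)} (hG : FlatAtZero G) : G 0 = 0 := by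
  rw [← norm_eq_zero, ← norm_iteratedFDeriv_zero (𝕜 := ℝ), hG 0, norm_zero]

theorem FlatAtZero.fderivCLM {G : 𝓢(E, V)} (hG : FlatAtZero G) :
    FlatAtZero (SchwartzMap.fderivCLM ℝ E V G) := by
  intro n
  rw [← norm_eq_zero]
  change ‖iteratedFDeriv ℝ n (fderiv ℝ G) 0‖ = 0
  rw [norm_iteratedFDeriv_fderiv, hG, norm_zero]

theorem FlatAtZero.add {G H : 𝓢(R4, V)} (hG : FlatAtZero G) (hH : FlatAtZero H) :
    FlatAtZero (G + H) := by
  intro n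
  have h : ((G + H : 𝓢(R4, V)) : R4 → V) = (G : R4 → V) + H := rfl
  rw [h, iteratedFDeriv_add_apply ((G.smooth n).contDiffAt) ((H.smooth n).contDiffAt), hG n, hH n,
    add_zero]

theorem FlatAtZero.bilinLeftCLM {F V' : Type} [NormedAddCommGroup F] [NormedSpace ℝ F]
    [NormedAddCommGroup V'] [NormedSpace ℝ V'] (B : V →L[ℝ] F →L[ℝ] V') {g : R4 → F}
    (hg : g.HasTemperateGrowth) {G : 𝓢(R4, V)} (hG : FlatAtZero G) :
    FlatAtZero (SchwartzMap.bilinLeftCLM B hg G) := by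
  intro n
  rw [← norm_le_zero_iff, SchwartzMap.bilinLeftCLM_apply]
  refine (B.norm_iteratedFDeriv_le_of_bilinear (G.smooth ⊤) hg.1 0
    (n := n) (by exact_mod_cast le_top)).trans (le_of_eq ?_)
  simp [hG _]

/-- Taylor's estimate for a function all of whose derivatives vanish at the origin. -/
theorem FlatAtZero.norm_apply_le (N : ℕ) : ∀ {V : Type} [NormedAddCommGroup V] [NormedSpace ℝ V]
    {G : 𝓢(E, V)}, FlatAtZero G → ∀ y, ‖G y‖ ≤ ‖y‖ ^ N * SchwartzMap.seminorm ℝ 0 N G := by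
  induction N with
  | zero =>
    intro V _ _ G _ y
    simpa using SchwartzMap.norm_le_seminorm ℝ G y
  | succ N ih =>
    intro V _ _ G hG y
    have hs : SchwartzMap.seminorm ℝ 0 N (SchwartzMap.fderivCLM ℝ E V G) ≤
        SchwartzMap.seminorm ℝ 0 (N + 1) G := by
      refine SchwartzMap.seminorm_le_bound ℝ 0 N _ (apply_nonneg _ _) fun x => ?_
      have h := SchwartzMap.le_seminorm ℝ 0 (N + 1) G x
      rwa [← norm_iteratedFDeriv_fderiv] at h
    have h := (convex_closedBall (0 : E) ‖y‖).norm_image_sub_le_of_norm_fderiv_le (𝕜 := ℝ)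
      (f := G) (C := ‖y‖ ^ N * SchwartzMap.seminorm ℝ 0 (N + 1) G) (x := 0) (y := y)
      (fun x _ => G.differentiableAt) (fun x hx => ?_) (by simp) (by simp)
    · rw [hG.apply_zero, sub_zero, sub_zero] at h
      rw [pow_succ]
      linarith
    · refine (ih hG.fderivCLM x).trans ?_
      rw [mem_closedBall_zero_iff] at hx
      gcongr

/-- The wave vector of a massless particle. -/
def lightVector (ε : ℝ) (p : R3) : R4 := waveVector ε ‖p‖ p

theorem continuous_lightVector (ε : ℝ) : Continuous (lightVector ε) :=
  continuous_waveVector ε continuous_norm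

theorem lightVector_zero (ε : ℝ) : lightVector ε 0 = 0 := by simp [lightVector, waveVector]

theorem norm_lightVector_le {ε : ℝ} (hε : ε * ε = 1) (p : R3) : ‖lightVector ε p‖ ≤ 2 * ‖p‖ := by
  refine (norm_waveVector_le hε _ p).trans (le_of_eq ?_)
  rw [abs_of_nonneg (norm_nonneg p)]
  ring

/-- The quadratic map with `D(lightVector)(p) = |p|⁻² coneQuad (lightVector p)` for `p ≠ 0`. -/
def coneQuad (ε : ℝ) (y : R4) : R3 →L[ℝ] R4 :=
  (ε * (2 * Real.pi)⁻¹) • ((ε * (2 * Real.pi) * y 0) •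
    (innerSL ℝ (waveBack ε y)).smulRight timeAxis - ‖waveBack ε y‖ ^ 2 • spaceL)

theorem coneQuad_hasTemperateGrowth (ε : ℝ) : (coneQuad ε).HasTemperateGrowth := by
  have h1 : (fun y : R4 => ε * (2 * Real.pi) * y 0).HasTemperateGrowth :=
    (Function.HasTemperateGrowth.const _).mul
      (EuclideanSpace.proj 0 : R4 →L[ℝ] ℝ).hasTemperateGrowth
  have h2 : (fun y : R4 => (innerSL ℝ (waveBack ε y)).smulRight timeAxis).HasTemperateGrowth :=
    (((ContinuousLinearMap.smulRightL ℝ R3 R4).flip timeAxis).comp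
      ((innerSL ℝ).comp (waveBack ε))).hasTemperateGrowth
  have h3 : (fun y : R4 => ‖waveBack ε y‖ ^ 2).HasTemperateGrowth :=
    (Function.hasTemperateGrowth_norm_sq R3).comp (waveBack ε).hasTemperateGrowth
  exact (Function.HasTemperateGrowth.const (ε * (2 * Real.pi)⁻¹)).smul
    ((h1.smul h2).sub (h3.smul (.const _)))

theorem hasFDerivAt_norm_rpow_of_ne_zero {p : R3} (hp : p ≠ 0) (r : ℝ) :
    HasFDerivAt (fun p : R3 => ‖p‖ ^ r) ((r * ‖p‖ ^ (r - 2)) • innerSL ℝ p) p := by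
  have hp' : 0 < ‖p‖ := norm_pos_iff.2 hp
  have h := ((hasStrictFDerivAt_norm_sq p).hasFDerivAt).rpow_const (p := r / 2)
    (Or.inl (by positivity))
  have h1 (q : R3) : (‖q‖ ^ 2) ^ (r / 2) = ‖q‖ ^ r := by
    rw [← Real.rpow_natCast, ← Real.rpow_mul (norm_nonneg q)]
    congr 1
    push_cast
    ring
  have h2 : (‖p‖ ^ 2) ^ (r / 2 - 1) = ‖p‖ ^ (r - 2) := by
    rw [← Real.rpow_natCast, ← Real.rpow_mul (norm_nonneg p)]
    congr 1
    push_cast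
    ring
  simp only [h1, h2] at h
  refine h.congr_fderiv ?_
  rw [smul_comm, ← Nat.cast_smul_eq_nsmul ℝ, smul_smul]
  congr 1
  push_cast
  ring

theorem hasFDerivAt_lightVector {ε : ℝ} (hε : ε * ε = 1) {p : R3} (hp : p ≠ 0) :
    HasFDerivAt (lightVector ε) ((‖p‖ ^ (-2 : ℝ)) • coneQuad ε (lightVector ε p)) p := by
  have hp' : 0 < ‖p‖ := norm_pos_iff.2 hp
  have h1 := hasFDerivAt_norm_rpow_of_ne_zero hp 1
  simp only [Real.rpow_one] at h1
  have h2 := ((h1.smul_const timeAxis).sub spaceL.hasFDerivAt).const_smul (ε * (2 * Real.pi)⁻¹)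
  refine h2.congr_fderiv ?_
  have h3 : ε * (2 * Real.pi) * (lightVector ε p) 0 = ‖p‖ := by
    have hπ := Real.pi_ne_zero
    simp only [lightVector, waveVector, PiLp.smul_apply, PiLp.sub_apply, timeAxis_zero,
      spaceL_zero, smul_eq_mul]
    field_simp
    linear_combination ‖p‖ * hε
  have h4 : waveBack ε (lightVector ε p) = p := waveBack_waveVector hε _ p
  have h5 : ‖p‖ ^ (-2 : ℝ) * ‖p‖ ^ 2 = 1 := by
    rw [← Real.rpow_natCast, ← Real.rpow_add hp']
    norm_num
  have h6 : ‖p‖ ^ (1 - 2 : ℝ) = ‖p‖ ^ (-2 : ℝ) * ‖p‖ := by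
    rw [← Real.rpow_add_one hp'.ne']
    norm_num
  rw [coneQuad, h3, h4, smul_comm _ (ε * (2 * Real.pi)⁻¹), smul_sub, smul_sub, smul_sub,
    smul_smul _ (‖p‖ ^ 2), h5, one_smul, h6, smul_smul (‖p‖ ^ (-2 : ℝ)) ‖p‖, one_mul]
  congr 2
  ext v
  simp [mul_assoc]

/-- The function `p ↦ |p|^r G(k(p))`, where `k(p)` is the wave vector of a massless particle. -/
def cone (r ε : ℝ) (G : 𝓢(R4, V)) (p : R3) : V := ‖p‖ ^ r • G (lightVector ε p)

/-- The operation on `G` for which the derivative of `cone r ε G` is `cone (r - 2) ε` of it. The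
factors `p` and `|p|` that appear in the derivative are linear functions of the wave vector. -/
def coneDeriv (r ε : ℝ) : 𝓢(R4, V) →L[ℝ] 𝓢(R4, R3 →L[ℝ] V) :=
  SchwartzMap.bilinLeftCLM ((ContinuousLinearMap.smulRightL ℝ R3 V).flip)
      (r • (innerSL ℝ).comp (waveBack ε)).hasTemperateGrowth +
    (SchwartzMap.bilinLeftCLM (ContinuousLinearMap.compL ℝ R3 R4 V)
      (coneQuad_hasTemperateGrowth ε)).comp (SchwartzMap.fderivCLM ℝ R4 V)

theorem coneDeriv_apply (r ε : ℝ) (G : 𝓢(R4, V)) (y : R4) :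
    coneDeriv r ε G y = (r • innerSL ℝ (waveBack ε y)).smulRight (G y) +
      (fderiv ℝ G y).comp (coneQuad ε y) := rfl

theorem flatAtZero_coneDeriv {G : 𝓢(R4, V)} (hG : FlatAtZero G) (r ε : ℝ) :
    FlatAtZero (coneDeriv r ε G) :=
  (hG.bilinLeftCLM _ _).add (hG.fderivCLM.bilinLeftCLM _ (coneQuad_hasTemperateGrowth ε))

theorem hasFDerivAt_cone {ε : ℝ} (hε : ε * ε = 1) {p : R3} (hp : p ≠ 0) (r : ℝ) (G : 𝓢(R4, V)) :
    HasFDerivAt (cone r ε G) (cone (r - 2) ε (coneDeriv r ε G) p) p := by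
  have hp' : 0 < ‖p‖ := norm_pos_iff.2 hp
  have h := (hasFDerivAt_norm_rpow_of_ne_zero hp r).smul
    (((G.differentiableAt).hasFDerivAt).comp p (hasFDerivAt_lightVector hε hp))
  refine h.congr_fderiv ?_
  have h4 : waveBack ε (lightVector ε p) = p := waveBack_waveVector hε _ p
  rw [cone, coneDeriv_apply, h4]
  ext v
  simp only [add_apply, smul_apply, ContinuousLinearMap.smulRight_apply,
    ContinuousLinearMap.comp_apply, smul_add, map_smul, smul_smul, Function.comp, smul_eq_mul]
  rw [← Real.rpow_add hp', sub_eq_add_neg r 2, add_comm]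
  congr 2
  ring

/-- Since `G` vanishes to infinite order at the origin and decreases rapidly, `|p|^ρ |G(k(p))|` is
bounded for all real `ρ`. -/
theorem norm_rpow_mul_le {ε : ℝ} (hε : ε * ε = 1) (ρ : ℝ) : ∃ (C : ℝ) (N : ℕ), 0 ≤ C ∧
    ∀ (G : 𝓢(R4, V)), FlatAtZero G → ∀ p : R3, ‖p‖ ^ ρ * ‖G (lightVector ε p)‖ ≤
      C * (Finset.Iic (N, N)).sup (schwartzSeminormFamily ℝ R4 V) G := by
  set N := ⌈|ρ|⌉₊
  have hN : |ρ| ≤ N := Nat.le_ceil _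
  refine ⟨2 ^ N + ‖waveBack ε‖ ^ N, N, by positivity, fun G hG p => ?_⟩
  set S := (Finset.Iic (N, N)).sup (schwartzSeminormFamily ℝ R4 V) G
  have hS : 0 ≤ S := apply_nonneg _ _
  have hS1 : SchwartzMap.seminorm ℝ 0 N G ≤ S :=
    Seminorm.le_finset_sup_apply (p := schwartzSeminormFamily ℝ R4 V) (i := (0, N))
      (Finset.mem_Iic.2 ⟨Nat.zero_le _, le_rfl⟩)
  have hS2 : SchwartzMap.seminorm ℝ N 0 G ≤ S :=
    Seminorm.le_finset_sup_apply (p := schwartzSeminormFamily ℝ R4 V) (i := (N, 0))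
      (Finset.mem_Iic.2 ⟨le_rfl, Nat.zero_le _⟩)
  rcases eq_or_ne p 0 with rfl | hp
  · rw [lightVector_zero, hG.apply_zero, norm_zero (E := V), mul_zero]
    positivity
  have hp' : 0 < ‖p‖ := norm_pos_iff.2 hp
  -- Near the origin the Taylor estimate compensates the negative powers, away from it the rapid
  -- decrease compensates the positive ones.
  rcases le_total ‖p‖ 1 with h1 | h1
  · have h2 : ‖p‖ ^ ρ ≤ (‖p‖ ^ N)⁻¹ := by
      rw [← Real.rpow_natCast, ← Real.rpow_neg hp'.le]
      exact Real.rpow_le_rpow_of_exponent_ge hp' h1 (by linarith [neg_abs_le ρ])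
    have h3 : ‖G (lightVector ε p)‖ ≤ (2 * ‖p‖) ^ N * S := by
      refine (hG.norm_apply_le N _).trans ?_
      gcongr
      exact norm_lightVector_le hε p
    calc ‖p‖ ^ ρ * ‖G (lightVector ε p)‖ ≤ (‖p‖ ^ N)⁻¹ * ((2 * ‖p‖) ^ N * S) := by gcongr
      _ = 2 ^ N * S := by
        rw [mul_pow]
        field_simp
      _ ≤ _ := by
        gcongr
        linarith [pow_nonneg (norm_nonneg (waveBack ε)) N]
  · have h2 : ‖p‖ ^ ρ ≤ ‖p‖ ^ N := by
      rw [← Real.rpow_natCast]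
      exact Real.rpow_le_rpow_of_exponent_le h1 (by linarith [le_abs_self ρ])
    have h3 : ‖p‖ ≤ ‖waveBack ε‖ * ‖lightVector ε p‖ := by
      conv_lhs => rw [← waveBack_waveVector hε ‖p‖ p]
      exact (waveBack ε).le_opNorm _
    have h4 : ‖lightVector ε p‖ ^ N * ‖G (lightVector ε p)‖ ≤ S :=
      (SchwartzMap.norm_pow_mul_le_seminorm ℝ G N _).trans hS2
    calc ‖p‖ ^ ρ * ‖G (lightVector ε p)‖
        ≤ (‖waveBack ε‖ * ‖lightVector ε p‖) ^ N * ‖G (lightVector ε p)‖ := by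
          gcongr
          exact h2.trans (pow_le_pow_left₀ hp'.le h3 N)
      _ = ‖waveBack ε‖ ^ N * (‖lightVector ε p‖ ^ N * ‖G (lightVector ε p)‖) := by ring
      _ ≤ ‖waveBack ε‖ ^ N * S := by gcongr
      _ ≤ _ := by
        gcongr
        linarith [pow_nonneg (zero_le_two (α := ℝ)) N]

theorem FlatAtZero.cone_zero {G : 𝓢(R4, V)} (hG : FlatAtZero G) (r ε : ℝ) : cone r ε G 0 = 0 := by
  rw [cone, lightVector_zero, hG.apply_zero, smul_zero]

/-- Unlike `hasFDerivAt_cone`, this includes the origin, where the light cone is not smooth. -/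
theorem FlatAtZero.hasFDerivAt_cone {ε : ℝ} (hε : ε * ε = 1) {G : 𝓢(R4, V)} (hG : FlatAtZero G)
    (r : ℝ) (p : R3) : HasFDerivAt (cone r ε G) (cone (r - 2) ε (coneDeriv r ε G) p) p := by
  -- At the apex of the cone `cone r ε G` is `O(|p|²)`, so that its derivative vanishes, as does
  -- the right-hand side.
  rcases eq_or_ne p 0 with rfl | hp
  · rw [(flatAtZero_coneDeriv hG r ε).cone_zero]
    refine Asymptotics.IsBigO.hasFDerivAt (n := 2) ?_ one_lt_two
    obtain ⟨C, N, -, hC⟩ := norm_rpow_mul_le (V := V) hε (r - 2)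
    refine Asymptotics.IsBigO.of_bound
      (C * (Finset.Iic (N, N)).sup (schwartzSeminormFamily ℝ R4 V) G)
      (Filter.Eventually.of_forall fun p => ?_)
    rcases eq_or_ne p 0 with rfl | hp
    · rw [hG.cone_zero]
      simp
    have hp' : 0 < ‖p‖ := norm_pos_iff.2 hp
    have h1 : ‖p‖ ^ r = ‖p‖ ^ 2 * ‖p‖ ^ (r - 2) := by
      rw [← Real.rpow_natCast, ← Real.rpow_add hp']
      norm_num
    rw [cone, norm_smul, Real.norm_of_nonneg (by positivity), h1, sub_zero,
      Real.norm_of_nonneg (by positivity), mul_assoc, mul_comm]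
    exact mul_le_mul_of_nonneg_right (hC G hG p) (by positivity)
  · exact FreeField.hasFDerivAt_cone hε hp r G

theorem FlatAtZero.fderiv_cone {ε : ℝ} (hε : ε * ε = 1) {G : 𝓢(R4, V)} (hG : FlatAtZero G)
    (r : ℝ) : fderiv ℝ (cone r ε G) = cone (r - 2) ε (coneDeriv r ε G) :=
  funext fun p => (hG.hasFDerivAt_cone hε r p).fderiv

theorem FlatAtZero.contDiff_cone {ε : ℝ} (hε : ε * ε = 1) (n : ℕ) : ∀ {V : Type}
    [NormedAddCommGroup V] [NormedSpace ℝ V] {G : 𝓢(R4, V)}, FlatAtZero G → ∀ r : ℝ,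
      ContDiff ℝ n (cone r ε G) := by
  induction n with
  | zero =>
    intro V _ _ G hG r
    exact contDiff_zero.2 (continuous_iff_continuousAt.2 fun p =>
      (hG.hasFDerivAt_cone hε r p).continuousAt)
  | succ n ih =>
    intro V _ _ G hG r
    push_cast
    rw [contDiff_succ_iff_fderiv]
    refine ⟨fun p => (hG.hasFDerivAt_cone hε r p).differentiableAt, by simp, ?_⟩
    rw [hG.fderiv_cone hε]
    exact ih (flatAtZero_coneDeriv hG r ε) _

theorem FlatAtZero.iteratedFDeriv_cone_zero {ε : ℝ} (hε : ε * ε = 1) (n : ℕ) : ∀ {V : Type}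
    [NormedAddCommGroup V] [NormedSpace ℝ V] {G : 𝓢(R4, V)}, FlatAtZero G → ∀ r : ℝ,
      iteratedFDeriv ℝ n (cone r ε G) 0 = 0 := by
  induction n with
  | zero =>
    intro V _ _ G hG r
    rw [← norm_eq_zero, norm_iteratedFDeriv_zero, hG.cone_zero, norm_zero]
  | succ n ih =>
    intro V _ _ G hG r
    rw [← norm_eq_zero, ← norm_iteratedFDeriv_fderiv, hG.fderiv_cone hε, ih (flatAtZero_coneDeriv hG r ε),
      norm_zero]

/-- The Schwartz seminorms of `cone r ε G` are controlled by those of `G`: each derivative replaces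
`G` by `coneDeriv r ε G` and lowers `r` by `2`, which is harmless as `G` vanishes to infinite
order. -/
theorem FlatAtZero.norm_iteratedFDeriv_cone_le {ε : ℝ} (hε : ε * ε = 1) (k n : ℕ) :
    ∀ {V : Type} [NormedAddCommGroup V] [NormedSpace ℝ V] (r : ℝ),
      ∃ (s : Finset (ℕ × ℕ)) (C : ℝ), 0 ≤ C ∧ ∀ G : 𝓢(R4, V), FlatAtZero G → ∀ p,
        ‖p‖ ^ k * ‖iteratedFDeriv ℝ n (cone r ε G) p‖ ≤
          C * s.sup (schwartzSeminormFamily ℝ R4 V) G := by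
  induction n with
  | zero =>
    intro V _ _ r
    obtain ⟨C, N, hC0, hC⟩ := norm_rpow_mul_le (V := V) hε (k + r)
    refine ⟨Finset.Iic (N, N), C, hC0, fun G hG p => ?_⟩
    rw [norm_iteratedFDeriv_zero]
    rcases eq_or_ne p 0 with rfl | hp
    · rw [hG.cone_zero, norm_zero (E := V), mul_zero]
      exact mul_nonneg hC0 (apply_nonneg _ _)
    · have hp' : 0 < ‖p‖ := norm_pos_iff.2 hp
      refine le_trans (le_of_eq ?_) (hC G hG p)
      rw [cone, norm_smul, Real.norm_of_nonneg (by positivity), Real.rpow_add hp',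
        Real.rpow_natCast, mul_assoc]
  | succ n ih =>
    intro V _ _ r
    obtain ⟨s, C, hC0, hC⟩ := ih (V := R3 →L[ℝ] V) (r - 2)
    obtain ⟨s', C', -, hC'⟩ := Seminorm.bound_of_continuous (schwartz_withSeminorms ℝ R4 V)
      ((s.sup (schwartzSeminormFamily ℝ R4 (R3 →L[ℝ] V))).comp
        (coneDeriv (V := V) r ε).toLinearMap)
      ((Seminorm.continuous_finsetSup fun i _ =>
        (schwartz_withSeminorms ℝ R4 (R3 →L[ℝ] V)).continuous_seminorm i).comp
          (coneDeriv (V := V) r ε).continuous)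
    refine ⟨s', C * C', by positivity, fun G hG p => ?_⟩
    rw [← norm_iteratedFDeriv_fderiv, hG.fderiv_cone hε, mul_assoc]
    refine (hC _ (flatAtZero_coneDeriv hG r ε) p).trans (mul_le_mul_of_nonneg_left ?_ hC0)
    exact hC' G

/-- The map `G ↦ |p|^r G(k(p))` from `S⁰(ℝ⁴)` to `S⁰(ℝ³)`. -/
def coneFlat (r : ℝ) {ε : ℝ} (hε : ε * ε = 1) : flat R4 →ₗ[ℂ] flat R3 where
  toFun G := ⟨⟨cone r ε G.1, contDiff_infty.2 fun n => FlatAtZero.contDiff_cone hε n G.2 r,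
    fun k n => by
      obtain ⟨s, C, -, hC⟩ := FlatAtZero.norm_iteratedFDeriv_cone_le hε k n (V := ℂ) r
      exact ⟨_, hC G.1 G.2⟩⟩, fun n => FlatAtZero.iteratedFDeriv_cone_zero hε n G.2 r⟩
  map_add' G H := by
    refine Subtype.ext (SchwartzMap.ext fun p => ?_)
    exact smul_add _ _ _
  map_smul' c G := by
    refine Subtype.ext (SchwartzMap.ext fun p => ?_)
    exact smul_comm (‖p‖ ^ r) c ((G : 𝓢(R4, ℂ)) (lightVector ε p))

theorem continuous_coneFlat (r : ℝ) {ε : ℝ} (hε : ε * ε = 1) : Continuous (coneFlat r hε) := by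
  rw [continuous_induced_rng]
  have hR4 : WithSeminorms fun i => (schwartzSeminormFamily ℂ R4 ℂ i).comp (flat R4).subtype :=
    LinearMap.withSeminorms_induced (schwartz_withSeminorms ℂ R4 ℂ) (flat R4).subtype
  refine hR4.continuous_of_isBounded (schwartz_withSeminorms ℂ R3 ℂ)
    ((flat R3).subtype.comp (coneFlat r hε)) (Seminorm.IsBounded.of_real fun i => ?_)
  obtain ⟨s, C, hC0, hC⟩ := FlatAtZero.norm_iteratedFDeriv_cone_le hε i.1 i.2 (V := ℂ) r
  refine ⟨s, C, fun G => ?_⟩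
  refine SchwartzMap.seminorm_le_bound ℂ i.1 i.2 _ (mul_nonneg hC0 (apply_nonneg _ _)) fun p => ?_
  refine (hC G.1 G.2 p).trans (mul_le_mul_of_nonneg_left ?_ hC0)
  rw [sup_schwartzSeminormFamily_real_eq_complex, Seminorm.finset_sup_apply,
    Seminorm.finset_sup_apply]
  exact le_rfl

end Cone

/-! ### The electromagnetic potential -/

/-- The amplitude of both kernels of the electromagnetic potential. -/
def potentialAmp (ν μ : Fin 4) (p : R3) : ℂ :=
  ((metric ν μ / ((2 * Real.pi) ^ (3 / 2 : ℝ) * Real.sqrt (2 * ‖p‖)) : ℝ) : ℂ)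

/-- The constant factor in the amplitude of the electromagnetic potential. -/
def potentialConst (ν μ : Fin 4) : ℝ :=
  metric ν μ / ((2 * Real.pi) ^ (3 / 2 : ℝ) * Real.sqrt 2)

theorem potentialAmp_eq (ν μ : Fin 4) (p : R3) :
    potentialAmp ν μ p = ((potentialConst ν μ * ‖p‖ ^ (-(1 / 2) : ℝ) : ℝ) : ℂ) := by
  rw [potentialAmp, potentialConst, Real.sqrt_mul (by norm_num), Real.rpow_neg (norm_nonneg p),
    ← Real.sqrt_eq_rpow, ← mul_assoc, ← div_div, ← div_eq_mul_inv]

/-- The singularity of the amplitude at the origin is integrable in three dimensions. -/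
theorem integrable_rpow_neg_half : Integrable fun p : R3 =>
    ((1 + ‖p‖) ^ 4)⁻¹ * ‖p‖ ^ (-(1 / 2) : ℝ) := by
  refine (integrable_fun_norm_addHaar (volume : Measure R3)
    (f := fun y : ℝ => ((1 + y) ^ 4)⁻¹ * y ^ (-(1 / 2) : ℝ))).2 ?_
  have h2 : IntegrableOn (fun y : ℝ => (1 + ‖y‖) ^ (-(2 : ℝ))) (Set.Ioi 0) :=
    (integrable_one_add_norm (by simp)).integrableOn
  refine h2.mono' (by fun_prop) ?_
  filter_upwards [ae_restrict_mem measurableSet_Ioi] with y hy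
  have hy : 0 < y := hy
  have hd : Module.finrank ℝ R3 - 1 = 2 := by simp
  rw [hd, smul_eq_mul, Real.norm_of_nonneg (by positivity), Real.norm_of_nonneg hy.le]
  have h3 : y ^ 2 * y ^ (-(1 / 2) : ℝ) ≤ (1 + y) ^ 2 := by
    rw [← Real.rpow_natCast, ← Real.rpow_add hy, ← Real.rpow_natCast]
    norm_num
    calc y ^ (3 / 2 : ℝ) ≤ (1 + y) ^ (3 / 2 : ℝ) :=
          Real.rpow_le_rpow hy.le (by linarith) (by norm_num)
      _ ≤ (1 + y) ^ (2 : ℝ) := Real.rpow_le_rpow_of_exponent_le (by linarith) (by norm_num)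
      _ = (1 + y) ^ 2 := by norm_num
  rw [Real.rpow_neg (x := 1 + y) (by positivity), Real.rpow_two]
  calc y ^ 2 * (((1 + y) ^ 4)⁻¹ * y ^ (-(1 / 2) : ℝ))
      = ((1 + y) ^ 4)⁻¹ * (y ^ 2 * y ^ (-(1 / 2) : ℝ)) := by ring
    _ ≤ ((1 + y) ^ 4)⁻¹ * (1 + y) ^ 2 := by gcongr
    _ = _ := by field_simp

theorem isPlaneWave_potential {κ : Kernel} {ε : ℝ} (hε : ε * ε = 1)
    (hκ : ∀ ν p μ x, κ ν p μ x = potentialAmp ν μ p * 𝐞 (-inner ℝ x (lightVector ε p))) :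
    IsPlaneWave κ potentialAmp (lightVector ε) (waveBack ε) where
  eq := hκ
  continuous_mom := continuous_lightVector ε
  back_mom p := waveBack_waveVector hε _ p
  norm_mom_le := ⟨2, by norm_num, fun p => (norm_lightVector_le hε p).trans (by
    linarith [norm_nonneg p])⟩
  measurable_amp ν μ := by
    unfold potentialAmp
    fun_prop
  integrable_amp := by
    refine ⟨4, fun ν μ => (integrable_rpow_neg_half.const_mul |potentialConst ν μ|).congr
      (Filter.Eventually.of_forall fun p => ?_)⟩
    simp only [potentialAmp_eq, Complex.norm_real, norm_mul, Real.norm_eq_abs]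
    rw [abs_of_nonneg (Real.rpow_nonneg (norm_nonneg p) _)]
    ring

theorem isPlaneWave_potential₀₁ :
    IsPlaneWave potential₀₁ potentialAmp (lightVector 1) (waveBack 1) :=
  isPlaneWave_potential (by norm_num) fun ν p μ x => by
    rw [lightVector, fourierChar_waveVector, one_mul]; rfl

theorem isPlaneWave_potential₁₀ :
    IsPlaneWave potential₁₀ potentialAmp (lightVector (-1)) (waveBack (-1)) :=
  isPlaneWave_potential (by norm_num) fun ν p μ x => by
    rw [lightVector, fourierChar_waveVector, neg_one_mul, Complex.ofReal_neg, mul_neg, neg_neg]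
    rfl

/-- If the Fourier transforms of the test functions are flat at the origin, then `κ(φ)` is, up to
constants, the image of the Fourier transform of `φ` under `coneFlat (-1/2)`. -/
theorem memTest_potential {κ : Kernel} {ε : ℝ} (hε : ε * ε = 1)
    (h : IsPlaneWave κ potentialAmp (lightVector ε) (waveBack ε)) {W : Submodule ℂ 𝓢(R3, ℂ)}
    {X : Submodule ℂ 𝓢(R4, ℂ)} (hW : flat R3 ≤ W) (hX : X ≤ flatFourier) : κ.MemTest W X := by
  let F : X →L[ℂ] flat R4 :=
    ((FourierTransform.fourierCLM ℂ 𝓢(R4, ℂ)).comp X.subtypeL).codRestrict (flat R4)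
      fun g => hX g.2
  let L : flat R4 →L[ℂ] W :=
    ((flat R3).subtypeL.comp ⟨coneFlat (-(1 / 2)) hε, continuous_coneFlat _ hε⟩).codRestrict W
      fun G => hW (coneFlat (-(1 / 2)) hε G).2
  let K (ν : Fin 4) : Test X →L[ℂ] W :=
    ∑ μ, (potentialConst ν μ : ℂ) • L.comp (F.comp (ContinuousLinearMap.proj μ))
  refine ⟨ContinuousLinearMap.pi K, fun φ ν => Filter.Eventually.of_forall fun p => ?_⟩
  rw [h.smearX_eq]
  have h1 : ((ContinuousLinearMap.pi K) φ ν : 𝓢(R3, ℂ)) =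
      ∑ μ, (potentialConst ν μ : ℂ) • (L (F (φ μ)) : 𝓢(R3, ℂ)) := by
    simp [K]
  rw [h1, sum_apply]
  refine Finset.sum_congr rfl fun μ _ => ?_
  rw [potentialAmp_eq, smul_apply]
  change (potentialConst ν μ : ℂ) • (‖p‖ ^ (-(1 / 2) : ℝ) •
    (𝓕 (φ μ : 𝓢(R4, ℂ))) (lightVector ε p)) = _
  rw [Complex.real_smul, smul_eq_mul, ← mul_assoc, Complex.ofReal_mul]

section

/-! ### Necessary conditions for the kernels -/

section

variable {W : Submodule ℂ 𝓢(R3, ℂ)} {X : Submodule ℂ 𝓢(R4, ℂ)} {st : Stat}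

/-- The vacuum. -/
def vacuum : Family
  | ⟨0, _⟩ => oneFun
  | ⟨_ + 1, _⟩ => 0

theorem tsum_idx_eq_zero_particle {M : Type} [AddCommMonoid M] [TopologicalSpace M] {g : Idx → M}
    (hg : ∀ n s, g ⟨n + 1, s⟩ = 0) : ∑' i, g i = g ⟨0, Fin.elim0⟩ := by
  refine tsum_eq_single _ fun i hi => ?_
  obtain ⟨n, s⟩ := i
  cases n with
  | zero => exact absurd (by rw [Subsingleton.elim s Fin.elim0]) hi
  | succ n => exact hg n s

theorem vacuum_mem (st : Stat) (W : Submodule ℂ 𝓢(R3, ℂ)) : vacuum ∈ hidaSubmodule st W := by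
  refine ⟨fun i => ?_, fun n σ s p => ?_, fun k => (memℓp_weighted_iff k _).2 ?_⟩
  · obtain ⟨n, s⟩ := i
    cases n with
    | zero =>
      refine Submodule.le_topologicalClosure _ (Submodule.subset_span ⟨Fin.elim0, fun p => ?_⟩)
      exact (oneFun_apply p).trans (by simp)
    | succ n => exact Submodule.zero_mem _
  · cases n with
    | zero =>
      have h : st.factor σ = 1 := by
        rw [Subsingleton.elim σ 1]
        cases st <;> simp [Stat.factor]
      rw [h, one_mul]
      rfl
    | succ n => exact (mul_zero _).symm
  · rw [hidaSq, tsum_idx_eq_zero_particle]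
    · exact ENNReal.mul_lt_top (by simp) (sqNorm_lt_top _)
    · intro n s
      have : vacuum ⟨n + 1, s⟩ = 0 := rfl
      rw [this, map_zero]
      simp [sqNorm]

theorem integral_fin_zero (f : (Fin 0 → R3) → ℂ) : ∫ q, f q = f Fin.elim0 := by
  rw [integral_unique]
  simp [Measure.real, volume_pi]
  congr

theorem integral_fin_one (f : (Fin 1 → R3) → ℂ) : ∫ P, f P = ∫ p, f fun _ => p :=
  ((volume_preserving_funUnique (Fin 1) R3).symm.integral_comp' f).symm

/-- The matrix element of a Hida vector with a one-particle vector. -/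
theorem pairing_oneParticle {G : Family} (hG : G ∈ hidaSubmodule st W) (ξ : Fin 4 → 𝓢(R3, ℂ)) :
    pairing G.fn (symFamily st (tensorFamily ξ vacuum)).fn =
      ∑ a, ∫ p, ξ a p * G ⟨1, fun _ => a⟩ fun _ => p := by
  have hv (k) : hidaSq k vacuum < ⊤ := (memℓp_weighted_iff k _).1 ((vacuum_mem st W).2.2 k)
  have hG0 : hidaSq 0 G < ⊤ := (memℓp_weighted_iff 0 _).1 (hG.2.2 0)
  rw [pairing_comm, pairing_symFamily hG.2.1 (hidaSq_tensorFamily_lt_top ξ (hv 1)) hG0,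
    pairing_tensorFamily hG0 (hv 1)]
  refine Finset.sum_congr rfl fun a _ => ?_
  rw [tsum_idx_eq_zero_particle]
  · have h : (Fin.cons a Fin.elim0 : Fin 1 → Fin 4) = fun _ => a := by
      funext i
      rw [Subsingleton.elim (α := Fin 1) i 0]
      rfl
    change ((0 + 1).factorial : ℂ) * ∫ P : Fin 1 → R3,
      tensor (ξ a) oneFun P * G ⟨1, Fin.cons a Fin.elim0⟩ P = _
    rw [h, integral_fin_one]
    simp only [zero_add, Nat.factorial_one, Nat.cast_one, one_mul, tensor_apply, oneFun_apply,
      mul_one]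
  · intro n s
    have h : tensor (ξ a) (vacuum ⟨n + 1, s⟩) = 0 := map_zero _
    simp [h]

theorem oneParticle_apply (ξ : Fin 4 → 𝓢(R3, ℂ)) (s : Fin 4) (p : R3)
    (t : Fin 0 → Fin 4) (q : Fin 0 → R3) :
    symFamily st (tensorFamily ξ vacuum) ⟨1, Fin.cons s t⟩ (Fin.cons p q) = ξ s p := by
  rw [symFamily_apply]
  have h (σ : Equiv.Perm (Fin 1)) : st.factor σ * tensorFamily ξ vacuum ⟨1, Fin.cons s t ∘ σ⟩
      (Fin.cons p q ∘ σ) = ξ s p := by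
    rw [Subsingleton.elim σ 1]
    have h1 : st.factor (1 : Equiv.Perm (Fin 1)) = 1 := by cases st <;> simp [Stat.factor]
    rw [h1, one_mul]
    change tensor (ξ s) oneFun (Fin.cons p q) = _
    rw [tensor_apply, oneFun_apply, mul_one]
    rfl
  simp [h]

/-- The matrix elements of a field between the vacuum and a one-particle vector involve only the
creation part. -/
theorem fieldForm_vacuum_oneParticle (κ₀₁ κ₁₀ : Kernel) (φ : Test X) (ξ : Test W) :
    fieldForm κ₀₁ κ₁₀ (st := st) φ ⟨vacuum, vacuum_mem st W⟩ (creationOp st W ξ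
      ⟨vacuum, vacuum_mem st W⟩) = ∑ s, ∫ p, κ₁₀.smearX φ s p * (ξ s : 𝓢(R3, ℂ)) p := by
  unfold fieldForm
  have h1 (s : Fin 4) (p : R3) (Ψ : Hida st W) :
      pairing (annihilate s p (Hida.comp (st := st) (W := W) ⟨vacuum, vacuum_mem st W⟩))
        Ψ.comp = 0 := by
    have h : annihilate s p (Hida.comp (st := st) (W := W) ⟨vacuum, vacuum_mem st W⟩) = 0 := by
      funext i q
      exact mul_zero _
    rw [h, pairing]
    simp
  have h2 (s : Fin 4) (p : R3) :
      pairing (Hida.comp (st := st) (W := W) ⟨vacuum, vacuum_mem st W⟩)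
        (annihilate s p (Hida.comp (creationOp st W ξ ⟨vacuum, vacuum_mem st W⟩))) =
      (ξ s : 𝓢(R3, ℂ)) p := by
    rw [pairing, tsum_idx_eq_zero_particle]
    · rw [integral_fin_zero]
      change ((Nat.factorial 0 : ℕ) : ℂ) * (oneFun Fin.elim0 * ((((0 : ℕ) : ℂ) + 1) *
        symFamily st (tensorFamily (fun a => (ξ a : 𝓢(R3, ℂ))) vacuum) ⟨1, Fin.cons s Fin.elim0⟩
          (Fin.cons p Fin.elim0))) = _
      rw [oneParticle_apply, oneFun_apply]
      simp
    · intro n t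
      have h : Hida.comp (st := st) (W := W) ⟨vacuum, vacuum_mem st W⟩ ⟨n + 1, t⟩ = 0 := rfl
      rw [h]
      simp
  simp_rw [h1, h2]
  simp

theorem integral_mul_single (F : Fin 4 → R3 → ℂ) (s : Fin 4) (η : W) :
    ∑ a, ∫ p, F a p * ((Pi.single s η : Test W) a : 𝓢(R3, ℂ)) p = ∫ p, F s p * η.1 p := by
  rw [Finset.sum_eq_single s]
  · rw [Pi.single_eq_same]
  · intro a _ ha
    rw [Pi.single_eq_of_ne ha]
    simp
  · simp

/-- If the functions in `W` vanish at the origin, then so do the elements of its completed tensor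
powers, as evaluation at a point is continuous. -/
theorem tensorPow_apply_zero (hW : W ≤ flat R3) {n : ℕ} {F : 𝓢(Fin (n + 1) → R3, ℂ)}
    (hF : F ∈ tensorPow W (n + 1)) : F 0 = 0 := by
  let L : 𝓢(Fin (n + 1) → R3, ℂ) →L[ℂ] ℂ :=
    (BoundedContinuousFunction.evalCLM ℂ (0 : Fin (n + 1) → R3)).comp
      (SchwartzMap.toBoundedContinuousFunctionCLM ℂ (Fin (n + 1) → R3) ℂ)
  have h : Submodule.topologicalClosure (Submodule.span ℂ (prodSet W (n + 1))) ≤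
      LinearMap.ker L.toLinearMap := by
    refine Submodule.topologicalClosure_minimal _ (Submodule.span_le.2 ?_) ?_
    · rintro G ⟨w, hw⟩
      change G 0 = 0
      rw [hw]
      refine Finset.prod_eq_zero (Finset.mem_univ 0) ?_
      exact FlatAtZero.apply_zero (hW (w 0).2)
    · exact L.isClosed_ker
  exact h hF

/-- If the field is an operator field, then `κ₁₀(φ)` is dominated, as a functional on test
functions, by a continuous function, which vanishes at the origin if the functions in `W` do:
the one-particle part of the field applied to the vacuum. -/
theorem exists_dominating_of_fieldMem {κ₀₁ κ₁₀ : Kernel} (h : FieldMem st κ₀₁ κ₁₀ W X)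
    (φ : Test X) : ∃ w : R3 → ℝ, Continuous w ∧ (W ≤ flat R3 → w 0 = 0) ∧
      ∀ (s : Fin 4) (η : W), ‖∫ p, κ₁₀.smearX φ s p * η.1 p‖ ≤ ∫ p, w p * ‖η.1 p‖ := by
  obtain ⟨T, hT⟩ := h
  let G : Hida st W := T φ ⟨vacuum, vacuum_mem st W⟩
  let g (a : Fin 4) (p : R3) : ℂ := G.1 ⟨1, fun _ => a⟩ fun _ => p
  have hg (a : Fin 4) : Continuous (g a) :=
    (G.1 ⟨1, fun _ => a⟩).continuous.comp (by fun_prop)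
  refine ⟨fun p => ∑ a, ‖g a p‖, by fun_prop, fun hW => ?_, fun s η => ?_⟩
  · refine Finset.sum_eq_zero fun a _ => norm_eq_zero.2 ?_
    exact tensorPow_apply_zero hW (G.2.1 ⟨1, fun _ => a⟩)
  have h1 := hT φ ⟨vacuum, vacuum_mem st W⟩
    (creationOp st W (Pi.single s η) ⟨vacuum, vacuum_mem st W⟩)
  rw [fieldForm_vacuum_oneParticle, integral_mul_single] at h1
  have h2 : pairing G.comp (Hida.comp (creationOp st W (Pi.single s η)
      ⟨vacuum, vacuum_mem st W⟩)) = ∑ a, ∫ p, ((Pi.single s η : Test W) a : 𝓢(R3, ℂ)) p * g a p :=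
    pairing_oneParticle G.2 _
  simp_rw [mul_comm _ (g _ _)] at h2
  rw [integral_mul_single] at h2
  rw [← h1]
  refine (congrArg norm h2).trans_le ?_
  refine (norm_integral_le_integral_norm _).trans ?_
  have h3 (a : Fin 4) : ∃ C : ℝ, ∀ p, ‖g a p‖ ≤ C :=
    ⟨_, fun p => SchwartzMap.norm_le_seminorm ℝ (G.1 ⟨1, fun _ => a⟩) _⟩
  choose C hC using h3
  have h4 (a : Fin 4) : Integrable fun p => ‖g a p‖ * ‖η.1 p‖ := by
    refine (η.1.integrable (μ := volume)).norm.bdd_mul (c := C a)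
      (hg a).norm.aestronglyMeasurable (Filter.Eventually.of_forall fun p => ?_)
    rw [norm_norm]
    exact hC a p
  refine integral_mono ((h4 s).congr (Filter.Eventually.of_forall fun p => (norm_mul _ _).symm)) ?_
    fun p => ?_
  · simp_rw [Finset.sum_mul]
    exact integrable_finsetSum _ fun a _ => h4 a
  · rw [norm_mul]
    refine mul_le_mul_of_nonneg_right ?_ (norm_nonneg _)
    exact Finset.single_le_sum (f := fun a => ‖g a p‖) (fun a _ => norm_nonneg _)
      (Finset.mem_univ s)

/-- If `κ` extends to `E*`, then `κ(φ)` is dominated, as a functional on test functions, by a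
multiple of `1`, and by a multiple of `|p|` if the functions in `W` vanish at the origin: this
bounds the functions of a bounded subset of `E`. -/
theorem exists_dominating_of_memDual {κ : Kernel} {amp : Fin 4 → Fin 4 → R3 → ℂ} {mom : R3 → R4}
    {back : R4 →L[ℝ] R3} (hκ : IsPlaneWave κ amp mom back) (h : κ.MemDual W X)
    (φ : Test X) : ∃ w : R3 → ℝ, Continuous w ∧ (W ≤ flat R3 → w 0 = 0) ∧
      ∀ (s : Fin 4) (η : W), ‖∫ p, κ.smearX φ s p * η.1 p‖ ≤ ∫ p, w p * ‖η.1 p‖ := by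
  obtain ⟨K, hK⟩ := h
  let L : StrongDual ℂ (Test W) → ℂ := fun ℓ => K ℓ φ
  have hL : Continuous L := (continuous_eval_const φ).comp K.continuous
  have hL0 : ∀ᶠ ℓ in nhds (0 : StrongDual ℂ (Test W)), ‖L ℓ‖ < 1 := by
    have h0 : ‖L 0‖ < 1 := by simp [L]
    exact hL.norm.continuousAt.eventually_lt_const h0
  obtain ⟨⟨B, r⟩, ⟨hB, hr⟩, hBr⟩ := (ContinuousLinearMap.hasBasis_nhds_zero_of_basis
    (Metric.nhds_basis_ball (x := (0 : ℂ)))).mem_iff.1 hL0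
  -- A functional bounded by `R` on `B` lies, after multiplication by `r / (R + rδ)`, in the
  -- neighbourhood given by `B` and `r`; the limit `δ → 0` includes the case `R = 0`.
  have key (ℓ : StrongDual ℂ (Test W)) (R : ℝ) (hR : ∀ η ∈ B, ‖ℓ η‖ ≤ R) (hR0 : 0 ≤ R) :
      ‖L ℓ‖ ≤ r⁻¹ * R := by
    refine le_of_forall_pos_le_add fun δ hδ => ?_
    have hd : 0 < R + r * δ := by positivity
    have h1 : ‖L (((r / (R + r * δ) : ℝ) : ℂ) • ℓ)‖ < 1 := hBr fun η hη => by
      simp only [mem_ball_zero_iff, smul_apply, norm_smul, Complex.norm_real]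
      rw [Real.norm_of_nonneg (by positivity), div_mul_eq_mul_div, div_lt_iff₀ hd]
      have := hR η hη
      have h3 : 0 < r * δ := by positivity
      nlinarith
    have h2 : L (((r / (R + r * δ) : ℝ) : ℂ) • ℓ) = ((r / (R + r * δ) : ℝ) : ℂ) * L ℓ := by
      simp [L]
    rw [h2, norm_mul, Complex.norm_real, Real.norm_of_nonneg (by positivity), div_mul_eq_mul_div,
      div_lt_one hd] at h1
    have h4 : ‖L ℓ‖ < r⁻¹ * (R + r * δ) := by
      rw [inv_mul_eq_div, lt_div_iff₀ hr]
      linarith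
    have h5 : r⁻¹ * (R + r * δ) = r⁻¹ * R + δ := by
      field_simp
    linarith
  have hsem (i : ℕ × ℕ) : ∃ M : ℝ, 0 < M ∧ ∀ η ∈ B, ∀ a,
      schwartzSeminormFamily ℂ R3 ℂ i (η a : 𝓢(R3, ℂ)) < M := by
    have h1 (a : Fin 4) : Bornology.IsVonNBounded ℂ
        ((W.subtypeL.comp (ContinuousLinearMap.proj a) : Test W →L[ℂ] 𝓢(R3, ℂ)) '' B) :=
      hB.image _
    have h2 (a : Fin 4) := (schwartz_withSeminorms ℂ R3 ℂ).isVonNBounded_iff_seminorm_bounded.1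
      (h1 a) i
    choose M hM0 hM using h2
    refine ⟨∑ a, M a, Finset.sum_pos (fun a _ => hM0 a) Finset.univ_nonempty, fun η hη a => ?_⟩
    exact (hM a _ ⟨η, hη, rfl⟩).trans_le
      (Finset.single_le_sum (f := M) (fun a _ => (hM0 a).le) (Finset.mem_univ a))
  -- A bounded set of Schwartz functions is dominated by a constant, and by a multiple of `|p|` if
  -- its members vanish at the origin, by the mean value inequality.
  have hw : ∃ w : R3 → ℝ, Continuous w ∧ (W ≤ flat R3 → w 0 = 0) ∧ (∀ p, 0 ≤ w p) ∧
      (∃ C, ∀ p, w p ≤ C * (1 + ‖p‖)) ∧ ∀ η ∈ B, ∀ a p, ‖(η a : 𝓢(R3, ℂ)) p‖ ≤ w p := by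
    by_cases hW : W ≤ flat R3
    · obtain ⟨M, hM0, hM⟩ := hsem (0, 1)
      refine ⟨fun p => ‖p‖ * M, by fun_prop, by simp, fun p => by positivity,
        ⟨M, fun p => by linarith⟩, fun η hη a p => ?_⟩
      refine (FlatAtZero.norm_apply_le 1 (hW (η a).2) p).trans ?_
      rw [pow_one]
      exact mul_le_mul_of_nonneg_left (hM η hη a).le (norm_nonneg p)
    · obtain ⟨M, hM0, hM⟩ := hsem (0, 0)
      refine ⟨fun _ => M, by fun_prop, fun h => absurd h hW, fun p => hM0.le,
        ⟨M, fun p => by nlinarith [norm_nonneg p]⟩, fun η hη a p => ?_⟩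
      exact (SchwartzMap.norm_le_seminorm ℂ _ p).trans (hM η hη a).le
  obtain ⟨w, hwc, hw0, hwn, ⟨C, hC⟩, hwB⟩ := hw
  refine ⟨fun p => r⁻¹ * w p, by fun_prop, fun hW => by simp [hw0 hW], fun s η => ?_⟩
  have hint : Integrable fun p => w p * ‖η.1 p‖ := by
    have h1 : Integrable fun p => C * (‖η.1 p‖ + ‖p‖ * ‖η.1 p‖) := by
      have h2 := η.1.integrable_pow_mul volume 1
      simp only [pow_one] at h2
      exact ((η.1.integrable (μ := volume)).norm.add h2).const_mul C
    refine h1.mono' (by have := η.1.continuous; fun_prop) (Filter.Eventually.of_forall fun p => ?_)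
    rw [Real.norm_of_nonneg (mul_nonneg (hwn p) (norm_nonneg _))]
    calc w p * ‖η.1 p‖ ≤ C * (1 + ‖p‖) * ‖η.1 p‖ :=
          mul_le_mul_of_nonneg_right (hC p) (norm_nonneg _)
      _ = _ := by ring
  have h1 := hK (Pi.single s η) φ
  rw [hκ.sum_integral_smearP_mul] at h1
  simp_rw [mul_comm _ (κ.smearX φ _ _)] at h1
  rw [integral_mul_single] at h1
  rw [← h1]
  simp_rw [mul_assoc]
  rw [integral_const_mul]
  refine key _ _ (fun ζ hζ => ?_) (integral_nonneg fun p => mul_nonneg (hwn p) (norm_nonneg _))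
  rw [toDual_apply]
  simp_rw [mul_comm _ ((ζ _ : 𝓢(R3, ℂ)) _)]
  rw [integral_mul_single]
  refine norm_integral_le_of_norm_le hint (Filter.Eventually.of_forall fun p => ?_)
  rw [norm_mul]
  exact mul_le_mul_of_nonneg_right (hwB ζ hζ s p) (norm_nonneg _)

end

end

section

/-! ### Pointwise bounds by testing with bump functions -/

section Bump

variable {E : Type} [NormedAddCommGroup E] [InnerProductSpace ℝ E] [FiniteDimensional ℝ E]
  [MeasurableSpace E] [BorelSpace E]

/-- A normalized bump function as a Schwartz function. -/
def bumpSchwartz {c : E} (f : ContDiffBump c) : 𝓢(E, ℂ) :=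
  HasCompactSupport.toSchwartzMap (f := fun x => ((f.normed volume x : ℝ) : ℂ))
    (f.hasCompactSupport_normed.comp_left Complex.ofReal_zero)
    (Complex.ofRealCLM.contDiff.comp f.contDiff_normed)

theorem bumpSchwartz_apply {c : E} (f : ContDiffBump c) (x : E) :
    bumpSchwartz f x = ((f.normed volume x : ℝ) : ℂ) := rfl

theorem bumpSchwartz_mem_flat {c : E} (f : ContDiffBump c) (hf : f.rOut < ‖c‖) :
    bumpSchwartz f ∈ flat E := by
  intro n
  by_contra h
  have h1 := support_iteratedFDeriv_subset n (𝕜 := ℝ) (f := bumpSchwartz f) h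
  have h2 : tsupport (bumpSchwartz f) ⊆ Metric.closedBall c f.rOut := by
    refine closure_minimal (fun x hx => ?_) Metric.isClosed_closedBall
    have h3 : x ∈ Function.support (f.normed volume) := fun h => hx (by
      rw [bumpSchwartz_apply, h, Complex.ofReal_zero])
    rw [f.support_normed_eq] at h3
    exact Metric.ball_subset_closedBall h3
  have h4 := h2 h1
  rw [Metric.mem_closedBall, dist_zero_left] at h4
  linarith

theorem bumpSchwartz_center_ne_zero {c : E} (f : ContDiffBump c) : bumpSchwartz f c ≠ 0 := by
  have h : c ∈ Function.support (f.normed volume) := by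
    rw [f.support_normed_eq]
    exact Metric.mem_ball_self f.rOut_pos
  rw [bumpSchwartz_apply]
  exact_mod_cast h

end Bump

/-- If `F` is dominated by `w` as a functional on test functions, then also at its points of
continuity, since bump functions concentrate at a point. -/
theorem norm_le_of_dominated {W : Submodule ℂ 𝓢(R3, ℂ)} (hW : flat R3 ≤ W) {F : R3 → ℂ}
    (hF : Measurable F) {w : R3 → ℝ} (hw : Continuous w)
    (h : ∀ η : W, ‖∫ p, F p * η.1 p‖ ≤ ∫ p, w p * ‖η.1 p‖) {c : R3} (hc : c ≠ 0)
    (hFc : ContinuousAt F c) : ‖F c‖ ≤ w c := by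
  refine le_of_forall_pos_le_add fun δ hδ => ?_
  have h1 : ∀ᶠ p in nhds c, ‖F c - F p‖ < δ / 2 := by
    have : ContinuousAt (fun p => ‖F c - F p‖) c := (continuousAt_const.sub hFc).norm
    exact this.eventually_lt_const (by simpa using half_pos hδ)
  have h2 : ∀ᶠ p in nhds c, w p < w c + δ / 2 :=
    hw.continuousAt.eventually_lt_const (by linarith)
  obtain ⟨r₀, hr₀, hr⟩ := Metric.eventually_nhds_iff_ball.1 (h1.and h2)
  have hc' : 0 < ‖c‖ := norm_pos_iff.2 hc
  -- The radius keeps the support of the bump function away from the origin, so that it lies in `W`.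
  let r := min r₀ (‖c‖ / 2)
  have hr0 : 0 < r := lt_min hr₀ (by positivity)
  let f : ContDiffBump c := ⟨r / 2, r, by positivity, by linarith⟩
  have hfc : f.rOut < ‖c‖ := (min_le_right _ _).trans_lt (by linarith)
  let η : W := ⟨bumpSchwartz f, hW (bumpSchwartz_mem_flat f hfc)⟩
  let u : R3 → ℝ := f.normed volume
  have hu0 (p) : 0 ≤ u p := f.nonneg_normed p
  have hu1 : ∫ p, u p = 1 := f.integral_normed
  have hui : Integrable u := f.integrable_normed
  have hη (p) : η.1 p = (u p : ℂ) := rfl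
  have hηn (p) : ‖η.1 p‖ = u p := by rw [hη, Complex.norm_real, Real.norm_of_nonneg (hu0 p)]
  have hsupp (p) (hp : u p ≠ 0) : p ∈ Metric.ball c r₀ := by
    have : p ∈ Function.support (f.normed volume) := hp
    rw [f.support_normed_eq] at this
    exact Metric.ball_subset_ball (min_le_left _ _) this
  have hmeas : AEStronglyMeasurable (fun p => F p * η.1 p) :=
    (hF.mul η.1.continuous.measurable).aestronglyMeasurable
  have hd (p) : ‖F c * η.1 p - F p * η.1 p‖ ≤ δ / 2 * u p := by
    rw [← sub_mul, norm_mul, hηn]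
    by_cases hp : u p = 0
    · simp [hp]
    · exact mul_le_mul_of_nonneg_right (hr p (hsupp p hp)).1.le (hu0 p)
  have hci : Integrable fun p => F c * η.1 p := (η.1.integrable (μ := volume)).const_mul _
  have hdi : Integrable fun p => F c * η.1 p - F p * η.1 p :=
    (hui.const_mul (δ / 2)).mono' (hci.aestronglyMeasurable.sub hmeas)
      (Filter.Eventually.of_forall hd)
  have hFi : Integrable fun p => F p * η.1 p :=
    (hci.sub hdi).congr (Filter.Eventually.of_forall fun p => by simp)
  have e1 : F c = (∫ p, F p * η.1 p) + ∫ p, (F c * η.1 p - F p * η.1 p) := by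
    rw [integral_sub hci hFi, integral_const_mul]
    have : ∫ p, η.1 p = 1 := by
      simp_rw [hη]
      rw [integral_complex_ofReal, hu1, Complex.ofReal_one]
    rw [this]
    ring
  have e2 : ‖∫ p, (F c * η.1 p - F p * η.1 p)‖ ≤ δ / 2 := by
    refine (norm_integral_le_of_norm_le (hui.const_mul (δ / 2))
      (Filter.Eventually.of_forall hd)).trans (le_of_eq ?_)
    rw [integral_const_mul, hu1, mul_one]
  have e3 : ∫ p, w p * ‖η.1 p‖ ≤ w c + δ / 2 := by
    simp_rw [hηn]
    have hwi : Integrable fun p => w p * u p :=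
      (hw.mul f.continuous_normed).integrable_of_hasCompactSupport
        f.hasCompactSupport_normed.mul_left
    refine (integral_mono hwi (hui.const_mul (w c + δ / 2)) fun p => ?_).trans (le_of_eq ?_)
    · by_cases hp : u p = 0
      · simp [hp]
      · exact mul_le_mul_of_nonneg_right (hr p (hsupp p hp)).2.le (hu0 p)
    · rw [integral_const_mul, hu1, mul_one]
  rw [e1]
  refine (norm_add_le _ _).trans ?_
  linarith [h η]

theorem le_at_zero {u v : R3 → ℝ} (hu : Continuous u) (hv : Continuous v)
    (h : ∀ p ≠ 0, u p ≤ v p) : u 0 ≤ v 0 := by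
  have h1 : closure ({0}ᶜ : Set R3) ⊆ {p | u p ≤ v p} :=
    closure_minimal (fun p hp => h p hp) (isClosed_le hu hv)
  exact h1 ((dense_compl_singleton (0 : R3)) 0)

section

variable {W : Submodule ℂ 𝓢(R3, ℂ)} {X : Submodule ℂ 𝓢(R4, ℂ)}

/-- `κ(φ)` is dominated, for every `φ`, by a continuous function that vanishes at the origin if
the functions in `W` do. -/
def Kernel.Dominated (κ : Kernel) (W : Submodule ℂ 𝓢(R3, ℂ)) (X : Submodule ℂ 𝓢(R4, ℂ)) : Prop :=
  ∀ φ : Test X, ∃ w : R3 → ℝ, Continuous w ∧ (W ≤ flat R3 → w 0 = 0) ∧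
    ∀ (s : Fin 4) (η : W), ‖∫ p, κ.smearX φ s p * η.1 p‖ ≤ ∫ p, w p * ‖η.1 p‖

theorem IsPlaneWave.smearX_single {κ : Kernel} {amp : Fin 4 → Fin 4 → R3 → ℂ} {mom : R3 → R4}
    {back : R4 →L[ℝ] R3} (hκ : IsPlaneWave κ amp mom back) (g : X) (s : Fin 4) :
    κ.smearX (Pi.single 0 g : Test X) s = fun p => amp s 0 p * 𝓕 (g : 𝓢(R4, ℂ)) (mom p) := by
  funext p
  rw [hκ.smearX_eq, Finset.sum_eq_single 0]
  · rw [Pi.single_eq_same]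
  · intro a _ ha
    rw [Pi.single_eq_of_ne ha, Submodule.coe_zero, FourierTransform.fourier_zero]
    simp
  · simp

/-- Domination as a functional yields a pointwise bound off the origin, where the amplitude is
continuous. -/
theorem IsPlaneWave.norm_amp_mul_le {κ : Kernel} {amp : Fin 4 → Fin 4 → R3 → ℂ} {mom : R3 → R4}
    {back : R4 →L[ℝ] R3} (hκ : IsPlaneWave κ amp mom back) (hW : flat R3 ≤ W)
    (hd : κ.Dominated W X) (s : Fin 4) (hamp : ∀ p ≠ 0, ContinuousAt (amp s 0) p) (g : X) :
    ∃ w : R3 → ℝ, Continuous w ∧ (W ≤ flat R3 → w 0 = 0) ∧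
      ∀ p ≠ 0, ‖amp s 0 p‖ * ‖𝓕 (g : 𝓢(R4, ℂ)) (mom p)‖ ≤ w p := by
  obtain ⟨w, hw, hw0, h⟩ := hd (Pi.single 0 g)
  refine ⟨w, hw, hw0, fun p hp => ?_⟩
  rw [← norm_mul]
  have hc : Continuous fun p => 𝓕 (g : 𝓢(R4, ℂ)) (mom p) :=
    (𝓕 (g : 𝓢(R4, ℂ))).continuous.comp hκ.continuous_mom
  have h1 := h s
  simp_rw [hκ.smearX_single] at h1
  exact norm_le_of_dominated hW ((hκ.measurable_amp s 0).mul hc.measurable) hw h1 hp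
    ((hamp p hp).mul hc.continuousAt)

/-- Since the amplitude of the potential is unbounded at the origin, the Fourier transforms of the
test functions have to vanish there. -/
theorem not_dominated_potential₁₀ (hW : flat R3 ≤ W) : ¬ potential₁₀.Dominated W ⊤ := by
  intro hd
  -- A test function whose Fourier transform is a bump at the origin.
  let f : ContDiffBump (0 : R4) := ⟨1, 2, one_pos, one_lt_two⟩
  let g : (⊤ : Submodule ℂ 𝓢(R4, ℂ)) := ⟨𝓕⁻ (bumpSchwartz f), trivial⟩
  have hg : 𝓕 (g : 𝓢(R4, ℂ)) = bumpSchwartz f := FourierTransform.fourier_fourierInv_eq _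
  have hamp : ∀ p ≠ 0, ContinuousAt (potentialAmp 0 0) p := by
    intro p hp
    have hp' : ‖p‖ ≠ 0 := norm_ne_zero_iff.2 hp
    have h1 : (potentialAmp 0 0) =
        fun p => ((potentialConst 0 0 * ‖p‖ ^ (-(1 / 2) : ℝ) : ℝ) : ℂ) :=
      funext fun p => potentialAmp_eq 0 0 p
    rw [h1]
    exact Complex.continuous_ofReal.continuousAt.comp
      (continuousAt_const.mul (continuous_norm.continuousAt.rpow_const (Or.inl hp')))
  obtain ⟨w, hw, -, h⟩ := isPlaneWave_potential₁₀.norm_amp_mul_le hW hd 0 hamp g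
  have hc : 0 < potentialConst 0 0 := by
    have : metric 0 0 = 1 := by simp [metric]
    rw [potentialConst, this]
    positivity
  rw [hg] at h
  have h1 : ∀ p ≠ 0, potentialConst 0 0 * ‖bumpSchwartz f (lightVector (-1) p)‖ ≤
      ‖p‖ ^ (1 / 2 : ℝ) * w p := by
    intro p hp
    have hp' : 0 < ‖p‖ := norm_pos_iff.2 hp
    refine le_trans (le_of_eq ?_) (mul_le_mul_of_nonneg_left (h p hp) (by positivity))
    rw [potentialAmp_eq, Complex.norm_real, Real.norm_of_nonneg (by positivity),
      Real.rpow_neg hp'.le]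
    have : ‖p‖ ^ (1 / 2 : ℝ) ≠ 0 := by positivity
    field_simp
  have h2 := le_at_zero (by
    have h3 := (bumpSchwartz f).continuous.comp (continuous_lightVector (-1))
    exact continuous_const.mul h3.norm)
    ((continuous_norm.rpow_const fun _ => Or.inr (by norm_num)).mul hw) h1
  rw [lightVector_zero, Pi.mul_apply, norm_zero, Real.zero_rpow (by norm_num), zero_mul] at h2
  have h4 : 0 < potentialConst 0 0 * ‖bumpSchwartz f 0‖ :=
    mul_pos hc (norm_pos_iff.2 (bumpSchwartz_center_ne_zero f))
  linarith

/-- The amplitude of the Dirac field does not vanish at the origin, nor do all Fourier transforms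
of test functions vanish at the corresponding wave vector. -/
theorem not_dominated_dirac₁₀ {m : ℝ} (hm : 0 < m) (hX : flatFourier ≤ X) :
    ¬ (dirac₁₀ m).Dominated (flat R3) X := by
  intro hd
  set k : R4 := waveVector (-1) (energy m 0) 0
  have hk : k ≠ 0 := by
    have hE := energy_pos hm 0
    have hπ := Real.pi_pos
    intro h
    have h0 : k 0 = 0 := by rw [h]; rfl
    have h1 : k 0 = -1 * (2 * Real.pi)⁻¹ * energy m 0 := by
      simp [k, waveVector]
    rw [h1] at h0
    have : 0 < (2 * Real.pi)⁻¹ * energy m 0 := by positivity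
    linarith
  have hk' : 0 < ‖k‖ := norm_pos_iff.2 hk
  -- A test function whose Fourier transform is a bump at `k`, supported away from the origin.
  let f : ContDiffBump k := ⟨‖k‖ / 3, ‖k‖ / 2, by positivity, by linarith⟩
  have hg0 : 𝓕 (𝓕⁻ (bumpSchwartz f)) = bumpSchwartz f := FourierTransform.fourier_fourierInv_eq _
  have hmem : 𝓕⁻ (bumpSchwartz f) ∈ flatFourier := by
    change 𝓕 (𝓕⁻ (bumpSchwartz f)) ∈ flat R4
    rw [hg0]
    exact bumpSchwartz_mem_flat f (half_lt_self hk')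
  have hamp := (diracAmp₁₀_hasTemperateGrowth hm 2 0).1.continuous
  obtain ⟨w, hw, hw0, h⟩ := (isPlaneWave_dirac₁₀ hm).norm_amp_mul_le le_rfl hd 2
    (fun p _ => hamp.continuousAt) ⟨_, hX hmem⟩
  simp only [hg0] at h
  have h2 := le_at_zero (hamp.norm.mul (((bumpSchwartz f).continuous.comp
    (isPlaneWave_dirac₁₀ hm).continuous_mom).norm)) hw h
  rw [hw0 le_rfl] at h2
  have h3 : diracAmp₁₀ m 2 0 0 ≠ 0 := by
    have h4 : spinorV m 0 0 0 = spinorNorm m 0 := by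
      have h5 : (Fin.append (chi 0 + chiBoost m 0 0) (-(chi 0 - chiBoost m 0 0)) :
          Fin (2 + 2) → ℂ) (Fin.castAdd 2 0) = 1 := by
        rw [Fin.append_left]
        simp [chi, chiBoost, pauli]
      change spinorNorm m 0 * (Fin.append (chi 0 + chiBoost m 0 0) (-(chi 0 - chiBoost m 0 0)) :
          Fin (2 + 2) → ℂ) (Fin.castAdd 2 0) = _
      rw [h5, mul_one]
    have hE := energy_pos hm 0
    have h6 : spinorNorm m 0 ≠ 0 := by
      rw [spinorNorm, Complex.ofReal_ne_zero]
      positivity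
    have h7 : (((2 * Real.pi) ^ (-(3 / 2) : ℝ) : ℝ) : ℂ) ≠ 0 := by
      rw [Complex.ofReal_ne_zero]
      positivity
    change (((2 * Real.pi) ^ (-(3 / 2) : ℝ) : ℝ) : ℂ) * spinorV m 0 0 0 ≠ 0
    rw [h4]
    exact mul_ne_zero h7 h6
  have h8 : 0 < ‖diracAmp₁₀ m 2 0 0‖ * ‖bumpSchwartz f k‖ :=
    mul_pos (norm_pos_iff.2 h3) (norm_pos_iff.2 (bumpSchwartz_center_ne_zero f))
  exact absurd h2 (not_le.2 h8)

/-! ### The equivalences -/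

/-- A field which is an operator field, and kernels which extend to the duals, dominate `κ₁₀(φ)`;
this fails unless the Fourier transforms of the test functions are flat at the origin. -/
theorem potential_tfae (hW : W ∈ ({flat R3, ⊤} : Set (Submodule ℂ 𝓢(R3, ℂ))))
    (hX : X ∈ ({flatFourier, ⊤} : Set (Submodule ℂ 𝓢(R4, ℂ)))) :
    List.TFAE [FieldMem .bose potential₀₁ potential₁₀ W X,
      potential₀₁.MemTest W X ∧ potential₁₀.MemTest W X,
      potential₀₁.MemDual W X ∧ potential₁₀.MemDual W X,
      flat R3 ≤ W ∧ X ≤ flatFourier] := by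
  have hW' : flat R3 ≤ W := by
    rcases hW with rfl | rfl
    exacts [le_rfl, le_top]
  have hd (h : potential₁₀.Dominated W X) : flat R3 ≤ W ∧ X ≤ flatFourier := by
    refine ⟨hW', ?_⟩
    rcases hX with rfl | rfl
    exacts [le_rfl, absurd h (not_dominated_potential₁₀ hW')]
  tfae_have 4 → 2 := fun h =>
    ⟨memTest_potential (by norm_num) isPlaneWave_potential₀₁ h.1 h.2,
      memTest_potential (by norm_num) isPlaneWave_potential₁₀ h.1 h.2⟩
  tfae_have 2 → 1 := fun h => fieldMem_of_memTest _ h.1 h.2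
  tfae_have 2 → 3 := fun h => ⟨isPlaneWave_potential₀₁.memDual_of_memTest h.1,
    isPlaneWave_potential₁₀.memDual_of_memTest h.2⟩
  tfae_have 1 → 4 := fun h => hd (exists_dominating_of_fieldMem h)
  tfae_have 3 → 4 := fun h => hd (exists_dominating_of_memDual isPlaneWave_potential₁₀ h.2)
  tfae_finish

/-- A field which is an operator field, and kernels which extend to the duals, dominate `κ₁₀(φ)`;
this fails if the functions in `W` vanish at the origin. -/
theorem dirac_tfae {m : ℝ} (hm : 0 < m)
    (hW : W ∈ ({flat R3, ⊤} : Set (Submodule ℂ 𝓢(R3, ℂ))))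
    (hX : X ∈ ({flatFourier, ⊤} : Set (Submodule ℂ 𝓢(R4, ℂ)))) :
    List.TFAE [FieldMem .fermi (dirac₀₁ m) (dirac₁₀ m) W X,
      (dirac₀₁ m).MemTest W X ∧ (dirac₁₀ m).MemTest W X,
      (dirac₀₁ m).MemDual W X ∧ (dirac₁₀ m).MemDual W X,
      ⊤ ≤ W ∧ X ≤ ⊤] := by
  have hX' : flatFourier ≤ X := by
    rcases hX with rfl | rfl
    exacts [le_rfl, le_top]
  have hd (h : (dirac₁₀ m).Dominated W X) : ⊤ ≤ W ∧ X ≤ ⊤ := by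
    refine ⟨?_, le_top⟩
    rcases hW with rfl | rfl
    exacts [absurd h (not_dominated_dirac₁₀ hm hX'), le_rfl]
  tfae_have 4 → 2 := fun h => by
    rw [top_le_iff.1 h.1]
    exact ⟨dirac₀₁_memTest hm X, dirac₁₀_memTest hm X⟩
  tfae_have 2 → 1 := fun h => fieldMem_of_memTest _ h.1 h.2
  tfae_have 2 → 3 := fun h => ⟨(isPlaneWave_dirac₀₁ hm).memDual_of_memTest h.1,
    (isPlaneWave_dirac₁₀ hm).memDual_of_memTest h.2⟩
  tfae_have 1 → 4 := fun h => hd (exists_dominating_of_fieldMem h)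
  tfae_have 3 → 4 := fun h => hd (exists_dominating_of_memDual (isPlaneWave_dirac₁₀ hm) h.2)
  tfae_finish

theorem potential_fieldMem_iff {P : Submodule ℂ 𝓢(R3, ℂ) × Submodule ℂ 𝓢(R4, ℂ)}
    (hP : P ∈ ({(flat R3, flatFourier), (⊤, ⊤)} :
      Set (Submodule ℂ 𝓢(R3, ℂ) × Submodule ℂ 𝓢(R4, ℂ)))) :
    FieldMem .bose potential₀₁ potential₁₀ P.1 P.2 ↔ P = (flat R3, flatFourier) := by
  have h1 : FieldMem .bose potential₀₁ potential₁₀ (flat R3) flatFourier :=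
    ((potential_tfae (Or.inl rfl) (Or.inl rfl)).out 0 3).2
      (⟨le_rfl, le_rfl⟩ : flat R3 ≤ flat R3 ∧ flatFourier ≤ flatFourier)
  refine ⟨fun h => ?_, fun h => by rw [h]; exact h1⟩
  rcases hP with rfl | rfl
  · rfl
  · exact absurd (exists_dominating_of_fieldMem h) (not_dominated_potential₁₀ le_top)

theorem dirac_fieldMem_iff {m : ℝ} (hm : 0 < m)
    {P : Submodule ℂ 𝓢(R3, ℂ) × Submodule ℂ 𝓢(R4, ℂ)}
    (hP : P ∈ ({(flat R3, flatFourier), (⊤, ⊤)} :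
      Set (Submodule ℂ 𝓢(R3, ℂ) × Submodule ℂ 𝓢(R4, ℂ)))) :
    FieldMem .fermi (dirac₀₁ m) (dirac₁₀ m) P.1 P.2 ↔ P = (⊤, ⊤) := by
  have h1 : FieldMem .fermi (dirac₀₁ m) (dirac₁₀ m) ⊤ ⊤ :=
    ((dirac_tfae hm (Or.inr rfl) (Or.inr rfl)).out 0 3).2
      (⟨le_rfl, le_rfl⟩ : (⊤ : Submodule ℂ 𝓢(R3, ℂ)) ≤ ⊤ ∧ (⊤ : Submodule ℂ 𝓢(R4, ℂ)) ≤ ⊤)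
  refine ⟨fun h => ?_, fun h => by rw [h]; exact h1⟩
  rcases hP with rfl | rfl
  · exact absurd (exists_dominating_of_fieldMem h) (not_dominated_dirac₁₀ hm le_rfl)
  · rfl

end

end

end FreeField

end

theorem mainTheorem6 :
    -- the electromagnetic potential
    ((∀ W ∈ ({FreeField.flat FreeField.R3, ⊤} : Set (Submodule ℂ 𝓢(FreeField.R3, ℂ))),
      ∀ X ∈ ({FreeField.flatFourier, ⊤} : Set (Submodule ℂ 𝓢(FreeField.R4, ℂ))),
        List.TFAE
          [FreeField.FieldMem .bose FreeField.potential₀₁ FreeField.potential₁₀ W X,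
            FreeField.potential₀₁.MemTest W X ∧ FreeField.potential₁₀.MemTest W X,
            FreeField.potential₀₁.MemDual W X ∧ FreeField.potential₁₀.MemDual W X,
            FreeField.flat FreeField.R3 ≤ W ∧ X ≤ FreeField.flatFourier]) ∧
      (∀ P ∈ ({(FreeField.flat FreeField.R3, FreeField.flatFourier), (⊤, ⊤)} :
          Set (Submodule ℂ 𝓢(FreeField.R3, ℂ) × Submodule ℂ 𝓢(FreeField.R4, ℂ))),
        FreeField.FieldMem .bose FreeField.potential₀₁ FreeField.potential₁₀ P.1 P.2 ↔
          P = (FreeField.flat FreeField.R3, FreeField.flatFourier)) ∧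
      (FreeField.potential₀₁.MemOM (FreeField.flat FreeField.R3) ∧
        FreeField.potential₁₀.MemOM (FreeField.flat FreeField.R3)) ∧
      (FreeField.potential₀₁.SmoothBounded (FreeField.flat FreeField.R3) ∧
        FreeField.potential₁₀.SmoothBounded (FreeField.flat FreeField.R3))) ∧
    -- the Dirac field of mass m
    (∀ m : ℝ, 0 < m →
      (∀ W ∈ ({FreeField.flat FreeField.R3, ⊤} : Set (Submodule ℂ 𝓢(FreeField.R3, ℂ))),
        ∀ X ∈ ({FreeField.flatFourier, ⊤} : Set (Submodule ℂ 𝓢(FreeField.R4, ℂ))),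
          List.TFAE
            [FreeField.FieldMem .fermi (FreeField.dirac₀₁ m) (FreeField.dirac₁₀ m) W X,
              (FreeField.dirac₀₁ m).MemTest W X ∧ (FreeField.dirac₁₀ m).MemTest W X,
              (FreeField.dirac₀₁ m).MemDual W X ∧ (FreeField.dirac₁₀ m).MemDual W X,
              ⊤ ≤ W ∧ X ≤ ⊤]) ∧
      (∀ P ∈ ({(FreeField.flat FreeField.R3, FreeField.flatFourier), (⊤, ⊤)} :
          Set (Submodule ℂ 𝓢(FreeField.R3, ℂ) × Submodule ℂ 𝓢(FreeField.R4, ℂ))),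
        FreeField.FieldMem .fermi (FreeField.dirac₀₁ m) (FreeField.dirac₁₀ m) P.1 P.2 ↔
          P = (⊤, ⊤)) ∧
      ((FreeField.dirac₀₁ m).MemOM ⊤ ∧ (FreeField.dirac₁₀ m).MemOM ⊤) ∧
      ((FreeField.dirac₀₁ m).SmoothBounded ⊤ ∧ (FreeField.dirac₁₀ m).SmoothBounded ⊤)) := by
  exact ⟨⟨fun W hW X hX => FreeField.potential_tfae hW hX,
      fun P hP => FreeField.potential_fieldMem_iff hP,
      ⟨FreeField.isPlaneWave_potential₀₁.memOM _, FreeField.isPlaneWave_potential₁₀.memOM _⟩,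
      FreeField.isPlaneWave_potential₀₁.smoothBounded _,
      FreeField.isPlaneWave_potential₁₀.smoothBounded _⟩,
    fun m hm => ⟨fun W hW X hX => FreeField.dirac_tfae hm hW hX,
      fun P hP => FreeField.dirac_fieldMem_iff hm hP,
      ⟨(FreeField.isPlaneWave_dirac₀₁ hm).memOM _, (FreeField.isPlaneWave_dirac₁₀ hm).memOM _⟩,
      (FreeField.isPlaneWave_dirac₀₁ hm).smoothBounded _,
      (FreeField.isPlaneWave_dirac₁₀ hm).smoothBounded _⟩⟩
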